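/- Let $X$ be a spectrally positive Lévy process with characteristic triple $(a,0,\pi)_{h\equiv x}$, that is, with no Gaussian component, Lévy measure $\pi(x)\,dx$ where $\pi(x)=0$ for $x<0$, and Laplace exponent ($\mathbb E[e^{zX_t}]=e^{t\psi(z)}$ for $\mathrm{Re}\,z=0$) $$\psi(z)=az+\int_{\mathbb R}\bigl(e^{zx}-1-zx\bigr)\pi(x)\,dx .$$ Assume that $\pi$ is completely monotone on $(0,\infty)$, that the jumps have infinite variation, $\int_{\mathbb R}|x|\pi(x)\,dx=\infty$, and that $\rho:=\sup\{c\ge 0:\int_1^\infty e^{cx}\pi(x)\,dx<\infty\}>0$ (then $\rho<\infty$). By Bernstein's theorem there is a unique positive Radon measure $\mu$ on $(0,\infty)$ with $\pi(x)=\int_{(0,\infty)}e^{-ux}\mu(du)$ for $x>0$; let $\mu^*$ be the image of $\mu$ under $u\mapsto 1/u$, a measure carried by $(0,1/\rho]$. The formula for $\psi$ converges for $\mathrm{Re}\,z<\rho$, and $\psi$ extends analytically to $\mathbb C\setminus[\rho,\infty)$; $\psi'(0)$ and $\psi''(0)$ are real. Fix $k\in\{1,2\}$. For every $n\ge 1$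 the Padé approximant $\psi^{[n+k/n]}$ of $\psi$ at $0$ exists: it is the unique rational function $P/Q$ with $\deg P\le n+k$, $\deg Q\le n$, $Q(0)\neq 0$ and $P(z)/Q(z)=\psi(z)+O(z^{2n+k+1})$ as $z\to0$. Moreover: (i) Let $x_1,\dots,x_n$ and $w_1,\dots,w_n$ be the nodes and the weights of the Gaussian quadrature of order $n$ with respect to the measure $v^{2+k}\mu^*(dv)$ on $[0,1/\rho]$, i.e. the distinct points $x_i$ of $[0,1/\rho]$ and the positive numbers $w_i$ with $\int v^{j}\,v^{2+k}\mu^*(dv)=\sum_{i=1}^n x_i^{j}w_i$ for $0\le j\le 2n-1$. They exist, $x_i>0$ for all $i$, and $$\psi^{[n+k/n]}(z)=\sum_{j=1}^{k}\psi^{(j)}(0)\frac{z^j}{j!}+z^{k+1}\sum_{i=1}^n\frac{w_i}{1-zx_i}.$$ (ii) $\psi^{[n+k/n]}$ is the Laplace exponent of a hyperexponential process $X^{(n)}$, i.e. of a Lévy process whose Lévy density is a finite mixture of exponentials. The Lévy density of $X^{(n)}$ is $$\pi_n(x)=\mathbf 1_{\{x>0\}}\sum_{i=1}^n w_i x_i^{-2-k}e^{-x/x_i},$$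 and its characteristic triple is $(\psi'(0),0,\pi_n)_{h\equiv x}$ if $k=1$, and $\bigl(\psi'(0),\ \psi''(0)-2\sum_{i=1}^n w_i/x_i,\ \pi_n\bigr)_{h\equiv x}$ if $k=2$, where the second entry is the Gaussian coefficient $\sigma^2\ge0$, which contributes $\sigma^2z^2/2$ to the Laplace exponent. (iii) For every compact set $A\subset\mathbb C\setminus[\rho,\infty)$ there are $c_1,c_2>0$, depending on $A$ (and on $\psi$, $k$), such that $|\psi^{[n+k/n]}(z)-\psi(z)|<c_1e^{-c_2n}$ for all $z\in A$ and all $n\ge1$. -/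

import Mathlib

open MeasureTheory ProbabilityTheory Filter Topology Set
open scoped NNReal ENNReal

namespace LevyPade

noncomputable section

/-! ### Lévy processes, Laplace exponents, characteristic triples -/

/-- A real-valued Lévy process: it starts at `0`, has independent and stationary increments and is
continuous in probability. -/
structure IsLevyProcess {Ω : Type*} [MeasurableSpace Ω] (X : ℝ≥0 → Ω → ℝ) (P : Measure Ω) :
    Prop where
  measurable : ∀ t, Measurable (X t)
  start_zero : ∀ᵐ ω ∂P, X 0 ω = 0
  indep_increments : HasIndepIncrements X P
  stationary_increments : ∀ s t, IdentDistrib (fun ω => X (s + t) ω - X s ω) (X t) P P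
  stochastically_continuous : ∀ s, TendstoInMeasure P X (𝓝 s) (X s)

/-- `ψ` is the Laplace exponent of `X` on the imaginary axis:
`E[exp (z X_t)] = exp (t ψ(z))` for all `z = i θ` and all times `t`. -/
def HasLaplaceExponent {Ω : Type*} [MeasurableSpace Ω] (X : ℝ≥0 → Ω → ℝ) (P : Measure Ω)
    (ψ : ℂ → ℂ) : Prop :=
  ∀ (t : ℝ≥0) (θ : ℝ),
    ∫ ω, Complex.exp (Complex.I * θ * X t ω) ∂P = Complex.exp ((t : ℝ) * ψ (Complex.I * θ))

/-- The integrand of the Lévy–Khintchine formula with cutoff function `h`, for a Lévy measure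
with density `π`. -/
def levyIntegrand (h π : ℝ → ℝ) (z : ℂ) (x : ℝ) : ℂ :=
  (Complex.exp (z * x) - 1 - z * h x) * π x

/-- The Lévy–Khintchine formula
`ψ(z) = σ² z² / 2 + a z + ∫ (exp (z x) - 1 - z h(x)) π(x) dx`; the argument `σsq` is `σ²`. -/
def levyExponent (h : ℝ → ℝ) (a σsq : ℝ) (π : ℝ → ℝ) (z : ℂ) : ℂ :=
  σsq * z ^ 2 / 2 + a * z + ∫ x : ℝ, levyIntegrand h π z x

/-- `π` is the density of a Lévy measure: `π ≥ 0` and `∫ min(1, x²) π(x) dx < ∞`. -/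
structure IsLevyDensity (π : ℝ → ℝ) : Prop where
  measurable : Measurable π
  nonneg : ∀ x, 0 ≤ π x
  integrable : Integrable (fun x : ℝ => min 1 (x ^ 2) * π x)

/-- `X` is a Lévy process with characteristic triple `(a, σ², π)` relative to the cutoff
function `h`. -/
structure HasCharacteristicTriple {Ω : Type*} [MeasurableSpace Ω] (X : ℝ≥0 → Ω → ℝ)
    (P : Measure Ω) (h : ℝ → ℝ) (a σsq : ℝ) (π : ℝ → ℝ) : Prop where
  isLevyProcess : IsLevyProcess X P
  nonneg : 0 ≤ σsq
  isLevyDensity : IsLevyDensity π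
  integrable : ∀ θ : ℝ, Integrable (levyIntegrand h π (Complex.I * θ))
  laplaceExponent : HasLaplaceExponent X P (levyExponent h a σsq π)

/-- The jumps have finite variation: `∫ |x| π(x) dx < ∞`. -/
def HasFiniteVariationJumps (π : ℝ → ℝ) : Prop :=
  Integrable (fun x : ℝ => |x| * π x)

/-! ### Completely monotone and hyperexponential jumps -/

/-- Complete monotonicity on `(0, ∞)`: smooth there, with `(-1)^k f^(k) ≥ 0` for all `k`. -/
def CompletelyMonotone (f : ℝ → ℝ) : Prop :=
  ContDiffOn ℝ (⊤ : ℕ∞) f (Ioi 0) ∧ ∀ (k : ℕ) (x : ℝ), 0 < x → 0 ≤ (-1) ^ k * iteratedDeriv k f x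

/-- The largest exponential rate of decay of `π` at `+∞`:
the supremum of the `c ≥ 0` for which `exp (c x) π(x)` is integrable at `+∞`. -/
def decayRate (π : ℝ → ℝ) : ℝ≥0∞ :=
  ⨆ (c : ℝ≥0) (_ : IntegrableOn (fun x : ℝ => Real.exp (c * x) * π x) (Ioi 1)), (c : ℝ≥0∞)

/-- Jump densities of the class `CM(ρ', ρ)`: completely monotone on both half-lines, with
exponential decay rates `ρ' > 0` at `-∞` and `ρ > 0` at `+∞`. -/
structure IsClassCM (π : ℝ → ℝ) (ρ' ρ : ℝ≥0∞) : Prop where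
  completelyMonotone_pos : CompletelyMonotone π
  completelyMonotone_neg : CompletelyMonotone (fun x => π (-x))
  rate_neg : decayRate (fun x => π (-x)) = ρ'
  rate_pos : decayRate π = ρ
  rate_neg_pos : 0 < ρ'
  rate_pos_pos : 0 < ρ

/-- `μ` is the measure on `ℝ \ {0}` that represents `π` as a mixture of exponentials:
`π(x) = ∫_{(0,∞)} exp (-u x) μ(du)` for `x > 0` and `π(x) = ∫_{(-∞,0)} exp (-u x) μ(du)`
for `x < 0`. (Convergence of these integrals makes `μ` finite on compact subsets of
`ℝ \ {0}`.) -/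
structure IsMixingMeasure (μ : Measure ℝ) (π : ℝ → ℝ) : Prop where
  zero : μ {0} = 0
  integrable_pos : ∀ x : ℝ, 0 < x → IntegrableOn (fun u : ℝ => Real.exp (-u * x)) (Ioi 0) μ
  eq_pos : ∀ x : ℝ, 0 < x → π x = ∫ u in Ioi (0 : ℝ), Real.exp (-u * x) ∂μ
  integrable_neg : ∀ x : ℝ, x < 0 → IntegrableOn (fun u : ℝ => Real.exp (-u * x)) (Iio 0) μ
  eq_neg : ∀ x : ℝ, x < 0 → π x = ∫ u in Iio (0 : ℝ), Real.exp (-u * x) ∂μ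

/-- Hyperexponential jumps: the mixing measure is supported on finitely many points. -/
def HasHyperexponentialJumps (π : ℝ → ℝ) : Prop :=
  ∃ μ : Measure ℝ, IsMixingMeasure μ π ∧ μ.support.Finite

/-- The measure `μ*`, the image of `μ` under `u ↦ 1 / u`. -/
def invMeasure (μ : Measure ℝ) : Measure ℝ := μ.map (fun u => u⁻¹)

/-- The measure `v ^ p μ*(dv)` (used when `μ*` is carried by `(0, ∞)`). -/
def powInvMeasure (μ : Measure ℝ) (p : ℕ) : Measure ℝ :=
  (invMeasure μ).withDensity (fun v => ENNReal.ofReal (v ^ p))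

/-! ### Gaussian quadrature and Padé approximants -/

/-- `x` and `w` are the nodes and the weights of the Gaussian quadrature of order `n` for the
measure `ν` on the interval `I`: the measure `∑ w_i δ_{x_i}` is carried by `n` points of `I` and
has the same moments of orders `0, …, 2n - 1` as `ν`. -/
structure IsGaussianQuadrature (ν : Measure ℝ) (I : Set ℝ) {n : ℕ} (x w : Fin n → ℝ) :
    Prop where
  injective : Function.Injective x
  mem : ∀ i, x i ∈ I
  weight_pos : ∀ i, 0 < w i
  integrable : ∀ j < 2 * n, Integrable (fun v : ℝ => v ^ j) ν
  moment_eq : ∀ j < 2 * n, ∫ v, v ^ j ∂ν = ∑ i, x i ^ j * w i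

/-- `R` is the `[m/n]` Padé approximant of `f` at the point `a`. The fraction `P / Q` is taken in
lowest terms, so that the function `R` is uniquely determined (with value `0` at its poles). -/
def IsPadeApproximant (f : ℂ → ℂ) (a : ℂ) (m n : ℕ) (R : ℂ → ℂ) : Prop :=
  ∃ p q : Polynomial ℂ, p.natDegree ≤ m ∧ q.natDegree ≤ n ∧ q.eval a ≠ 0 ∧ IsCoprime p q ∧
    (∀ z, R z = p.eval z / q.eval z) ∧
    (fun z => R z - f z) =O[𝓝 a] (fun z => (z - a) ^ (m + n + 1))

/-- The cut plane `ℂ \ [ρ, ∞)`. -/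
def cutPlane (ρ : ℝ) : Set ℂ := ((fun r : ℝ => (r : ℂ)) '' Ici ρ)ᶜ

/-- The hyperexponential density `1_{x > 0} ∑ w_i x_i^{-p} exp (-x / x_i)`. -/
def quadratureDensity {n : ℕ} (p : ℕ) (x w : Fin n → ℝ) (y : ℝ) : ℝ :=
  if 0 < y then ∑ i, w i / x i ^ p * Real.exp (-y / x i) else 0

end

end LevyPade

namespace LevyPade

/-! ### Bernstein's theorem -/

/-! By Bernstein, π is a mixture of exponentials e^{-ux} with mixing measure μ
(`IsCMSequence.exists_measure`). Integrating e^{zx} - 1 - zx against e^{-ux} gives z²/(u²(u - z)),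
so with v = 1/u the exponent is az + z² ∫ v³ μ*(dv)/(1 - zv)
(`IsOneSidedLevyDensity.levyExponent_eq`): up to a polynomial, ψ is a power of z times the Stieltjes
function of a measure ν on (0, 1/ρ]. The identity 1/(1 - zv) = 1 + zv/(1 - zv) passes from k = 1 to
k = 2. Each hypothesis has its translation: exponential decay puts μ on [ρ, ∞), integrability of x²π
makes ∫ u⁻³ dμ finite, hence ν finite, and infinite variation makes ∫ u⁻² dμ infinite, so that no
finite set carries ν and Gaussian quadrature of every order exists
(`IsMomentMeasure.exists_isGaussianQuadrature`).

A quadrature that reproduces 2n moments changes the Stieltjes function by O(z^{2n}) and therefore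
the exponent by O(z^{2n+k+1}). The result is a rational function of the right degrees, hence the
Padé approximant (`exists_isPadeApproximant`); uniqueness comes from cross-multiplication
(`IsPadeApproximant.unique`). Because the weights are positive, the quadrature error is at most
twice the mass of ν times the uniform distance to polynomials of degree below 2n. For z off the cut,
some disc contains [0, 1/ρ] but not 1/z, and a geometric series about its centre makes that distance
exponentially small, locally uniformly in z (`exists_center`, `exists_geometric_bound`).

Partial fractions identify the approximant with the exponent of a hyperexponential triple. For k = 2
its Gaussian coefficient is nonnegative since the quadrature underestimates ∫ v⁻¹ dν
(`IsGaussianQuadrature.sum_div_le`). The process itself is built as compound Poisson plus Brownian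
motion plus drift, and all its properties are read off the joint characteristic functions of
increments (`exists_hasCharacteristicTriple`). -/

/-- A sequence of successive derivatives on `(0, ∞)` with alternating signs, starting at `F 0`. -/
structure IsCMSequence (F : ℕ → ℝ → ℝ) : Prop where
  hasDerivAt : ∀ k x, 0 < x → HasDerivAt (F k) (F (k + 1) x) x
  sign : ∀ k x, 0 < x → 0 ≤ (-1) ^ k * F k x

lemma CompletelyMonotone.isCMSequence {f : ℝ → ℝ} (hf : CompletelyMonotone f) :
    IsCMSequence (fun k => iteratedDeriv k f) where
  hasDerivAt k x hx := by
    have hmem : Ioi (0 : ℝ) ∈ 𝓝 x := Ioi_mem_nhds hx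
    have h1 := hf.1.differentiableOn_iteratedDerivWithin (m := k)
      (by exact_mod_cast WithTop.coe_lt_top _) isOpen_Ioi.uniqueDiffOn
    have h2 : DifferentiableAt ℝ (iteratedDerivWithin k f (Ioi 0)) x :=
      (h1 x hx).differentiableAt hmem
    have h3 : iteratedDerivWithin k f (Ioi 0) =ᶠ[𝓝 x] iteratedDeriv k f :=
      Filter.eventuallyEq_of_mem hmem (iteratedDerivWithin_of_isOpen isOpen_Ioi)
    have h4 := (h2.congr_of_eventuallyEq h3.symm).hasDerivAt
    rwa [← iteratedDeriv_succ] at h4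
  sign := hf.2

/-- The Taylor polynomial with `n` terms at the centre `t`, evaluated at `y`. -/
noncomputable def taylorSum (F : ℕ → ℝ → ℝ) (y : ℝ) (n : ℕ) (t : ℝ) : ℝ :=
  ∑ k ∈ Finset.range n, F k t * (y - t) ^ k / (k.factorial : ℝ)

/-- Differentiation in the centre telescopes: each term cancels against part of the next one, and
only the top order survives. This single formula gives both the monotonicity in the centre and the
remainder estimate. -/
lemma IsCMSequence.hasDerivAt_taylorSum {F : ℕ → ℝ → ℝ} (hF : IsCMSequence F) (y : ℝ) (n : ℕ)
    {t : ℝ} (ht : 0 < t) :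
    HasDerivAt (taylorSum F y (n + 1)) (F (n + 1) t * (y - t) ^ n / (n.factorial : ℝ)) t := by
  induction n with
  | zero =>
    have := hF.hasDerivAt 0 t ht
    have h0 : taylorSum F y (0 + 1) = F 0 := by funext s; simp [taylorSum]
    rw [h0]
    simpa using this
  | succ n ih =>
    have h1 : HasDerivAt (fun t : ℝ => (y - t) ^ (n + 1)) (((n + 1 : ℕ) : ℝ) * (y - t) ^ n * (-1)) t := by
      have := ((hasDerivAt_id t).const_sub y).pow (n + 1)
      exact this.congr_deriv (by simp)
    have h2 := ((hF.hasDerivAt (n + 1) t ht).mul h1).div_const ((n + 1).factorial : ℝ)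
    have h3 := ih.add h2
    have h4 : taylorSum F y (n + 1 + 1) = fun s => taylorSum F y (n + 1) s
        + F (n + 1) s * (y - s) ^ (n + 1) / ((n + 1).factorial : ℝ) := by
      funext s
      simp [taylorSum, Finset.sum_range_succ]
    rw [h4]
    refine HasDerivAt.congr_deriv (f := fun s => taylorSum F y (n + 1) s
        + F (n + 1) s * (y - s) ^ (n + 1) / ((n + 1).factorial : ℝ)) h3 ?_
    have : (n.factorial : ℝ) ≠ 0 := by positivity
    rw [Nat.factorial_succ]
    push_cast
    field_simp
    ring

lemma taylorSum_self (F : ℕ → ℝ → ℝ) (y : ℝ) (n : ℕ) : taylorSum F y (n + 1) y = F 0 y := by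
  simp [taylorSum, Finset.sum_range_succ']

lemma IsCMSequence.term_nonneg {F : ℕ → ℝ → ℝ} (hF : IsCMSequence F) (k : ℕ) {y t : ℝ}
    (ht : 0 < t) (hyt : y ≤ t) : 0 ≤ F k t * (y - t) ^ k / (k.factorial : ℝ) := by
  have h1 := hF.sign k t ht
  have h2 : F k t * (y - t) ^ k = ((-1) ^ k * F k t) * (t - y) ^ k := by
    rw [← neg_sub t y, neg_pow]; ring
  rw [h2]
  have : 0 ≤ (t - y) ^ k := pow_nonneg (by linarith) _
  positivity

/-- The alternating signs make the Taylor sum decrease as its centre moves to the right of y, where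
it starts from the exact value. -/
lemma IsCMSequence.taylorSum_le {F : ℕ → ℝ → ℝ} (hF : IsCMSequence F) (n : ℕ) {y t : ℝ}
    (hy : 0 < y) (hyt : y ≤ t) : taylorSum F y (n + 1) t ≤ F 0 y := by
  rw [← taylorSum_self F y n]
  have hanti : AntitoneOn (taylorSum F y (n + 1)) (Ici y) := by
    refine antitoneOn_of_deriv_nonpos (convex_Ici y) (fun s hs => ?_) (fun s hs => ?_)
      (fun s hs => ?_)
    · exact (hF.hasDerivAt_taylorSum y n (hy.trans_le hs)).continuousAt.continuousWithinAt
    · rw [interior_Ici] at hs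
      exact (hF.hasDerivAt_taylorSum y n (hy.trans hs)).differentiableAt.differentiableWithinAt
    · rw [interior_Ici] at hs
      have hs' : y < s := hs
      rw [(hF.hasDerivAt_taylorSum y n (hy.trans hs)).deriv]
      have h1 := hF.sign (n + 1) s (hy.trans hs)
      have h2 : F (n + 1) s * (y - s) ^ n = -(((-1) ^ (n + 1) * F (n + 1) s) * (s - y) ^ n) := by
        rw [← neg_sub s y, neg_pow]; ring
      rw [h2, neg_div, neg_nonpos]
      have : 0 ≤ (s - y) ^ n := pow_nonneg (by linarith) _
      positivity
  exact hanti (mem_Ici.2 le_rfl) hyt hyt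

/-- All Taylor terms to the left of the centre are nonnegative, so one of them is at most their sum.
This plays the role of a Cauchy estimate. -/
lemma IsCMSequence.abs_le {F : ℕ → ℝ → ℝ} (hF : IsCMSequence F) (n : ℕ) {y t : ℝ}
    (hy : 0 < y) (hyt : y < t) :
    (-1) ^ n * F n t ≤ n.factorial * F 0 y / (t - y) ^ n := by
  have h1 := hF.taylorSum_le n hy hyt.le
  have h2 : F n t * (y - t) ^ n / (n.factorial : ℝ) ≤ taylorSum F y (n + 1) t :=
    Finset.single_le_sum (f := fun k => F k t * (y - t) ^ k / (k.factorial : ℝ))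
      (fun k _ => hF.term_nonneg k (hy.trans hyt) hyt.le) (Finset.mem_range.2 (Nat.lt_succ_self n))
  have h3 := h2.trans h1
  have h4 : F n t * (y - t) ^ n = ((-1) ^ n * F n t) * (t - y) ^ n := by
    rw [← neg_sub t y, neg_pow]; ring
  rw [h4, div_le_iff₀ (by positivity)] at h3
  rw [le_div_iff₀ (pow_pos (by linarith) _)]
  linarith

/-- The Taylor series of a completely monotone function converges to it to the left of the
centre. -/
lemma IsCMSequence.hasSum_taylor {F : ℕ → ℝ → ℝ} (hF : IsCMSequence F) {y T : ℝ}
    (hy : 0 < y) (hyT : y < T) :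
    HasSum (fun k : ℕ => F k T * (y - T) ^ k / (k.factorial : ℝ)) (F 0 y) := by
  have hT : 0 < T := hy.trans hyT
  rw [hasSum_iff_tendsto_nat_of_nonneg (fun k => hF.term_nonneg k hT hyT.le)]
  rw [← tendsto_add_atTop_iff_nat 1]
  change Tendsto (fun n => taylorSum F y (n + 1) T) atTop (𝓝 (F 0 y))
  -- The derivative bound is applied from the base point y / 2 rather than y: the remainder at ξ
  -- then carries the ratio (ξ - y) / (ξ - y / 2) < 1, which increases in ξ, and r is its value at
  -- T.
  set r : ℝ := (T - y) / (T - y / 2) with hr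
  have hr0 : 0 ≤ r := div_nonneg (by linarith) (by linarith)
  have hr1 : r < 1 := by rw [hr, div_lt_one (by linarith)]; linarith
  have hF0 : 0 ≤ F 0 (y / 2) := by simpa using hF.sign 0 (y / 2) (by linarith)
  set C : ℝ := (T - y) * F 0 (y / 2) * (2 / y) with hC
  have hbound : ∀ n : ℕ, F 0 y - taylorSum F y (n + 1) T ≤ C * ((n : ℝ) * r ^ n + r ^ n) := by
    intro n
    -- Mean value theorem in the centre, between y and T; this produces a Cauchy form of the
    -- remainder.
    obtain ⟨ξ, hξ, hξe⟩ := exists_hasDerivAt_eq_slope (taylorSum F y (n + 1))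
      (fun t => F (n + 1) t * (y - t) ^ n / (n.factorial : ℝ)) hyT
      (fun s hs => (hF.hasDerivAt_taylorSum y n
        (hy.trans_le hs.1)).continuousAt.continuousWithinAt)
      (fun s hs => hF.hasDerivAt_taylorSum y n (hy.trans hs.1))
    rw [taylorSum_self, eq_div_iff (by linarith)] at hξe
    have h1 := hF.abs_le (n + 1) (y := y / 2) (t := ξ) (by linarith) (by linarith [hξ.1])
    have h2 : F (n + 1) ξ * (y - ξ) ^ n = -(((-1) ^ (n + 1) * F (n + 1) ξ) * (ξ - y) ^ n) := by
      rw [← neg_sub ξ y, neg_pow]; ring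
    have h3 : F 0 y - taylorSum F y (n + 1) T
        = (T - y) * (((-1) ^ (n + 1) * F (n + 1) ξ) * (ξ - y) ^ n / (n.factorial : ℝ)) := by
      simp only [h2] at hξe
      linear_combination hξe
    have hpos : 0 < ξ - y / 2 := by linarith [hξ.1]
    have h4 : ((-1) ^ (n + 1) * F (n + 1) ξ) * (ξ - y) ^ n / (n.factorial : ℝ)
        ≤ ((n + 1).factorial * F 0 (y / 2) / (ξ - y / 2) ^ (n + 1)) * (ξ - y) ^ n
          / (n.factorial : ℝ) := by
      have : 0 ≤ (ξ - y) ^ n := pow_nonneg (by linarith [hξ.1]) _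
      gcongr
    have h5 : ((n + 1).factorial * F 0 (y / 2) / (ξ - y / 2) ^ (n + 1)) * (ξ - y) ^ n
          / (n.factorial : ℝ)
        = ((n : ℝ) + 1) * F 0 (y / 2) * (1 / (ξ - y / 2)) * ((ξ - y) / (ξ - y / 2)) ^ n := by
      have : (n.factorial : ℝ) ≠ 0 := by positivity
      have hp := hpos.ne'
      generalize ξ - y / 2 = s at hp
      rw [Nat.factorial_succ, div_pow]
      push_cast
      field_simp
      ring
    have h6 : (ξ - y) / (ξ - y / 2) ≤ r := by
      rw [hr, div_le_div_iff₀ hpos (by linarith)]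
      nlinarith [hξ.1, hξ.2]
    have h7 : 1 / (ξ - y / 2) ≤ 2 / y := by
      rw [div_le_div_iff₀ hpos hy]; linarith [hξ.1]
    have h8 : 0 ≤ (ξ - y) / (ξ - y / 2) := div_nonneg (by linarith [hξ.1]) hpos.le
    have h9 : ((n : ℝ) + 1) * F 0 (y / 2) * (1 / (ξ - y / 2)) * ((ξ - y) / (ξ - y / 2)) ^ n
        ≤ ((n : ℝ) + 1) * F 0 (y / 2) * (2 / y) * r ^ n := by
      gcongr
    rw [h3]
    calc _ ≤ (T - y) * (((n : ℝ) + 1) * F 0 (y / 2) * (2 / y) * r ^ n) :=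
          mul_le_mul_of_nonneg_left (h4.trans (h5.le.trans h9)) (by linarith)
      _ = _ := by rw [hC]; ring
  have hlim : Tendsto (fun n : ℕ => C * ((n : ℝ) * r ^ n + r ^ n)) atTop (𝓝 0) := by
    have := ((tendsto_self_mul_const_pow_of_lt_one hr0 hr1).add
      (tendsto_pow_atTop_nhds_zero_of_lt_one hr0 hr1)).const_mul C
    simpa using this
  have hd : Tendsto (fun n => F 0 y - taylorSum F y (n + 1) T) atTop (𝓝 0) :=
    squeeze_zero (fun n => sub_nonneg.2 (hF.taylorSum_le n hy hyT.le)) hbound hlim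
  have := hd.const_sub (F 0 y)
  simpa using this

lemma IsCMSequence.antitoneOn {F : ℕ → ℝ → ℝ} (hF : IsCMSequence F) :
    AntitoneOn (F 0) (Ioi 0) := by
  intro x hx y hy hxy
  have := hF.taylorSum_le 0 hx hxy
  simpa [taylorSum] using this


/-! ### Discrete approximations of the Bernstein measure -/

/-- The discrete measure whose Laplace transform at `x - 1` is `F 0 (N (1 - exp (-x / N)))`. -/
noncomputable def bernsteinMeasure (F : ℕ → ℝ → ℝ) (N : ℕ) : Measure ℝ :=
  Measure.sum fun k : ℕ => ENNReal.ofReal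
    ((-1) ^ k * F k N * (N : ℝ) ^ k / (k.factorial : ℝ) * Real.exp (-(k / N))) •
      Measure.dirac ((k : ℝ) / N)

/-- The points at which `F 0` is evaluated by the Laplace transform of `bernsteinMeasure F N`. -/
noncomputable def bernsteinNode (x : ℝ) (N : ℕ) : ℝ := N * (1 - Real.exp (-(x / N)))

lemma bernsteinNode_pos {x : ℝ} (hx : 0 < x) {N : ℕ} (hN : 0 < N) : 0 < bernsteinNode x N := by
  have hN' : (0 : ℝ) < N := by exact_mod_cast hN
  have : Real.exp (-(x / N)) < 1 := by rw [Real.exp_lt_one_iff]; simp; positivity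
  exact mul_pos hN' (by linarith)

lemma bernsteinNode_lt (x : ℝ) {N : ℕ} (hN : 0 < N) : bernsteinNode x N < N := by
  have hN' : (0 : ℝ) < N := by exact_mod_cast hN
  have := Real.exp_pos (-(x / N))
  unfold bernsteinNode
  nlinarith

/-- The point is that the lower bound does not depend on N: as `F 0` is antitone, it bounds the
Laplace transforms uniformly in N, which gives tightness. It follows from 1 - e^{-s} ≥ s / (1 + s).
-/
lemma le_bernsteinNode {x : ℝ} (hx : 0 < x) {N : ℕ} (hN : 0 < N) :
    x / (1 + x) ≤ bernsteinNode x N := by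
  have hN1 : (1 : ℝ) ≤ N := by exact_mod_cast hN
  have hN' : (0 : ℝ) < N := by linarith
  have h1 : 1 + x / N ≤ Real.exp (x / N) := by linarith [Real.add_one_le_exp (x / N)]
  have h2 : Real.exp (-(x / N)) ≤ 1 / (1 + x / N) := by
    rw [Real.exp_neg, ← one_div]
    exact one_div_le_one_div_of_le (by positivity) h1
  have h3 : x / (1 + x) ≤ N * (1 - 1 / (1 + x / N)) := by
    have : (N : ℝ) * (1 - 1 / (1 + x / N)) = N * x / (N + x) := by field_simp; ring
    rw [this, div_le_div_iff₀ (by positivity) (by positivity)]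
    nlinarith [mul_nonneg (mul_self_nonneg x) (sub_nonneg.2 hN1)]
  refine h3.trans ?_
  unfold bernsteinNode
  gcongr

lemma tendsto_bernsteinNode (x : ℝ) : Tendsto (bernsteinNode x) atTop (𝓝 x) := by
  have h1 : HasDerivAt (fun s : ℝ => 1 - Real.exp (-(x * s))) x 0 := by
    have := (((hasDerivAt_id (0 : ℝ)).const_mul x).neg.exp).const_sub 1
    exact this.congr_deriv (by simp)
  have h2 := h1.tendsto_slope_zero_right
  have h3 : Tendsto (fun N : ℕ => ((N : ℝ))⁻¹) atTop (𝓝[>] 0) := by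
    refine tendsto_nhdsWithin_iff.2 ⟨tendsto_inv_atTop_nhds_zero_nat, ?_⟩
    filter_upwards [eventually_gt_atTop 0] with N hN
    have : (0 : ℝ) < N := by exact_mod_cast hN
    exact inv_pos.2 this
  refine (h2.comp h3).congr fun N => ?_
  simp [bernsteinNode, div_eq_mul_inv]

/-- This is the Taylor series at the centre N: the displacement of the node is -N e^{-x/N}, whose
k-th power supplies e^{-kx/N}. The factor e^{-k/N} in the weights is a tilt that makes the total
mass finite, at the price of the shift from x to x - 1. -/
lemma lintegral_bernsteinMeasure {F : ℕ → ℝ → ℝ} (hF : IsCMSequence F) {N : ℕ} (hN : 0 < N)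
    {x : ℝ} (hx : 0 < x) :
    ∫⁻ u, ENNReal.ofReal (Real.exp ((1 - x) * u)) ∂(bernsteinMeasure F N)
      = ENNReal.ofReal (F 0 (bernsteinNode x N)) := by
  have hN' : (0 : ℝ) < N := by exact_mod_cast hN
  have hsum := hF.hasSum_taylor (bernsteinNode_pos hx hN) (bernsteinNode_lt x hN)
  have hnn : ∀ k, 0 ≤ F k N * (bernsteinNode x N - N) ^ k / (k.factorial : ℝ) := fun k =>
    hF.term_nonneg k hN' (bernsteinNode_lt x hN).le
  rw [← hsum.tsum_eq, ENNReal.ofReal_tsum_of_nonneg hnn hsum.summable, bernsteinMeasure,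
    lintegral_sum_measure]
  congr 1
  funext k
  rw [lintegral_smul_measure, lintegral_dirac, smul_eq_mul, ← ENNReal.ofReal_mul]
  · congr 1
    have h1 : bernsteinNode x N - N = - (N * Real.exp (-(x / N))) := by
      unfold bernsteinNode; ring
    have h2 : Real.exp ((1 - x) * (k / N)) * Real.exp (-(k / N)) = Real.exp (-(x / N)) ^ k := by
      rw [← Real.exp_add, ← Real.exp_nat_mul]
      congr 1
      ring
    rw [h1, neg_pow ((N : ℝ) * _), mul_pow, ← h2]
    ring
  · have h1 := hF.sign k N hN'
    positivity

lemma bernsteinMeasure_Iio_zero (F : ℕ → ℝ → ℝ) (N : ℕ) : bernsteinMeasure F N (Iio 0) = 0 := by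
  rw [bernsteinMeasure, Measure.sum_apply _ measurableSet_Iio, ENNReal.tsum_eq_zero]
  intro k
  have : ¬ ((k : ℝ) / N < 0) := not_lt.2 (by positivity)
  simp [this]


lemma lintegral_bernsteinMeasure_le {F : ℕ → ℝ → ℝ} (hF : IsCMSequence F) {N : ℕ} (hN : 0 < N)
    {x : ℝ} (hx : 0 < x) :
    ∫⁻ u, ENNReal.ofReal (Real.exp ((1 - x) * u)) ∂(bernsteinMeasure F N)
      ≤ ENNReal.ofReal (F 0 (x / (1 + x))) := by
  rw [lintegral_bernsteinMeasure hF hN hx]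
  exact ENNReal.ofReal_le_ofReal (hF.antitoneOn (mem_Ioi.2 (by positivity))
    (bernsteinNode_pos hx hN) (le_bernsteinNode hx hN))

lemma ae_nonneg_bernsteinMeasure (F : ℕ → ℝ → ℝ) (N : ℕ) :
    ∀ᵐ u ∂(bernsteinMeasure F N), 0 ≤ u := by
  rw [ae_iff]
  simp only [not_le]
  exact bernsteinMeasure_Iio_zero F N

lemma bernsteinMeasure_univ_le {F : ℕ → ℝ → ℝ} (hF : IsCMSequence F) {N : ℕ} (hN : 0 < N) :
    bernsteinMeasure F N univ ≤ ENNReal.ofReal (F 0 (1 / (1 + 1))) := by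
  have := lintegral_bernsteinMeasure_le hF hN one_pos
  simpa using this

/-- Markov's inequality with the transform at x = 1/2: on u > j one has 1 ≤ e^{-j/2} e^{u/2}. -/
lemma bernsteinMeasure_compl_Icc_le {F : ℕ → ℝ → ℝ} (hF : IsCMSequence F) {N : ℕ} (hN : 0 < N)
    (j : ℕ) : bernsteinMeasure F N (Icc 0 (j : ℝ))ᶜ
      ≤ ENNReal.ofReal (Real.exp (-(j / 2)) * F 0 ((1 / 2) / (1 + 1 / 2))) := by
  have h0 : (Icc 0 (j : ℝ))ᶜ ⊆ Iio 0 ∪ Ioi (j : ℝ) := by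
    intro u hu
    simp only [mem_compl_iff, mem_Icc, not_and_or, not_le] at hu
    exact hu
  have h1 : bernsteinMeasure F N (Icc 0 (j : ℝ))ᶜ ≤ bernsteinMeasure F N (Ioi (j : ℝ)) := by
    refine (measure_mono h0).trans ((measure_union_le _ _).trans ?_)
    rw [bernsteinMeasure_Iio_zero, zero_add]
  refine h1.trans ?_
  rw [ENNReal.ofReal_mul (Real.exp_nonneg _)]
  refine le_trans ?_ (mul_le_mul_right (lintegral_bernsteinMeasure_le hF hN (by norm_num)) _)
  rw [← lintegral_const_mul _ (by fun_prop), ← lintegral_indicator_one measurableSet_Ioi]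
  refine lintegral_mono fun u => ?_
  by_cases hu : (j : ℝ) < u
  · rw [indicator_of_mem (mem_Ioi.2 hu), Pi.one_apply, ← ENNReal.ofReal_mul (Real.exp_nonneg _),
      ← Real.exp_add, ENNReal.one_le_ofReal, Real.one_le_exp_iff]
    linarith
  · rw [indicator_of_notMem (by simpa using hu)]
    positivity

/-- A limit point of the Bernstein measures. -/
lemma exists_tendsto_bernsteinMeasure {F : ℕ → ℝ → ℝ} (hF : IsCMSequence F) :
    ∃ m : Measure ℝ, IsFiniteMeasure m ∧ ∀ g : BoundedContinuousFunction ℝ ℝ,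
      Tendsto (fun N => ∫ u, g u ∂(bernsteinMeasure F (N + 1)))
        (hyperfilter ℕ : Filter ℕ) (𝓝 (∫ u, g u ∂m)) := by
  have hfin : ∀ N, IsFiniteMeasure (bernsteinMeasure F (N + 1)) := fun N =>
    ⟨(bernsteinMeasure_univ_le hF N.succ_pos).trans_lt ENNReal.ofReal_lt_top⟩
  let ms : ℕ → FiniteMeasure ℝ := fun N => ⟨bernsteinMeasure F (N + 1), hfin N⟩
  let u : ℕ → ℝ≥0 := fun j => (Real.exp (-(j / 2)) * F 0 ((1 / 2) / (1 + 1 / 2))).toNNReal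
  have hu : Tendsto u atTop (𝓝 0) := by
    have h1 : Tendsto (fun j : ℕ => Real.exp (-((j : ℝ) / 2))) atTop (𝓝 0) :=
      Real.tendsto_exp_atBot.comp (tendsto_neg_atTop_atBot.comp
        (tendsto_natCast_atTop_atTop.atTop_div_const two_pos))
    have h2 := (h1.mul_const (F 0 ((1 / 2) / (1 + 1 / 2))))
    rw [zero_mul] at h2
    have h3 := (continuous_real_toNNReal.tendsto 0).comp h2
    rwa [Real.toNNReal_zero] at h3
  -- Prokhorov compactness. The limit is taken along an ultrafilter, so that no subsequence has to
  -- be extracted.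
  have hcomp := isCompact_setOfPred_finiteMeasure_mass_le_compl_isCompact_le (E := ℝ) (u := u)
    (K := fun j : ℕ => Icc 0 (j : ℝ)) (F 0 (1 / (1 + 1))).toNNReal hu (fun n => isCompact_Icc)
    (Or.inr fun i j hij => Icc_subset_Icc_right (by exact_mod_cast hij))
  have hmem : ∀ N, ms N ∈ {μ : FiniteMeasure ℝ | μ.mass ≤ (F 0 (1 / (1 + 1))).toNNReal
      ∧ ∀ n : ℕ, μ (Icc 0 (n : ℝ))ᶜ ≤ u n} := by
    intro N
    refine ⟨?_, fun n => ?_⟩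
    · rw [← ENNReal.coe_le_coe, FiniteMeasure.ennreal_mass]
      exact bernsteinMeasure_univ_le hF N.succ_pos
    · rw [← ENNReal.coe_le_coe, FiniteMeasure.ennreal_coeFn_eq_coeFn_toMeasure]
      exact bernsteinMeasure_compl_Icc_le hF N.succ_pos n
  obtain ⟨m, -, hm⟩ := hcomp.ultrafilter_le_nhds' ((hyperfilter ℕ).map ms)
    (Ultrafilter.mem_map.2 (Filter.univ_mem' hmem))
  refine ⟨m, inferInstance, ?_⟩
  exact FiniteMeasure.tendsto_iff_forall_integral_tendsto.1 hm

/-- The function `exp ((1 - x) u)`, cut off to the right of `R`. -/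
noncomputable def expCutoff (x : ℝ) (R : ℕ) (u : ℝ) : ℝ :=
  Real.exp ((1 - x) * max u 0) * max 0 (min 1 (R + 1 - u))

lemma expCutoff_nonneg (x : ℝ) (R : ℕ) (u : ℝ) : 0 ≤ expCutoff x R u :=
  mul_nonneg (Real.exp_nonneg _) (le_max_left _ _)

/-- `expCutoff` as a bounded continuous function. -/
noncomputable def expCutoffBCF (x : ℝ) (R : ℕ) : BoundedContinuousFunction ℝ ℝ :=
  BoundedContinuousFunction.ofNormedAddCommGroup (expCutoff x R)
    (by unfold expCutoff; fun_prop) (Real.exp (|1 - x| * (R + 1))) (by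
      intro u
      rw [Real.norm_of_nonneg (expCutoff_nonneg x R u)]
      unfold expCutoff
      by_cases hu : u ≤ R + 1
      · have h1 : max 0 (min 1 ((R : ℝ) + 1 - u)) ≤ 1 := max_le zero_le_one (min_le_left _ _)
        have h2 : (1 - x) * max u 0 ≤ |1 - x| * (R + 1) :=
          mul_le_mul (le_abs_self _) (max_le hu (by positivity)) (le_max_right _ _) (abs_nonneg _)
        calc _ ≤ Real.exp (|1 - x| * (R + 1)) * 1 :=
              mul_le_mul (Real.exp_le_exp.2 h2) h1 (le_max_left _ _) (Real.exp_nonneg _)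
          _ = _ := mul_one _
      · have : max 0 (min 1 ((R : ℝ) + 1 - u)) = 0 :=
          max_eq_left ((min_le_right _ _).trans (by linarith))
        rw [this, mul_zero]
        exact Real.exp_nonneg _)

/-- For x < 1 the function e^{(1-x)u} is unbounded, so weak convergence does not apply to it
directly. Beyond R it is at most e^{-xR/2} e^{(1-x/2)u}, and the transform at x / 2 is bounded
uniformly in N; the cutoff error is thus uniform as well. -/
lemma abs_integral_expCutoff_sub_le {F : ℕ → ℝ → ℝ} (hF : IsCMSequence F) {N : ℕ} (hN : 0 < N)
    {x : ℝ} (hx : 0 < x) (R : ℕ) :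
    |∫ u, expCutoffBCF x R u ∂(bernsteinMeasure F N) - F 0 (bernsteinNode x N)|
      ≤ Real.exp (-(x / 2 * R)) * F 0 ((x / 2) / (1 + x / 2)) := by
  have hfin : IsFiniteMeasure (bernsteinMeasure F N) :=
    ⟨(bernsteinMeasure_univ_le hF hN).trans_lt ENNReal.ofReal_lt_top⟩
  have hint : ∀ y : ℝ, 0 < y → Integrable (fun u => Real.exp ((1 - y) * u)) (bernsteinMeasure F N) := by
    intro y hy
    refine ⟨by fun_prop, ?_⟩
    rw [hasFiniteIntegral_iff_ofReal (ae_of_all _ fun u => Real.exp_nonneg _),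
      lintegral_bernsteinMeasure hF hN hy]
    exact ENNReal.ofReal_lt_top
  have hval : ∀ y : ℝ, 0 < y →
      ∫ u, Real.exp ((1 - y) * u) ∂(bernsteinMeasure F N) = F 0 (bernsteinNode y N) := by
    intro y hy
    rw [integral_eq_lintegral_of_nonneg_ae (ae_of_all _ fun u => Real.exp_nonneg _) (by fun_prop),
      lintegral_bernsteinMeasure hF hN hy, ENNReal.toReal_ofReal]
    simpa using hF.sign 0 _ (bernsteinNode_pos hy hN)
  have hg : Integrable (fun u => expCutoffBCF x R u) (bernsteinMeasure F N) :=
    (expCutoffBCF x R).integrable _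
  have hx2 : 0 < x / 2 := by linarith
  rw [← hval x hx, ← integral_sub hg (hint x hx)]
  have hb := norm_integral_le_of_norm_le (((hint _ hx2).const_mul (Real.exp (-(x / 2 * R)))))
    (f := fun u => expCutoffBCF x R u - Real.exp ((1 - x) * u)) (by
      filter_upwards [ae_nonneg_bernsteinMeasure F N] with u hu
      change |expCutoff x R u - Real.exp ((1 - x) * u)| ≤ _
      unfold expCutoff
      rw [max_eq_left hu]
      by_cases huR : u ≤ R
      · have : max 0 (min 1 ((R : ℝ) + 1 - u)) = 1 := by
          rw [min_eq_left (by linarith), max_eq_right zero_le_one]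
        rw [this, mul_one, sub_self, abs_zero]
        positivity
      · have h1 : max 0 (min 1 ((R : ℝ) + 1 - u)) ≤ 1 := max_le zero_le_one (min_le_left _ _)
        have h2 : 0 ≤ max 0 (min 1 ((R : ℝ) + 1 - u)) := le_max_left _ _
        have h3 : |Real.exp ((1 - x) * u) * max 0 (min 1 ((R : ℝ) + 1 - u))
            - Real.exp ((1 - x) * u)| ≤ Real.exp ((1 - x) * u) := by
          have := Real.exp_pos ((1 - x) * u)
          rw [abs_le]; constructor <;> nlinarith
        refine h3.trans ?_
        rw [← Real.exp_add, Real.exp_le_exp]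
        nlinarith)
  rw [Real.norm_eq_abs, integral_const_mul, hval _ hx2] at hb
  refine hb.trans (mul_le_mul_of_nonneg_left ?_ (Real.exp_nonneg _))
  exact hF.antitoneOn (mem_Ioi.2 (by positivity))
    (bernsteinNode_pos hx2 hN) (le_bernsteinNode hx2 hN)

/-- Bernstein's theorem for functions that vanish at infinity. -/
theorem IsCMSequence.exists_measure {F : ℕ → ℝ → ℝ} (hF : IsCMSequence F)
    (hlim : Tendsto (F 0) atTop (𝓝 0)) :
    ∃ μ : Measure ℝ, μ (Iic 0) = 0 ∧ ∀ x : ℝ, 0 < x →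
      ∫⁻ u, ENNReal.ofReal (Real.exp (-u * x)) ∂μ = ENNReal.ofReal (F 0 x) := by
  obtain ⟨m, hmfin, hm⟩ := exists_tendsto_bernsteinMeasure hF
  have hcont : ∀ x : ℝ, 0 < x → Tendsto (fun N : ℕ => F 0 (bernsteinNode x (N + 1)))
      (hyperfilter ℕ : Filter ℕ) (𝓝 (F 0 x)) := by
    intro x hx
    have h1 : Tendsto (fun N : ℕ => F 0 (bernsteinNode x (N + 1))) atTop (𝓝 (F 0 x)) :=
      (hF.hasDerivAt 0 x hx).continuousAt.tendsto.comp
        ((tendsto_bernsteinNode x).comp (tendsto_add_atTop_nat 1))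
    refine h1.mono_left ?_
    rw [← Nat.cofinite_eq_atTop]
    exact hyperfilter_le_cofinite
  have hneg : m (Iio 0) = 0 := by
    -- A bounded continuous test function that is positive exactly on the negative half-line.
    let g : BoundedContinuousFunction ℝ ℝ :=
      BoundedContinuousFunction.ofNormedAddCommGroup (fun u : ℝ => min (max (-u) 0) 1)
        (by fun_prop) 1 (fun u => by
          rw [Real.norm_of_nonneg (le_min (le_max_right _ _) zero_le_one)]
          exact min_le_right _ _)
    have hg0 : ∀ u, 0 ≤ g u := fun u => le_min (le_max_right _ _) zero_le_one
    have h1 : ∀ N : ℕ, ∫ u, g u ∂(bernsteinMeasure F (N + 1)) = 0 := by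
      intro N
      refine integral_eq_zero_of_ae ?_
      filter_upwards [ae_nonneg_bernsteinMeasure F (N + 1)] with u hu
      change min (max (-u) 0) 1 = 0
      rw [max_eq_right (by linarith), min_eq_left zero_le_one]
    have h2 := hm g
    simp only [h1] at h2
    have h3 : ∫ u, g u ∂m = 0 := tendsto_nhds_unique h2 tendsto_const_nhds |>.symm ▸ rfl
    rw [integral_eq_zero_iff_of_nonneg hg0 (g.integrable m)] at h3
    refine measure_mono_null (fun u hu => ?_) h3
    have hu' : u < 0 := hu
    have : 0 < min (max (-u) 0) 1 := lt_min (lt_max_of_lt_left (by linarith)) one_pos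
    exact this.ne'
  have hae : ∀ᵐ u ∂m, 0 ≤ u := by
    rw [ae_iff]; simp only [not_le]; exact hneg
  have hval : ∀ x : ℝ, 0 < x →
      ∫⁻ u, ENNReal.ofReal (Real.exp ((1 - x) * u)) ∂m = ENNReal.ofReal (F 0 x) := by
    intro x hx
    have hR : ∀ R : ℕ, |∫ u, expCutoffBCF x R u ∂m - F 0 x|
        ≤ Real.exp (-(x / 2 * R)) * F 0 ((x / 2) / (1 + x / 2)) := fun R =>
      le_of_tendsto ((hm (expCutoffBCF x R)).sub (hcont x hx)).abs
        (Eventually.of_forall fun N => abs_integral_expCutoff_sub_le hF N.succ_pos hx R)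
    have hlimR : Tendsto (fun R : ℕ => ∫ u, expCutoffBCF x R u ∂m) atTop (𝓝 (F 0 x)) := by
      rw [tendsto_iff_norm_sub_tendsto_zero]
      refine squeeze_zero (fun _ => norm_nonneg _) hR ?_
      have h1 : Tendsto (fun R : ℕ => Real.exp (-(x / 2 * (R : ℝ)))) atTop (𝓝 0) :=
        Real.tendsto_exp_atBot.comp (tendsto_neg_atTop_atBot.comp
          (tendsto_natCast_atTop_atTop.const_mul_atTop (by linarith)))
      simpa using h1.mul_const (F 0 ((x / 2) / (1 + x / 2)))
    have h2 : Tendsto (fun R : ℕ => ∫⁻ u, ENNReal.ofReal (expCutoff x R u) ∂m) atTop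
        (𝓝 (ENNReal.ofReal (F 0 x))) := by
      refine ((ENNReal.continuous_ofReal.tendsto _).comp hlimR).congr fun R => ?_
      exact ofReal_integral_eq_lintegral_ofReal ((expCutoffBCF x R).integrable m)
        (ae_of_all _ fun u => expCutoff_nonneg x R u)
    have h3 : Tendsto (fun R : ℕ => ∫⁻ u, ENNReal.ofReal (expCutoff x R u) ∂m) atTop
        (𝓝 (∫⁻ u, ENNReal.ofReal (Real.exp ((1 - x) * u)) ∂m)) := by
      refine lintegral_tendsto_of_tendsto_of_monotone (fun R => ?_) ?_ ?_
      · exact ((expCutoffBCF x R).continuous.measurable.ennreal_ofReal).aemeasurable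
      · refine ae_of_all _ fun u R S hRS => ENNReal.ofReal_le_ofReal ?_
        have : (R : ℝ) ≤ S := by exact_mod_cast hRS
        unfold expCutoff
        gcongr
      · filter_upwards [hae] with u hu
        refine tendsto_const_nhds.congr' ?_
        filter_upwards [eventually_ge_atTop ⌈u⌉₊] with R hRu
        have : u ≤ R := Nat.ceil_le.1 hRu
        unfold expCutoff
        rw [max_eq_left hu, min_eq_left (by linarith), max_eq_right zero_le_one, mul_one]
    exact tendsto_nhds_unique h3 h2
  -- An atom at 0 would bound `F 0` from below; only here does the vanishing at infinity enter.
  have hzero : m {0} = 0 := by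
    have h1 : ∀ x : ℝ, 0 < x → m {0} ≤ ENNReal.ofReal (F 0 x) := by
      intro x hx
      rw [← hval x hx]
      calc m {0} = ∫⁻ u in {0}, ENNReal.ofReal (Real.exp ((1 - x) * u)) ∂m := by
            rw [lintegral_singleton]; simp
        _ ≤ _ := setLIntegral_le_lintegral _ _
    have h2 : Tendsto (fun x => ENNReal.ofReal (F 0 x)) atTop (𝓝 0) := by
      have := (ENNReal.continuous_ofReal.tendsto _).comp hlim
      rwa [ENNReal.ofReal_zero] at this
    exact le_antisymm (ge_of_tendsto h2
      (by filter_upwards [eventually_gt_atTop 0] with x hx using h1 x hx)) zero_le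
  have hIic : m (Iic 0) = 0 := by
    rw [← Iio_union_right]
    exact measure_union_null hneg hzero
  -- The density e^u undoes the tilt built into the approximating measures.
  refine ⟨m.withDensity fun u => ENNReal.ofReal (Real.exp u),
    withDensity_absolutelyContinuous _ _ hIic, fun x hx => ?_⟩
  rw [lintegral_withDensity_eq_lintegral_mul _ (by fun_prop) (by fun_prop), ← hval x hx]
  refine lintegral_congr fun u => ?_
  rw [Pi.mul_apply, ← ENNReal.ofReal_mul (Real.exp_nonneg _), ← Real.exp_add]
  congr 2
  ring


/-! ### Mixing measures -/

lemma IsClassCM.integrableOn_exp_mul {π : ℝ → ℝ} {ρ : ℝ} {ρ' : ℝ≥0∞}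
    (hCM : IsClassCM π ρ' (ENNReal.ofReal ρ)) (hπ : IsLevyDensity π) {c : ℝ} (hc : c < ρ) :
    IntegrableOn (fun x : ℝ => Real.exp (c * x) * π x) (Ioi 1) := by
  have hρ : 0 < ρ := ENNReal.ofReal_pos.1 hCM.rate_pos_pos
  -- For negative c the left side is 0, and the argument still yields an admissible exponent d ≥ c.
  have h1 : ENNReal.ofReal c < decayRate π := by
    rw [hCM.rate_pos]
    exact (ENNReal.ofReal_lt_ofReal_iff hρ).2 hc
  obtain ⟨d, hd⟩ := lt_iSup_iff.1 h1
  obtain ⟨hdi, hcd⟩ := lt_iSup_iff.1 hd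
  have hcd' : c ≤ d := by
    have : c.toNNReal < d := ENNReal.coe_lt_coe.1 hcd
    exact Real.toNNReal_le_iff_le_coe.1 this.le
  refine hdi.mono' ((by fun_prop : Measurable fun x : ℝ => Real.exp (c * x)).mul
    hπ.measurable).aestronglyMeasurable ?_
  filter_upwards [ae_restrict_mem measurableSet_Ioi] with x hx
  have hx' : (1 : ℝ) < x := hx
  have := hπ.nonneg x
  rw [Real.norm_of_nonneg (by positivity)]
  gcongr

lemma IsLevyDensity.integrableOn_sq {π : ℝ → ℝ} (hπ : IsLevyDensity π) :
    IntegrableOn (fun x : ℝ => x ^ 2 * π x) (Ioc 0 1) := by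
  refine (hπ.integrable.integrableOn).congr_fun (fun x hx => ?_) measurableSet_Ioc
  simp only
  rw [min_eq_right]
  have := hx.1; have := hx.2
  nlinarith

/-- π is decreasing and integrable at infinity, so (x - 1) π(x) is bounded by its integral over (1,
∞). -/
lemma IsClassCM.tendsto_atTop {π : ℝ → ℝ} {ρ : ℝ} {ρ' : ℝ≥0∞}
    (hCM : IsClassCM π ρ' (ENNReal.ofReal ρ)) (hπ : IsLevyDensity π) :
    Tendsto π atTop (𝓝 0) := by
  have hρ : 0 < ρ := ENNReal.ofReal_pos.1 hCM.rate_pos_pos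
  have h1 : IntegrableOn π (Ioi 1) := by
    simpa using hCM.integrableOn_exp_mul hπ hρ
  have hanti : AntitoneOn π (Ioi 0) := by
    simpa using hCM.completelyMonotone_pos.isCMSequence.antitoneOn
  have hbound : ∀ x, 1 < x → π x ≤ (∫ y in Ioi 1, π y) / (x - 1) := by
    intro x hx
    rw [le_div_iff₀ (by linarith)]
    calc π x * (x - 1) = ∫ _ in Ioc 1 x, π x := by
          simp [Measure.real, Real.volume_Ioc, ENNReal.toReal_ofReal (by linarith : 0 ≤ x - 1), mul_comm]
      _ ≤ ∫ y in Ioc 1 x, π y := by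
          refine setIntegral_mono_on (by simp) (h1.mono_set Ioc_subset_Ioi_self)
            measurableSet_Ioc fun y hy => ?_
          exact hanti (mem_Ioi.2 (by linarith [hy.1])) (mem_Ioi.2 (by linarith)) hy.2
      _ ≤ _ := setIntegral_mono_set h1 (ae_of_all _ fun y => hπ.nonneg y)
          Ioc_subset_Ioi_self.eventuallyLE
  refine squeeze_zero' (Eventually.of_forall hπ.nonneg)
    ((eventually_gt_atTop 1).mono hbound) ?_
  exact tendsto_const_nhds.div_atTop (tendsto_atTop_add_const_right _ (-1) tendsto_id)

/-- **Bernstein's theorem** for one-sided completely monotone jump densities. -/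
theorem IsClassCM.exists_isMixingMeasure {π : ℝ → ℝ} {ρ : ℝ} {ρ' : ℝ≥0∞}
    (hCM : IsClassCM π ρ' (ENNReal.ofReal ρ)) (hπ : IsLevyDensity π)
    (hpos : ∀ x < 0, π x = 0) : ∃ μ : Measure ℝ, IsMixingMeasure μ π := by
  obtain ⟨μ, hμ0, hμ⟩ := hCM.completelyMonotone_pos.isCMSequence.exists_measure
    (by simpa using hCM.tendsto_atTop hπ)
  simp only [iteratedDeriv_zero] at hμ
  have hIoi : μ.restrict (Ioi 0) = μ := by
    rw [Measure.restrict_eq_self_of_ae_mem]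
    rw [ae_iff]
    simp only [mem_Ioi, not_lt]
    exact hμ0
  have hIio : μ.restrict (Iio 0) = 0 := by
    rw [Measure.restrict_eq_zero]
    exact measure_mono_null Iio_subset_Iic_self hμ0
  refine ⟨μ, ⟨measure_mono_null (by simp) hμ0, fun x hx => ?_, fun x hx => ?_,
    fun x hx => ?_, fun x hx => ?_⟩⟩
  · rw [IntegrableOn, hIoi]
    refine ⟨by fun_prop, ?_⟩
    rw [hasFiniteIntegral_iff_ofReal (ae_of_all _ fun u => Real.exp_nonneg _), hμ x hx]
    exact ENNReal.ofReal_lt_top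
  · rw [hIoi, integral_eq_lintegral_of_nonneg_ae (ae_of_all _ fun u => Real.exp_nonneg _)
      (by fun_prop), hμ x hx, ENNReal.toReal_ofReal (hπ.nonneg x)]
  · rw [IntegrableOn, hIio]; exact integrable_zero_measure
  · rw [hIio, integral_zero_measure, hpos x hx]

/-- The properties of a mixing measure `μ` of `π` on `(0, ∞)` in terms of the lower Lebesgue
integral. -/
structure IsPosMixing (μ : Measure ℝ) (π : ℝ → ℝ) : Prop where
  Iic_zero : μ (Iic 0) = 0
  lintegral_eq : ∀ x : ℝ, 0 < x →
    ∫⁻ u, ENNReal.ofReal (Real.exp (-u * x)) ∂μ = ENNReal.ofReal (π x)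

lemma IsMixingMeasure.isPosMixing {μ : Measure ℝ} {π : ℝ → ℝ} (hμ : IsMixingMeasure μ π)
    (hpos : ∀ x < 0, π x = 0) : IsPosMixing μ π := by
  have hIio : μ (Iio 0) = 0 := by
    -- A strictly positive function with zero integral over the negative half-line: no mass can lie
    -- there.
    have h1 := hμ.eq_neg (-1) (by norm_num)
    rw [hpos _ (by norm_num), eq_comm, setIntegral_eq_zero_iff_of_nonneg_ae
      (ae_of_all _ fun u => Real.exp_nonneg _) (hμ.integrable_neg (-1) (by norm_num))] at h1
    rw [← Measure.restrict_eq_zero, ← ae_eq_bot, ← eventually_false_iff_eq_bot]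
    filter_upwards [h1] with u hu
    exact (Real.exp_pos _).ne' hu
  have hIic : μ (Iic 0) = 0 := by
    rw [← Iio_union_right]
    exact measure_union_null hIio hμ.zero
  have hIoi : μ.restrict (Ioi 0) = μ := by
    rw [Measure.restrict_eq_self_of_ae_mem]
    rw [ae_iff]
    simp only [mem_Ioi, not_lt]
    exact hIic
  refine ⟨hIic, fun x hx => ?_⟩
  have h1 := hμ.integrable_pos x hx
  have h2 := hμ.eq_pos x hx
  rw [IntegrableOn, hIoi] at h1
  rw [hIoi] at h2
  rw [h2, ofReal_integral_eq_lintegral_ofReal h1 (ae_of_all _ fun u => Real.exp_nonneg _)]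

namespace IsPosMixing

variable {μ : Measure ℝ} {π : ℝ → ℝ}

lemma ae_pos (hμ : IsPosMixing μ π) : ∀ᵐ u ∂μ, 0 < u := by
  rw [ae_iff]; simp only [not_lt]; exact hμ.Iic_zero

/-- The measure e^{-u} μ(du) has mass π(1), and μ has the finite density e^u with respect to it.
Needed for the exchanges of integrals. -/
lemma sigmaFinite (hμ : IsPosMixing μ π) : SigmaFinite μ := by
  have hfin : IsFiniteMeasure (μ.withDensity fun u => ENNReal.ofReal (Real.exp (-u * 1))) := by
    refine isFiniteMeasure_withDensity ?_
    rw [hμ.lintegral_eq 1 one_pos]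
    exact ENNReal.ofReal_ne_top
  have h1 : (μ.withDensity fun u => ENNReal.ofReal (Real.exp (-u * 1))).withDensity
      (fun u => ENNReal.ofReal (Real.exp u)) = μ := by
    rw [← withDensity_mul _ (by fun_prop) (by fun_prop)]
    conv_rhs => rw [← withDensity_one (μ := μ)]
    congr 1
    funext u
    rw [Pi.mul_apply, ← ENNReal.ofReal_mul (Real.exp_nonneg _), ← Real.exp_add]
    simp
  rw [← h1]
  exact SigmaFinite.withDensity_of_ne_top (ae_of_all _ fun u => ENNReal.ofReal_ne_top)

/-- Tonelli's theorem for integrals against a mixture of exponentials. -/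
lemma lintegral_mul (hμ : IsPosMixing μ π) {f : ℝ → ℝ≥0∞} (hf : Measurable f) :
    ∫⁻ x in Ioi 0, f x * ENNReal.ofReal (π x)
      = ∫⁻ u, ∫⁻ x in Ioi 0, f x * ENNReal.ofReal (Real.exp (-u * x)) ∂volume ∂μ := by
  have := hμ.sigmaFinite
  rw [lintegral_lintegral_swap (by fun_prop)]
  refine setLIntegral_congr_fun measurableSet_Ioi fun x hx => ?_
  rw [lintegral_const_mul _ (by fun_prop), hμ.lintegral_eq x hx]

end IsPosMixing


/-! ### Integrals against a single exponential density -/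

lemma integral_pow_mul_exp_neg (n : ℕ) {u : ℝ} (hu : 0 < u) :
    ∫ x in Ioi (0 : ℝ), x ^ n * Real.exp (-u * x) = n.factorial / u ^ (n + 1) := by
  have h := Real.integral_rpow_mul_exp_neg_mul_Ioi (a := (n : ℝ) + 1) (r := u) (by positivity) hu
  rw [Real.Gamma_nat_eq_factorial] at h
  have h2 : ((1 : ℝ) / u) ^ ((n : ℝ) + 1) = 1 / u ^ (n + 1) := by
    rw [← Nat.cast_succ, Real.rpow_natCast, div_pow, one_pow]
  rw [h2] at h
  rw [div_eq_mul_one_div, mul_comm, ← h]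
  refine setIntegral_congr_fun measurableSet_Ioi fun x _ => ?_
  simp only [add_sub_cancel_right, Real.rpow_natCast, neg_mul]

lemma integrableOn_pow_mul_exp_neg (n : ℕ) {u : ℝ} (hu : 0 < u) :
    IntegrableOn (fun x : ℝ => x ^ n * Real.exp (-u * x)) (Ioi 0) := by
  -- A non-integrable function has Bochner integral 0 by convention, so a nonzero value proves
  -- integrability.
  refine not_imp_comm.1 integral_undef ?_
  rw [integral_pow_mul_exp_neg n hu]
  positivity

lemma lintegral_pow_mul_exp_neg (n : ℕ) {u : ℝ} (hu : 0 < u) :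
    ∫⁻ x in Ioi (0 : ℝ), ENNReal.ofReal (x ^ n) * ENNReal.ofReal (Real.exp (-u * x))
      = ENNReal.ofReal (n.factorial / u ^ (n + 1)) := by
  rw [← integral_pow_mul_exp_neg n hu, ofReal_integral_eq_lintegral_ofReal
    (integrableOn_pow_mul_exp_neg n hu)]
  · refine setLIntegral_congr_fun measurableSet_Ioi fun x hx => ?_
    exact (ENNReal.ofReal_mul (pow_nonneg (le_of_lt hx) _)).symm
  · filter_upwards [ae_restrict_mem measurableSet_Ioi] with x hx
    exact mul_nonneg (pow_nonneg (le_of_lt hx) _) (Real.exp_nonneg _)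

/-- The compensated Laplace transform of an exponential density. -/
lemma integral_compensated_exp {u : ℝ} (hu : 0 < u) {z : ℂ} (hz : z.re < u) :
    IntegrableOn (fun x : ℝ => (Complex.exp (z * x) - 1 - z * x) * (Real.exp (-u * x) : ℂ)) (Ioi 0) ∧
    ∫ x in Ioi (0 : ℝ), (Complex.exp (z * x) - 1 - z * x) * (Real.exp (-u * x) : ℂ)
      = z ^ 2 / (u ^ 2 * (u - z)) := by
  have hre : (z - u).re < 0 := by simpa using hz
  have hne : (u : ℂ) - z ≠ 0 := by
    intro h
    have := congrArg Complex.re h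
    simp at this
    linarith
  have hne' : z - u ≠ 0 := by rw [← neg_sub]; exact neg_ne_zero.2 hne
  have hu' : (u : ℂ) ≠ 0 := by exact_mod_cast hu.ne'
  have h1 := integrableOn_exp_mul_complex_Ioi hre 0
  have h2 : IntegrableOn (fun x : ℝ => ((x ^ 0 * Real.exp (-u * x) : ℝ) : ℂ)) (Ioi 0) :=
    (integrableOn_pow_mul_exp_neg 0 hu).ofReal
  have h3 : IntegrableOn (fun x : ℝ => z * ((x ^ 1 * Real.exp (-u * x) : ℝ) : ℂ)) (Ioi 0) :=
    ((integrableOn_pow_mul_exp_neg 1 hu).ofReal).const_mul z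
  have hfun : (fun x : ℝ => (Complex.exp (z * x) - 1 - z * x) * (Real.exp (-u * x) : ℂ))
      = fun x : ℝ => Complex.exp ((z - u) * x) - ((x ^ 0 * Real.exp (-u * x) : ℝ) : ℂ)
        - z * ((x ^ 1 * Real.exp (-u * x) : ℝ) : ℂ) := by
    funext x
    have : Complex.exp ((z - u) * x) = Complex.exp (z * x) * Complex.exp (-u * x) := by
      rw [← Complex.exp_add]; congr 1; ring
    rw [this]
    push_cast
    ring
  rw [hfun]
  refine ⟨(h1.sub h2).sub h3, ?_⟩
  have h12 : IntegrableOn (fun x : ℝ => Complex.exp ((z - u) * x)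
      - ((x ^ 0 * Real.exp (-u * x) : ℝ) : ℂ)) (Ioi 0) := h1.sub h2
  rw [integral_sub h12 h3, integral_sub h1 h2, integral_exp_mul_complex_Ioi hre,
    integral_const_mul, integral_complex_ofReal, integral_complex_ofReal, integral_pow_mul_exp_neg 0 hu,
    integral_pow_mul_exp_neg 1 hu]
  push_cast
  simp only [mul_zero, Complex.exp_zero, Nat.factorial]
  -- What remains is 1/(u - z) - 1/u - z/u² = z²/(u²(u - z)).
  field_simp
  ring

/-! ### One-sided Lévy densities and their mixing measures -/

/-- The standing assumptions on the jump density, in usable form. -/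
structure IsOneSidedLevyDensity (π : ℝ → ℝ) (ρ : ℝ) : Prop where
  isLevyDensity : IsLevyDensity π
  rate_pos : 0 < ρ
  integrableOn_exp : ∀ c < ρ, IntegrableOn (fun x : ℝ => Real.exp (c * x) * π x) (Ioi 1)
  eq_zero : ∀ x < 0, π x = 0
  infinite_variation : ¬ HasFiniteVariationJumps π

lemma norm_exp_sub_le {z : ℂ} {x : ℝ} (hx : 0 ≤ x) {c : ℝ} (hc : 0 < c) (hzc : z.re ≤ c) :
    ‖Complex.exp (z * x) - 1 - z * x‖ ≤ (2 + ‖z‖ / c) * Real.exp (c * x) := by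
  have h1 : ‖Complex.exp (z * x)‖ ≤ Real.exp (c * x) := by
    rw [Complex.norm_exp, Real.exp_le_exp]
    simp only [Complex.mul_re, Complex.ofReal_re, Complex.ofReal_im, mul_zero, sub_zero]
    gcongr
  have h2 : (1 : ℝ) ≤ Real.exp (c * x) := Real.one_le_exp (by positivity)
  have h3 : ‖z * x‖ ≤ ‖z‖ / c * Real.exp (c * x) := by
    rw [norm_mul, Complex.norm_real, Real.norm_of_nonneg hx, div_mul_eq_mul_div, le_div_iff₀ hc,
      mul_assoc]
    gcongr
    linarith [Real.add_one_le_exp (c * x)]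
  calc ‖Complex.exp (z * x) - 1 - z * x‖ ≤ ‖Complex.exp (z * x)‖ + ‖(1 : ℂ)‖ + ‖z * x‖ :=
        (norm_sub_le _ _).trans (by gcongr; exact norm_sub_le _ _)
    _ ≤ Real.exp (c * x) + Real.exp (c * x) + ‖z‖ / c * Real.exp (c * x) := by
        rw [norm_one]; gcongr
    _ = _ := by ring

namespace IsOneSidedLevyDensity

variable {π : ℝ → ℝ} {ρ : ℝ}

lemma integrableOn_sq (h : IsOneSidedLevyDensity π ρ) : IntegrableOn (fun x : ℝ => x ^ 2 * π x) (Ioi 0) := by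
  rw [← Ioc_union_Ioi_eq_Ioi zero_le_one]
  refine h.isLevyDensity.integrableOn_sq.union ?_
  have hρ := h.rate_pos
  -- The constant comes from s²/2 ≤ e^s at s = ρx/2.
  refine ((h.integrableOn_exp (ρ / 2) (by linarith)).const_mul (8 / ρ ^ 2)).mono'
    ((by fun_prop : Measurable fun x : ℝ => x ^ 2).mul
      h.isLevyDensity.measurable).aestronglyMeasurable ?_
  filter_upwards [ae_restrict_mem measurableSet_Ioi] with x hx
  have hx' : (1 : ℝ) < x := hx
  have hπ := h.isLevyDensity.nonneg x
  rw [Real.norm_of_nonneg (by positivity), ← mul_assoc]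
  gcongr
  have := Real.quadratic_le_exp_of_nonneg (x := ρ / 2 * x) (by positivity)
  rw [div_mul_eq_mul_div, le_div_iff₀ (by positivity)]
  nlinarith [mul_pos hρ (zero_lt_one.trans hx')]

lemma integrableOn_compensated (h : IsOneSidedLevyDensity π ρ) {z : ℂ} (hz : z.re < ρ) :
    IntegrableOn (fun x : ℝ => ‖Complex.exp (z * x) - 1 - z * x‖ * π x) (Ioi 0) := by
  have hρ := h.rate_pos
  have hmeas : Measurable fun x : ℝ => ‖Complex.exp (z * x) - 1 - z * x‖ * π x :=
    (by fun_prop : Measurable fun x : ℝ => ‖Complex.exp (z * x) - 1 - z * x‖).mul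
      h.isLevyDensity.measurable
  rw [← Ioc_union_Ioi_eq_Ioi zero_le_one]
  refine IntegrableOn.union ?_ ?_
  · refine (h.isLevyDensity.integrableOn_sq.const_mul (‖z‖ ^ 2 * Real.exp ‖z‖)).mono'
      hmeas.aestronglyMeasurable ?_
    filter_upwards [ae_restrict_mem measurableSet_Ioc] with x hx
    have hπ := h.isLevyDensity.nonneg x
    rw [Real.norm_of_nonneg (by positivity), ← mul_assoc]
    gcongr
    have h1 := Complex.norm_exp_sub_sum_le_norm_mul_exp (z * x) 2
    simp only [Finset.sum_range_succ, Finset.sum_range_zero, Nat.factorial] at h1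
    have h2 : ‖z * (x : ℂ)‖ = ‖z‖ * x := by
      rw [norm_mul, Complex.norm_real, Real.norm_of_nonneg hx.1.le]
    rw [h2] at h1
    have h3 : Real.exp (‖z‖ * x) ≤ Real.exp ‖z‖ :=
      Real.exp_le_exp.2 (mul_le_of_le_one_right (norm_nonneg _) hx.2)
    calc ‖Complex.exp (z * x) - 1 - z * x‖ ≤ (‖z‖ * x) ^ 2 * Real.exp (‖z‖ * x) := by
          refine le_trans (le_of_eq ?_) h1
          congr 1
          push_cast
          ring
      _ ≤ (‖z‖ * x) ^ 2 * Real.exp ‖z‖ := by gcongr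
      _ = _ := by ring
  -- The exponent must dominate Re z and stay below ρ; the second entry ρ / 2 keeps it positive,
  -- since the bound divides by c.
  · set c := max z.re (ρ / 2) with hc
    have hc0 : 0 < c := lt_max_of_lt_right (by linarith)
    have hcρ : c < ρ := max_lt hz (by linarith)
    refine ((h.integrableOn_exp c hcρ).const_mul (2 + ‖z‖ / c)).mono'
      hmeas.aestronglyMeasurable ?_
    filter_upwards [ae_restrict_mem measurableSet_Ioi] with x hx
    have hx' : (1 : ℝ) < x := hx
    have hπ := h.isLevyDensity.nonneg x
    rw [Real.norm_of_nonneg (by positivity), ← mul_assoc]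
    gcongr
    exact norm_exp_sub_le (by linarith) hc0 (le_max_left _ _)

lemma levyIntegrand_eq_indicator (h : IsOneSidedLevyDensity π ρ) (z : ℂ) :
    levyIntegrand (fun x => x) π z = (Ioi 0).indicator
      (fun x : ℝ => (Complex.exp (z * x) - 1 - z * x) * (π x : ℂ)) := by
  funext x
  by_cases hx : 0 < x
  · rw [indicator_of_mem (mem_Ioi.2 hx), levyIntegrand]
  · rw [indicator_of_notMem (by simpa using hx), levyIntegrand]
    rcases lt_or_eq_of_le (not_lt.1 hx) with hx | hx
    · rw [h.eq_zero x hx]; simp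
    -- At x = 0 the compensated factor vanishes, so the value of π at 0 is irrelevant.
    · rw [hx]; simp

lemma integrable_levyIntegrand (h : IsOneSidedLevyDensity π ρ) {z : ℂ} (hz : z.re < ρ) :
    Integrable (levyIntegrand (fun x => x) π z) := by
  rw [h.levyIntegrand_eq_indicator, integrable_indicator_iff measurableSet_Ioi]
  refine (h.integrableOn_compensated hz).mono' ?_ ?_
  · exact ((by fun_prop : Measurable fun x : ℝ => Complex.exp (z * x) - 1 - z * x).mul
      h.isLevyDensity.measurable.complex_ofReal).aestronglyMeasurable
  · refine ae_of_all _ fun x => ?_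
    rw [norm_mul, Complex.norm_real, Real.norm_of_nonneg (h.isLevyDensity.nonneg x)]

variable {μ : Measure ℝ}

/-- For c < ρ, Tonelli turns the finite integral of e^{cx} π(x) over (1, ∞) into the μ-integral of
∫₁^∞ e^{(c-u)x} dx. The inner integral is infinite when u ≤ c, so such u form a null set; then c
increases to ρ. -/
lemma ae_rate_le (h : IsOneSidedLevyDensity π ρ) (hμ : IsPosMixing μ π) : ∀ᵐ u ∂μ, ρ ≤ u := by
  have key : ∀ c < ρ, ∀ᵐ u ∂μ, c < u := by
    intro c hc
    have h1 := hμ.lintegral_mul (f := (Ioi 1).indicator fun x => ENNReal.ofReal (Real.exp (c * x)))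
      ((by fun_prop : Measurable fun x : ℝ => ENNReal.ofReal (Real.exp (c * x))).indicator
        measurableSet_Ioi)
    have h2 : ∫⁻ x in Ioi 0, (Ioi 1).indicator (fun x => ENNReal.ofReal (Real.exp (c * x))) x
        * ENNReal.ofReal (π x) ≠ ⊤ := by
      have h3 := (h.integrableOn_exp c hc).2
      rw [hasFiniteIntegral_iff_ofReal (ae_of_all _ fun x =>
        mul_nonneg (Real.exp_nonneg _) (h.isLevyDensity.nonneg x))] at h3
      refine ne_top_of_le_ne_top h3.ne ?_
      rw [← lintegral_indicator measurableSet_Ioi, ← lintegral_indicator measurableSet_Ioi]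
      refine lintegral_mono fun x => ?_
      by_cases hx : (1 : ℝ) < x
      · have hx0 : (0 : ℝ) < x := by linarith
        simp only [indicator_of_mem (mem_Ioi.2 hx), indicator_of_mem (mem_Ioi.2 hx0)]
        rw [ENNReal.ofReal_mul (Real.exp_nonneg _)]
      · simp [indicator, hx]
    rw [h1] at h2
    have := hμ.sigmaFinite
    have hm : Measurable fun u : ℝ => ∫⁻ x in Ioi 0, (Ioi 1).indicator
        (fun x => ENNReal.ofReal (Real.exp (c * x))) x * ENNReal.ofReal (Real.exp (-u * x)) := by
      refine Measurable.lintegral_prod_right' (ν := volume.restrict (Ioi (0 : ℝ)))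
        (f := fun p : ℝ × ℝ => (Ioi 1).indicator
        (fun x => ENNReal.ofReal (Real.exp (c * x))) p.2 * ENNReal.ofReal (Real.exp (-p.1 * p.2))) ?_
      exact (((by fun_prop : Measurable fun x : ℝ => ENNReal.ofReal (Real.exp (c * x))).indicator
        measurableSet_Ioi).comp measurable_snd).mul (by fun_prop)
    filter_upwards [ae_lt_top hm h2] with u hu
    by_contra hcu
    rw [not_lt] at hcu
    refine hu.ne (top_unique ?_)
    calc (⊤ : ℝ≥0∞) = ∫⁻ _ in Ioi (1 : ℝ), 1 := by simp
      _ ≤ ∫⁻ x in Ioi (1 : ℝ), (Ioi 1).indicator (fun x => ENNReal.ofReal (Real.exp (c * x))) x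
            * ENNReal.ofReal (Real.exp (-u * x)) := by
          refine setLIntegral_mono' measurableSet_Ioi fun x hx => ?_
          have hx' : (1 : ℝ) < x := hx
          rw [indicator_of_mem hx, ← ENNReal.ofReal_mul (Real.exp_nonneg _), ← Real.exp_add,
            ENNReal.one_le_ofReal, Real.one_le_exp_iff]
          nlinarith
      _ ≤ _ := lintegral_mono_set (Ioi_subset_Ioi zero_le_one)
  have h1 : ∀ᵐ u ∂μ, ∀ n : ℕ, ρ - 1 / ((n : ℝ) + 1) < u :=
    ae_all_iff.2 fun n => key _ (by have : (0 : ℝ) < 1 / ((n : ℝ) + 1) := by positivity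
                                    linarith)
  filter_upwards [h1] with u hu
  have h2 : Tendsto (fun n : ℕ => ρ - 1 / ((n : ℝ) + 1)) atTop (𝓝 (ρ - 0)) :=
    tendsto_one_div_add_atTop_nhds_zero_nat.const_sub ρ
  rw [sub_zero] at h2
  exact le_of_tendsto' h2 fun n => (hu n).le

/-- By Tonelli, the integral of x² π(x) is that of 2/u³ against μ. -/
lemma lintegral_inv_cube_lt_top (h : IsOneSidedLevyDensity π ρ) (hμ : IsPosMixing μ π) :
    ∫⁻ u, ENNReal.ofReal (1 / u ^ 3) ∂μ < ⊤ := by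
  have h1 := hμ.lintegral_mul (f := fun x => ENNReal.ofReal (x ^ 2)) (by fun_prop)
  have h2 := h.integrableOn_sq.2
  rw [hasFiniteIntegral_iff_ofReal (ae_of_all _ fun x =>
    mul_nonneg (sq_nonneg x) (h.isLevyDensity.nonneg x))] at h2
  have h3 : ∫⁻ x in Ioi 0, ENNReal.ofReal (x ^ 2) * ENNReal.ofReal (π x) < ⊤ := by
    refine lt_of_eq_of_lt (lintegral_congr fun x => ?_) h2
    rw [ENNReal.ofReal_mul (sq_nonneg x)]
  rw [h1] at h3
  refine lt_of_le_of_lt (lintegral_mono_ae ?_) h3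
  filter_upwards [hμ.ae_pos] with u hu
  rw [lintegral_pow_mul_exp_neg 2 hu]
  refine ENNReal.ofReal_le_ofReal ?_
  gcongr
  norm_num [Nat.factorial]

/-- By Tonelli, the integral of x π(x) is that of 1/u² against μ, so infinite variation is a
statement about μ near infinity. -/
lemma lintegral_inv_sq_eq_top (h : IsOneSidedLevyDensity π ρ) (hμ : IsPosMixing μ π) :
    ∫⁻ u, ENNReal.ofReal (1 / u ^ 2) ∂μ = ⊤ := by
  by_contra hne
  refine h.infinite_variation ?_
  have h1 := hμ.lintegral_mul (f := fun x => ENNReal.ofReal (x ^ 1)) (by fun_prop)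
  have h2 : ∫⁻ x in Ioi 0, ENNReal.ofReal (x ^ 1) * ENNReal.ofReal (π x)
      = ∫⁻ u, ENNReal.ofReal (1 / u ^ 2) ∂μ := by
    rw [h1]
    refine lintegral_congr_ae ?_
    filter_upwards [hμ.ae_pos] with u hu
    rw [lintegral_pow_mul_exp_neg 1 hu]
    simp [Nat.factorial]
  have h3 : (fun x : ℝ => |x| * π x) = (Ioi 0).indicator (fun x => x * π x) := by
    funext x
    by_cases hx : 0 < x
    · rw [indicator_of_mem (mem_Ioi.2 hx), abs_of_pos hx]
    · rw [indicator_of_notMem (by simpa using hx)]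
      rcases lt_or_eq_of_le (not_lt.1 hx) with hx | hx
      · rw [h.eq_zero x hx]; simp
      · rw [hx]; simp
  rw [HasFiniteVariationJumps, h3, integrable_indicator_iff measurableSet_Ioi]
  refine ⟨(measurable_id.mul h.isLevyDensity.measurable).aestronglyMeasurable, ?_⟩
  rw [hasFiniteIntegral_iff_ofReal]
  · rw [lt_top_iff_ne_top]
    rw [← h2] at hne
    convert hne using 1
    refine setLIntegral_congr_fun measurableSet_Ioi fun x hx => ?_
    rw [ENNReal.ofReal_mul (le_of_lt hx), pow_one]
  · filter_upwards [ae_restrict_mem measurableSet_Ioi] with x hx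
    exact mul_nonneg (le_of_lt hx) (h.isLevyDensity.nonneg x)

/-- The Lévy–Khintchine integral in terms of the mixing measure. -/
lemma integral_levyIntegrand (h : IsOneSidedLevyDensity π ρ) (hμ : IsPosMixing μ π) {z : ℂ}
    (hz : z.re < ρ) :
    ∫ x, levyIntegrand (fun x => x) π z x = ∫ u : ℝ, z ^ 2 / (u ^ 2 * (u - z)) ∂μ := by
  have := hμ.sigmaFinite
  set f : ℝ → ℝ → ℂ := fun x u =>
    (Complex.exp (z * x) - 1 - z * x) * (Real.exp (-u * x) : ℂ) with hf
  have hmeas : Measurable (Function.uncurry f) := by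
    rw [hf]; unfold Function.uncurry; fun_prop
  -- Fubini needs absolute integrability: integrating out u first replaces e^{-ux} by π(x) and
  -- leaves the compensated integrand, already known to be integrable.
  have hint : Integrable (Function.uncurry f) ((volume.restrict (Ioi 0)).prod μ) := by
    refine ⟨hmeas.aestronglyMeasurable, ?_⟩
    rw [hasFiniteIntegral_iff_enorm, lintegral_prod _ hmeas.enorm.aemeasurable]
    have h1 := (h.integrableOn_compensated hz).2
    rw [hasFiniteIntegral_iff_ofReal (ae_of_all _ fun x =>
      mul_nonneg (norm_nonneg _) (h.isLevyDensity.nonneg x))] at h1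
    refine lt_of_eq_of_lt (setLIntegral_congr_fun measurableSet_Ioi fun x hx => ?_) h1
    simp only [Function.uncurry, hf, enorm_mul]
    rw [ENNReal.ofReal_mul (norm_nonneg _), ← hμ.lintegral_eq x hx,
      lintegral_const_mul _ (by fun_prop), ofReal_norm]
    congr 1
    refine lintegral_congr fun u => ?_
    rw [← ofReal_norm, Complex.norm_real, Real.norm_of_nonneg (Real.exp_nonneg _)]
  rw [h.levyIntegrand_eq_indicator, integral_indicator measurableSet_Ioi]
  have h2 : ∫ x in Ioi (0 : ℝ), (Complex.exp (z * x) - 1 - z * x) * (π x : ℂ)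
      = ∫ x in Ioi (0 : ℝ), ∫ u, f x u ∂μ := by
    refine setIntegral_congr_fun measurableSet_Ioi fun x hx => ?_
    simp only [hf]
    rw [integral_const_mul, integral_complex_ofReal, integral_eq_lintegral_of_nonneg_ae
      (ae_of_all _ fun u => Real.exp_nonneg _) (by fun_prop), hμ.lintegral_eq x hx,
      ENNReal.toReal_ofReal (h.isLevyDensity.nonneg x)]
  rw [h2, integral_integral_swap hint]
  refine integral_congr_ae ?_
  filter_upwards [h.ae_rate_le hμ] with u hu
  exact (integral_compensated_exp (h.rate_pos.trans_le hu) (hz.trans_le hu)).2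

end IsOneSidedLevyDensity


/-! ### Moment measures and Stieltjes functions -/

/-- A finite measure carried by `(0, L]` but not by a finite set. -/
structure IsMomentMeasure (ν : Measure ℝ) (L : ℝ) : Prop where
  isFiniteMeasure : IsFiniteMeasure ν
  pos : 0 < L
  ae_mem : ∀ᵐ v ∂ν, v ∈ Ioc 0 L
  infinite : ∀ S : Set ℝ, S.Finite → ν Sᶜ ≠ 0

/-- The Stieltjes function `∫ ν(dv) / (1 - z v)` of a measure. -/
noncomputable def stieltjes (ν : Measure ℝ) (z : ℂ) : ℂ := ∫ v : ℝ, (1 - z * v)⁻¹ ∂ν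

lemma lintegral_powInvMeasure (μ : Measure ℝ) (p : ℕ) {g : ℝ → ℝ≥0∞} (hg : Measurable g) :
    ∫⁻ v, g v ∂(powInvMeasure μ p) = ∫⁻ u, ENNReal.ofReal ((u⁻¹) ^ p) * g u⁻¹ ∂μ := by
  rw [powInvMeasure, invMeasure, lintegral_withDensity_eq_lintegral_mul _ (by fun_prop) hg,
    lintegral_map (by fun_prop) measurable_inv]
  rfl

lemma integral_powInvMeasure {μ : Measure ℝ} (hμ : ∀ᵐ u ∂μ, 0 < u) (p : ℕ) {g : ℝ → ℂ}
    (hg : Measurable g) :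
    ∫ v, g v ∂(powInvMeasure μ p) = ∫ u : ℝ, ((u⁻¹ ^ p : ℝ) : ℂ) * g u⁻¹ ∂μ := by
  rw [powInvMeasure, invMeasure, integral_withDensity_eq_integral_toReal_smul (by fun_prop)
    (ae_of_all _ fun _ => ENNReal.ofReal_lt_top), integral_map measurable_inv.aemeasurable
    (by fun_prop)]
  refine integral_congr_ae ?_
  filter_upwards [hμ] with u hu
  rw [ENNReal.toReal_ofReal (by positivity), Complex.real_smul]

namespace IsOneSidedLevyDensity

variable {π : ℝ → ℝ} {ρ : ℝ} {μ : Measure ℝ}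

/-- Since u ≥ ρ almost everywhere, the case p = 3 controls all higher powers. If a finite set
carried the measure, u would be bounded by some B, so 1/u² ≤ B/u³ would be integrable, against
infinite variation. -/
lemma isMomentMeasure (h : IsOneSidedLevyDensity π ρ) (hμ : IsPosMixing μ π) {p : ℕ} (hp : 3 ≤ p) :
    IsMomentMeasure (powInvMeasure μ p) (1 / ρ) where
  isFiniteMeasure := by
    refine ⟨?_⟩
    rw [← lintegral_one, lintegral_powInvMeasure μ p measurable_const]
    have h1 := h.lintegral_inv_cube_lt_top hμ
    refine lt_of_le_of_lt (b := ∫⁻ u, ENNReal.ofReal (ρ⁻¹ ^ (p - 3)) *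
      ENNReal.ofReal (1 / u ^ 3) ∂μ) (lintegral_mono_ae ?_) ?_
    · filter_upwards [h.ae_rate_le hμ] with u hu
      have hu0 : 0 < u := h.rate_pos.trans_le hu
      have hρ := h.rate_pos
      rw [mul_one, ← ENNReal.ofReal_mul (by positivity)]
      refine ENNReal.ofReal_le_ofReal ?_
      calc u⁻¹ ^ p = u⁻¹ ^ (p - 3) * u⁻¹ ^ 3 := by rw [← pow_add]; congr 1; omega
        _ = u⁻¹ ^ (p - 3) * (1 / u ^ 3) := by rw [inv_pow u 3, one_div]
        _ ≤ _ := by gcongr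
    · rw [lintegral_const_mul _ (by fun_prop)]
      exact ENNReal.mul_lt_top ENNReal.ofReal_lt_top h1
  pos := one_div_pos.2 h.rate_pos
  ae_mem := by
    rw [ae_iff]
    rw [powInvMeasure]
    refine withDensity_absolutelyContinuous _ _ ?_
    rw [invMeasure, Measure.map_apply measurable_inv]
    · refine measure_mono_null ?_ (ae_iff.1 (h.ae_rate_le hμ))
      intro u hu hu2
      refine hu ⟨inv_pos.2 (h.rate_pos.trans_le hu2), ?_⟩
      rw [one_div]
      exact inv_anti₀ h.rate_pos hu2
    · exact (measurableSet_Ioc (a := (0 : ℝ)) (b := 1 / ρ)).compl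
  infinite := by
    intro S hS h0
    have hSm : MeasurableSet Sᶜ := hS.measurableSet.compl
    rw [← lintegral_indicator_one hSm, lintegral_powInvMeasure μ p
      (measurable_one.indicator hSm), lintegral_eq_zero_iff (by
        refine Measurable.mul (by fun_prop) ?_
        exact (measurable_one.indicator hSm).comp measurable_inv)] at h0
    have hfin : (S.image (fun v => v⁻¹)).Finite := hS.image _
    obtain ⟨B, hB⟩ := hfin.bddAbove
    have hle : ∀ᵐ u ∂μ, u ≤ B := by
      filter_upwards [h0, hμ.ae_pos] with u hu hu0
      have h1 : u⁻¹ ∈ S := by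
        by_contra hn
        rw [indicator_of_mem (by simpa using hn)] at hu
        have : 0 < ENNReal.ofReal (u⁻¹ ^ p) := ENNReal.ofReal_pos.2 (by positivity)
        simp at hu
        linarith [pow_pos hu0 p]
      exact hB ⟨u⁻¹, h1, by simp⟩
    have h2 := h.lintegral_inv_sq_eq_top hμ
    refine (lt_of_le_of_lt (b := ∫⁻ u, ENNReal.ofReal (max B 0) * ENNReal.ofReal (1 / u ^ 3) ∂μ)
      (lintegral_mono_ae ?_) ?_).ne h2
    · filter_upwards [hle, hμ.ae_pos] with u hu hu0
      rw [← ENNReal.ofReal_mul (le_max_right _ _)]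
      refine ENNReal.ofReal_le_ofReal ?_
      have h3 : u ≤ max B 0 := hu.trans (le_max_left _ _)
      rw [mul_one_div, div_le_div_iff₀ (by positivity) (by positivity)]
      have : 0 < u ^ 2 := by positivity
      nlinarith
    · rw [lintegral_const_mul _ (by fun_prop)]
      exact ENNReal.mul_lt_top ENNReal.ofReal_lt_top (h.lintegral_inv_cube_lt_top hμ)

/-- With v = 1/u, the factor 1/(u²(u - z)) becomes v³/(1 - zv). The right side makes sense on the
whole cut plane and serves as the analytic continuation. -/
lemma levyExponent_eq (h : IsOneSidedLevyDensity π ρ) (hμ : IsPosMixing μ π) (a : ℝ) {z : ℂ}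
    (hz : z.re < ρ) :
    levyExponent (fun x => x) a 0 π z = a * z + z ^ 2 * stieltjes (powInvMeasure μ 3) z := by
  rw [levyExponent, h.integral_levyIntegrand hμ hz, stieltjes,
    integral_powInvMeasure hμ.ae_pos 3 (by fun_prop), ← integral_const_mul]
  simp only [Complex.ofReal_zero, zero_mul, zero_div, zero_add]
  congr 1
  refine integral_congr_ae ?_
  filter_upwards [h.ae_rate_le hμ] with u hu
  have hu0 : (u : ℂ) ≠ 0 := by exact_mod_cast (h.rate_pos.trans_le hu).ne'
  have hne : (u : ℂ) - z ≠ 0 := by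
    intro hc
    have := congrArg Complex.re hc
    simp at this
    linarith
  have : 1 - z * (u : ℂ)⁻¹ = (u - z) / u := by field_simp
  push_cast
  rw [this]
  field_simp

lemma integral_powInvMeasure_succ (hμ : IsPosMixing μ π) (p : ℕ) {g : ℝ → ℂ}
    (hg : Measurable g) :
    ∫ v, g v ∂(powInvMeasure μ (p + 1)) = ∫ v : ℝ, v * g v ∂(powInvMeasure μ p) := by
  rw [integral_powInvMeasure hμ.ae_pos _ hg, integral_powInvMeasure hμ.ae_pos _ (by fun_prop)]
  refine integral_congr_ae (ae_of_all _ fun u => ?_)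
  push_cast
  ring

end IsOneSidedLevyDensity


/-! ### Gaussian quadrature -/

namespace IsMomentMeasure

open Polynomial

variable {ν : Measure ℝ} {L : ℝ}

lemma restrict_Icc (hν : IsMomentMeasure ν L) : ν.restrict (Icc 0 L) = ν :=
  Measure.restrict_eq_self_of_ae_mem (hν.ae_mem.mono fun _ hv => Ioc_subset_Icc_self hv)

lemma integrable {E : Type*} [NormedAddCommGroup E] (hν : IsMomentMeasure ν L) {g : ℝ → E}
    (hg : ContinuousOn g (Icc 0 L)) : Integrable g ν := by
  have := hν.isFiniteMeasure
  have := hg.integrableOn_compact (μ := ν) isCompact_Icc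
  rwa [IntegrableOn, hν.restrict_Icc] at this

lemma integrable_eval (hν : IsMomentMeasure ν L) (p : ℝ[X]) :
    Integrable (fun v => p.eval v) ν :=
  hν.integrable p.continuous.continuousOn

/-- Integration against `ν`, as a linear functional on polynomials. -/
noncomputable def functional (hν : IsMomentMeasure ν L) : ℝ[X] →ₗ[ℝ] ℝ where
  toFun p := ∫ v, p.eval v ∂ν
  map_add' p q := by
    simp only [eval_add]
    exact integral_add (hν.integrable_eval p) (hν.integrable_eval q)
  map_smul' c p := by
    simp only [eval_smul, smul_eq_mul, RingHom.id_apply]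
    exact integral_const_mul _ _

lemma functional_apply (hν : IsMomentMeasure ν L) (p : ℝ[X]) :
    hν.functional p = ∫ v, p.eval v ∂ν := rfl

/-- If the integral vanished, ν would be carried by the finitely many roots of q. -/
lemma integral_mul_sq_pos (hν : IsMomentMeasure ν L) {c : ℝ → ℝ} {q : ℝ[X]} (hq : q ≠ 0)
    (hc : ∀ v ∈ Ioc 0 L, 0 < c v) (hint : Integrable (fun v => c v * q.eval v ^ 2) ν) :
    0 < ∫ v, c v * q.eval v ^ 2 ∂ν := by
  have hnn : 0 ≤ᵐ[ν] fun v => c v * q.eval v ^ 2 := by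
    filter_upwards [hν.ae_mem] with v hv
    exact mul_nonneg (hc v hv).le (sq_nonneg _)
  refine lt_of_le_of_ne (integral_nonneg_of_ae hnn) fun h0 => ?_
  rw [eq_comm, integral_eq_zero_iff_of_nonneg_ae hnn hint] at h0
  refine hν.infinite q.roots.toFinset q.roots.toFinset.finite_toSet ?_
  have : ∀ᵐ v ∂ν, v ∈ (q.roots.toFinset : Set ℝ) := by
    filter_upwards [h0, hν.ae_mem] with v hv hvm
    have h1 : q.eval v = 0 := by
      have := (mul_eq_zero.1 hv).resolve_left (hc v hvm).ne'
      exact pow_eq_zero_iff two_ne_zero |>.1 this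
    simpa [mem_roots hq] using h1
  exact this

lemma functional_mul_self_pos (hν : IsMomentMeasure ν L) {q : ℝ[X]} (hq : q ≠ 0) :
    0 < hν.functional (q * q) := by
  have h := hν.integral_mul_sq_pos (c := fun _ => 1) hq (fun _ _ => one_pos) (by
    exact (hν.integrable_eval (q ^ 2)).congr (ae_of_all _ fun v => by simp))
  rw [functional_apply]
  simpa [sq] using h

/-- There is a nonzero polynomial of degree at most `n` that is orthogonal to all polynomials of
lower degree. -/
lemma exists_orthogonal (hν : IsMomentMeasure ν L) (n : ℕ) :
    ∃ p : ℝ[X], p ≠ 0 ∧ p.natDegree ≤ n ∧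
      ∀ g : ℝ[X], g.natDegree < n → hν.functional (p * g) = 0 := by
  let T : (Fin (n + 1) → ℝ) →ₗ[ℝ] (Fin n → ℝ) :=
    LinearMap.pi fun j => hν.functional ∘ₗ (LinearMap.mulRight ℝ (X ^ (j : ℕ))) ∘ₗ
      (degreeLT ℝ (n + 1)).subtype ∘ₗ ((degreeLTEquiv ℝ (n + 1)).symm : _ →ₗ[ℝ] _)
  -- There are n + 1 coefficients and only n orthogonality conditions.
  have hker : LinearMap.ker T ≠ ⊥ := LinearMap.ker_ne_bot_of_finrank_lt (by simp)
  obtain ⟨c, hc, hc0⟩ := Submodule.exists_mem_ne_zero_of_ne_bot hker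
  set p := (degreeLTEquiv ℝ (n + 1)).symm c with hp
  have hpdeg : (p : ℝ[X]).degree < ((n + 1 : ℕ) : WithBot ℕ) := mem_degreeLT.1 p.2
  have hp0 : (p : ℝ[X]) ≠ 0 := by
    intro h
    have : p = 0 := Subtype.ext h
    exact hc0 ((LinearEquiv.map_eq_zero_iff _).1 this)
  refine ⟨p, hp0, ?_, fun g hg => ?_⟩
  · have := (natDegree_lt_iff_degree_lt hp0).2 hpdeg
    omega
  · have hmon : ∀ j < n, hν.functional ((p : ℝ[X]) * X ^ j) = 0 := fun j hj =>
      congrFun (LinearMap.mem_ker.1 hc) ⟨j, hj⟩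
    rw [as_sum_range' g n hg, Finset.mul_sum, map_sum]
    refine Finset.sum_eq_zero fun j hj => ?_
    rw [← C_mul_X_pow_eq_monomial, mul_left_comm, ← smul_eq_C_mul, map_smul,
      hmon j (Finset.mem_range.1 hj), smul_zero]

section Orthogonal

variable (hν : IsMomentMeasure ν L) {n : ℕ} {p : ℝ[X]} (hp0 : p ≠ 0) (hpn : p.natDegree ≤ n)
  (hp : ∀ g : ℝ[X], g.natDegree < n → hν.functional (p * g) = 0)

include hp0 hpn hp

/-- Pairing p = f g with the cofactor g, of degree below n, would give ∫ f g² dν = 0 although f is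
positive on the carrier. The location and the reality of the roots of p both follow by exhibiting
such a factor f. -/
lemma not_eq_mul_of_pos {f g : ℝ[X]} (hpfg : p = f * g) (hf : f.natDegree ≠ 0) :
    ¬ ∀ v ∈ Ioc 0 L, 0 < f.eval v := by
  intro hpos
  have hf0 : f ≠ 0 := by rintro rfl; simp at hf
  have hg0 : g ≠ 0 := by rintro rfl; simp [hp0] at hpfg
  have hdeg : g.natDegree < n := by
    rw [hpfg, natDegree_mul hf0 hg0] at hpn
    omega
  have h1 := hp g hdeg
  have h2 := hν.integral_mul_sq_pos (c := fun v => f.eval v) hg0 hpos (by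
    exact (hν.integrable_eval (f * g ^ 2)).congr (ae_of_all _ fun v => by simp))
  rw [functional_apply, hpfg] at h1
  refine h2.ne' ?_
  rw [← h1]
  refine integral_congr_ae (ae_of_all _ fun v => ?_)
  simp only [eval_mul]
  ring

lemma root_mem {c : ℝ} (hc : p.IsRoot c) : c ∈ Ioc 0 L := by
  obtain ⟨g, hg⟩ := dvd_iff_isRoot.2 hc
  refine ⟨?_, ?_⟩ <;> by_contra hcon
  · exact hν.not_eq_mul_of_pos hp0 hpn hp hg (by simp) fun v hv => by
      simp only [eval_sub, eval_X, eval_C]; linarith [hv.1]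
  · exact hν.not_eq_mul_of_pos hp0 hpn hp (f := -(X - C c)) (g := -g) (by rw [hg]; ring)
      (by rw [natDegree_neg, natDegree_X_sub_C]; norm_num) fun v hv => by
      simp only [eval_neg, eval_sub, eval_X, eval_C]; linarith [hv.2]

/-- A double root c would give p = (X - c)² g, and pairing p with g produces the integral of ((X -
c) g)². -/
lemma roots_nodup : p.roots.Nodup := by
  rw [Multiset.nodup_iff_count_le_one]
  intro c
  rw [count_roots]
  by_contra hcon
  obtain ⟨g, hg⟩ := (le_rootMultiplicity_iff hp0 (a := c) (n := 2)).1 (by omega)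
  have hg0 : g ≠ 0 := by rintro rfl; simp [hp0] at hg
  have hdeg : g.natDegree < n := by
    rw [hg, natDegree_mul (pow_ne_zero _ (X_sub_C_ne_zero c)) hg0, natDegree_pow,
      natDegree_X_sub_C] at hpn
    omega
  have h1 := hp g hdeg
  have h2 := hν.functional_mul_self_pos (mul_ne_zero (X_sub_C_ne_zero c) hg0)
  refine h2.ne' ?_
  rw [← h1, hg]
  congr 1
  ring

/-- A non-real root contributes a real quadratic factor that is positive on the whole line, which
`not_eq_mul_of_pos` excludes. -/
lemma card_roots_eq_natDegree : p.roots.card = p.natDegree := by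
  obtain ⟨q, hq, hcard, hqr⟩ := exists_prod_multiset_X_sub_C_mul p
  suffices q.natDegree = 0 by omega
  by_contra hq0
  obtain ⟨z, hz⟩ := IsAlgClosed.exists_aeval_eq_zero ℂ q (by
    intro h; exact hq0 (natDegree_eq_of_degree_eq_some h))
  have hqne : q ≠ 0 := by rintro rfl; simp at hq0
  by_cases him : z.im = 0
  · have hzr : z = ((z.re : ℝ) : ℂ) := Complex.ext (by simp) (by simp [him])
    rw [hzr] at hz
    have h1 : q.eval z.re = 0 := by
      have h2 := Polynomial.aeval_algebraMap_apply ℂ z.re q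
      rw [Complex.coe_algebraMap] at h2
      rw [h2, Complex.ofReal_eq_zero] at hz
      simpa using hz
    have h3 : z.re ∈ q.roots := (mem_roots hqne).2 h1
    rw [hqr] at h3
    simp at h3
  · have hzp : aeval z p = 0 := by rw [← hq, map_mul, hz, mul_zero]
    obtain ⟨g, hg⟩ := quadratic_dvd_of_aeval_eq_zero_im_ne_zero p hzp him
    refine hν.not_eq_mul_of_pos hp0 hpn hp hg ?_ fun v _ => ?_
    · have : (X ^ 2 - C (2 * z.re) * X + C (‖z‖ ^ 2) : ℝ[X])
          = C 1 * X ^ 2 + C (-(2 * z.re)) * X + C (‖z‖ ^ 2) := by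
        simp only [map_one, map_neg]; ring
      rw [this, natDegree_quadratic one_ne_zero]
      norm_num
    · simp only [eval_add, eval_sub, eval_mul, eval_pow, eval_X, eval_C]
      rw [Complex.sq_norm, Complex.normSq_apply]
      have : 0 < z.im * z.im := mul_self_pos.2 him
      nlinarith [sq_nonneg (v - z.re)]

/-- If the degree were smaller, p would be orthogonal to itself. -/
lemma natDegree_eq : p.natDegree = n := by
  by_contra hne
  have h1 := hp p (by omega)
  exact (hν.functional_mul_self_pos hp0).ne' h1

end Orthogonal

/-- Existence of Gaussian quadrature. -/
theorem exists_isGaussianQuadrature (hν : IsMomentMeasure ν L) {n : ℕ} (hn : 1 ≤ n) :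
    ∃ x w : Fin n → ℝ, IsGaussianQuadrature ν (Icc 0 L) x w := by
  obtain ⟨p, hp0, hpn, hp⟩ := hν.exists_orthogonal n
  have hdeg := hν.natDegree_eq hp0 hpn hp
  have hcard : p.roots.toFinset.card = n := by
    rw [Multiset.toFinset_card_of_nodup (hν.roots_nodup hp0 hpn hp),
      hν.card_roots_eq_natDegree hp0 hpn hp, hdeg]
  let x : Fin n → ℝ := fun i => ((Finset.equivFinOfCardEq hcard).symm i : ℝ)
  have hxinj : Function.Injective x :=
    Subtype.val_injective.comp (Finset.equivFinOfCardEq hcard).symm.injective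
  have hxroot : ∀ i, p.IsRoot (x i) := fun i => by
    have := ((Finset.equivFinOfCardEq hcard).symm i).2
    rw [Multiset.mem_toFinset] at this
    exact isRoot_of_mem_roots this
  let l : Fin n → ℝ[X] := Lagrange.basis Finset.univ x
  let w : Fin n → ℝ := fun i => hν.functional (l i)
  have hinj : Set.InjOn x (Finset.univ : Finset (Fin n)) := hxinj.injOn
  -- Divide f by p: the quotient has degree below n, so its product with p integrates to 0, and the
  -- remainder agrees with f at the nodes and is recovered by Lagrange interpolation.
  have hexact : ∀ f : ℝ[X], f.natDegree < 2 * n →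
      hν.functional f = ∑ i, f.eval (x i) * w i := by
    intro f hf
    have hmod : (f % p).degree < (Finset.univ : Finset (Fin n)).card := by
      have h1 : (f % p).degree < p.degree := EuclideanDomain.mod_lt f hp0
      rw [degree_eq_natDegree hp0, hdeg] at h1
      simpa using h1
    have hdiv : (f / p).natDegree < n := by
      by_cases h0 : f / p = 0
      · rw [h0, natDegree_zero]; omega
      · have h1 : p.degree ≤ f.degree := by
          by_contra hlt
          exact h0 ((Polynomial.div_eq_zero_iff hp0).2 (not_le.1 hlt))
        have h2 := degree_add_div hp0 h1
        have hf0 : f ≠ 0 := by rintro rfl; simp at h0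
        rw [degree_eq_natDegree hp0, degree_eq_natDegree h0, degree_eq_natDegree hf0] at h2
        have h3 : p.natDegree + (f / p).natDegree = f.natDegree := by exact_mod_cast h2
        omega
    have heval : ∀ i, (f % p).eval (x i) = f.eval (x i) := by
      intro i
      conv_rhs => rw [← EuclideanDomain.div_add_mod f p]
      have h1 : p.eval (x i) = 0 := hxroot i
      rw [eval_add, eval_mul, h1]
      ring
    calc hν.functional f = hν.functional (p * (f / p) + f % p) := by
          rw [EuclideanDomain.div_add_mod]
      _ = hν.functional (f % p) := by rw [map_add, hp _ hdiv, zero_add]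
      _ = _ := by
          conv_lhs => rw [Lagrange.eq_interpolate hinj hmod, Lagrange.interpolate_apply, map_sum]
          refine Finset.sum_congr rfl fun i _ => ?_
          rw [← smul_eq_C_mul, map_smul, smul_eq_mul, heval]
  refine ⟨x, w, hxinj, fun i => Ioc_subset_Icc_self (hν.root_mem hp0 hpn hp (hxroot i)),
    fun i => ?_, fun j _ => hν.integrable (by fun_prop), fun j hj => ?_⟩
  · have hl0 : l i ≠ 0 := Lagrange.basis_ne_zero hinj (Finset.mem_univ i)
    have hld : (l i).natDegree = n - 1 := by
      simpa using Lagrange.natDegree_basis hinj (Finset.mem_univ i)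
    -- Exactness for the square of the i-th Lagrange polynomial, of degree 2n - 2, exhibits the
    -- weight as the integral of a square.
    have h1 := hexact (l i * l i) (by rw [natDegree_mul hl0 hl0, hld]; omega)
    have h2 : ∑ j, (l i * l i).eval (x j) * w j = w i := by
      rw [Finset.sum_eq_single i]
      · have : (l i).eval (x i) = 1 := Lagrange.eval_basis_self hinj (Finset.mem_univ i)
        rw [eval_mul, this]; ring
      · intro j _ hji
        have : (l i).eval (x j) = 0 := Lagrange.eval_basis_of_ne hji.symm (Finset.mem_univ j)
        rw [eval_mul, this]; ring
      · simp
    rw [← h2, ← h1]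
    exact hν.functional_mul_self_pos hl0
  · have := hexact (X ^ j) (by rw [natDegree_X_pow]; exact hj)
    simpa [functional_apply] using this

end IsMomentMeasure


/-! ### Positivity and error bounds for an arbitrary Gaussian quadrature -/

namespace IsGaussianQuadrature

open Polynomial

variable {ν : Measure ℝ} {L : ℝ} {n : ℕ} {x w : Fin n → ℝ}

lemma integral_eval (hq : IsGaussianQuadrature ν (Icc 0 L) x w) {f : ℝ[X]}
    (hf : f.natDegree < 2 * n) : ∫ v, f.eval v ∂ν = ∑ i, f.eval (x i) * w i := by
  simp only [eval_eq_sum_range' hf]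
  rw [integral_finsetSum _ fun j hj => (hq.integrable j (Finset.mem_range.1 hj)).const_mul _]
  simp only [Finset.sum_mul]
  rw [Finset.sum_comm]
  refine Finset.sum_congr rfl fun j hj => ?_
  rw [integral_const_mul, hq.moment_eq j (Finset.mem_range.1 hj), Finset.mul_sum]
  exact Finset.sum_congr rfl fun i _ => by ring

lemma integral_eval_complex (hq : IsGaussianQuadrature ν (Icc 0 L) x w) {f : ℂ[X]}
    (hf : f.natDegree < 2 * n) :
    ∫ v : ℝ, f.eval (v : ℂ) ∂ν = ∑ i, f.eval (x i : ℂ) * w i := by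
  simp only [eval_eq_sum_range' hf]
  have hint : ∀ j < 2 * n, Integrable (fun v : ℝ => (v : ℂ) ^ j) ν := fun j hj => by
    simpa using (hq.integrable j hj).ofReal (𝕜 := ℂ)
  rw [integral_finsetSum _ fun j hj => (hint j (Finset.mem_range.1 hj)).const_mul _]
  simp only [Finset.sum_mul]
  rw [Finset.sum_comm]
  refine Finset.sum_congr rfl fun j hj => ?_
  have h1 : ∫ v : ℝ, (v : ℂ) ^ j ∂ν = ((∫ v : ℝ, v ^ j ∂ν : ℝ) : ℂ) := by
    rw [← integral_complex_ofReal]; simp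
  rw [integral_const_mul, h1, hq.moment_eq j (Finset.mem_range.1 hj)]
  push_cast
  rw [Finset.mul_sum]
  exact Finset.sum_congr rfl fun i _ => by ring

lemma natDegree_prod_X_sub_C (s : Finset (Fin n)) (x : Fin n → ℝ) :
    (∏ i ∈ s, (X - C (x i))).natDegree = s.card := by
  rw [natDegree_prod _ _ fun i _ => X_sub_C_ne_zero _]
  simp

/-- If 0 were a node, X times the squared product over the other nodes would have degree 2n - 1 and
vanish at every node, while its integral is positive. -/
lemma node_pos (hν : IsMomentMeasure ν L) (hq : IsGaussianQuadrature ν (Icc 0 L) x w)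
    (i : Fin n) : 0 < x i := by
  refine lt_of_le_of_ne (hq.mem i).1 fun h0 => ?_
  set q : ℝ[X] := ∏ j ∈ Finset.univ.erase i, (X - C (x j)) with hqdef
  have hq0 : q ≠ 0 := Finset.prod_ne_zero_iff.2 fun j _ => X_sub_C_ne_zero _
  have hqd : q.natDegree = n - 1 := by
    rw [hqdef, natDegree_prod_X_sub_C]; simp
  have hn : 0 < n := i.pos
  have hdeg : (X * q ^ 2).natDegree < 2 * n := by
    rw [natDegree_mul X_ne_zero (pow_ne_zero _ hq0), natDegree_X, natDegree_pow, hqd]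
    omega
  have h1 := hq.integral_eval hdeg
  have h2 : ∑ j, (X * q ^ 2).eval (x j) * w j = 0 := by
    refine Finset.sum_eq_zero fun j _ => ?_
    by_cases hji : j = i
    · rw [hji, eval_mul, eval_X, ← h0]; ring
    · have : q.eval (x j) = 0 := by
        rw [hqdef, eval_prod]
        exact Finset.prod_eq_zero (Finset.mem_erase.2 ⟨hji, Finset.mem_univ j⟩) (by simp)
      rw [eval_mul, eval_pow, this]; ring
  have h3 := hν.integral_mul_sq_pos (c := fun v => v) hq0 (fun v hv => hv.1)
    ((hν.integrable_eval (X * q ^ 2)).congr (ae_of_all _ fun v => by simp))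
  refine h3.ne' ?_
  rw [← h2, ← h1]
  refine integral_congr_ae (ae_of_all _ fun v => ?_)
  simp

/-- The quadrature formula underestimates the integral of `1 / v`. -/
lemma sum_div_le (hν : IsMomentMeasure ν L) (hq : IsGaussianQuadrature ν (Icc 0 L) x w)
    (hint : Integrable (fun v : ℝ => v⁻¹) ν) : ∑ i, w i / x i ≤ ∫ v, v⁻¹ ∂ν := by
  rcases Nat.eq_zero_or_pos n with rfl | hn
  · simp only [Finset.univ_eq_empty, Finset.sum_empty]
    refine integral_nonneg_of_ae ?_
    filter_upwards [hν.ae_mem] with v hv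
    exact (inv_pos.2 hv.1).le
  set ω : ℝ[X] := ∏ j, (X - C (x j)) with hω
  have hωd : ω.natDegree = n := by rw [hω, natDegree_prod_X_sub_C]; simp
  have hω0 : ω.eval 0 ≠ 0 := by
    rw [hω, eval_prod, Finset.prod_ne_zero_iff]
    intro j _
    simpa using (node_pos hν hq j).ne'
  have hωx : ∀ i, ω.eval (x i) = 0 := fun i => by
    rw [hω, eval_prod]
    exact Finset.prod_eq_zero (Finset.mem_univ i) (by simp)
  set c : ℝ := ω.eval 0 ^ 2 with hc
  have hcpos : 0 < c := by positivity
  -- h(v) = (1 - ω(v)²/ω(0)²)/v is the polynomial of degree below 2n that agrees with 1/v at the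
  -- nodes; the error ω(v)²/(ω(0)² v) is nonnegative, whence the sign of the inequality.
  set h : ℝ[X] := C (-c⁻¹) * (ω ^ 2).divX with hh
  have hdeg : h.natDegree < 2 * n := by
    have h1 := natDegree_C_mul_le (-c⁻¹) (ω ^ 2).divX
    rw [natDegree_divX_eq_natDegree_tsub_one, natDegree_pow, hωd, ← hh] at h1
    omega
  have heval : ∀ v : ℝ, v ≠ 0 → v⁻¹ = h.eval v + c⁻¹ * (v⁻¹ * ω.eval v ^ 2) := by
    intro v hv
    have h1 := congrArg (eval v) (divX_mul_X_add (ω ^ 2))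
    rw [eval_add, eval_mul, eval_X, eval_C, coeff_zero_eq_eval_zero, eval_pow, eval_pow, ← hc] at h1
    rw [hh, eval_mul, eval_C, ← h1]
    field_simp
    ring
  have hI := hq.integral_eval hdeg
  have hs : ∑ i, h.eval (x i) * w i = ∑ i, w i / x i := by
    refine Finset.sum_congr rfl fun i _ => ?_
    have h1 := heval (x i) (node_pos hν hq i).ne'
    rw [hωx i] at h1
    rw [div_eq_inv_mul, h1]
    ring
  rw [← hs, ← hI]
  refine integral_mono_ae (hν.integrable_eval h) hint ?_
  filter_upwards [hν.ae_mem] with v hv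
  have hv0 : 0 < v := hv.1
  rw [heval v hv0.ne']
  have : 0 ≤ c⁻¹ * (v⁻¹ * ω.eval v ^ 2) := by positivity
  linarith

lemma sum_weights (hq : IsGaussianQuadrature ν (Icc 0 L) x w) (hn : 1 ≤ n) :
    ∑ i, w i = ν.real univ := by
  have := hq.moment_eq 0 (by omega)
  simpa using this.symm

/-- The polynomial drops out by exactness. The weights are positive with sum the mass of ν, so the
integral and the quadrature of g - f each contribute at most mass times ε. -/
lemma norm_integral_sub_sum_le (hν : IsMomentMeasure ν L)
    (hq : IsGaussianQuadrature ν (Icc 0 L) x w) (hn : 1 ≤ n) {g : ℝ → ℂ} {f : ℂ[X]}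
    (hf : f.natDegree < 2 * n) {ε : ℝ} (hg : Integrable g ν)
    (hfg : ∀ v ∈ Icc 0 L, ‖g v - f.eval (v : ℂ)‖ ≤ ε) :
    ‖∫ v, g v ∂ν - ∑ i, g (x i) * w i‖ ≤ 2 * ν.real univ * ε := by
  have := hν.isFiniteMeasure
  have hfi : Integrable (fun v : ℝ => f.eval (v : ℂ)) ν :=
    hν.integrable (f.continuous.comp Complex.continuous_ofReal).continuousOn
  have h1 : ∫ v, g v ∂ν - ∑ i, g (x i) * w i
      = ∫ v, (g v - f.eval (v : ℂ)) ∂ν - ∑ i, (g (x i) - f.eval (x i : ℂ)) * w i := by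
    rw [integral_sub hg hfi, hq.integral_eval_complex hf]
    simp only [sub_mul, Finset.sum_sub_distrib]
    ring
  have h2 : ‖∫ v, (g v - f.eval (v : ℂ)) ∂ν‖ ≤ ε * ν.real univ := by
    refine norm_integral_le_of_norm_le_const ?_
    filter_upwards [hν.ae_mem] with v hv using hfg v (Ioc_subset_Icc_self hv)
  have h3 : ‖∑ i, (g (x i) - f.eval (x i : ℂ)) * w i‖ ≤ ε * ν.real univ := by
    rw [← hq.sum_weights hn, Finset.mul_sum]
    refine (norm_sum_le _ _).trans (Finset.sum_le_sum fun i _ => ?_)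
    rw [norm_mul, Complex.norm_real, Real.norm_of_nonneg (hq.weight_pos i).le]
    exact mul_le_mul_of_nonneg_right (hfg _ (hq.mem i)) (hq.weight_pos i).le
  rw [h1]
  refine (norm_sub_le _ _).trans ?_
  linarith

end IsGaussianQuadrature

/-! ### Quadrature error for Stieltjes functions -/

/-- The Stieltjes function of the quadrature measure `∑ w_i δ_{x_i}`. -/
noncomputable def quadratureStieltjes {n : ℕ} (x w : Fin n → ℝ) (z : ℂ) : ℂ :=
  ∑ i, (w i : ℂ) / (1 - z * x i)

open Polynomial in
/-- The error of the quadrature for a Stieltjes function, by means of a geometric series around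
the point `b`. -/
lemma norm_stieltjes_sub_le {ν : Measure ℝ} {L : ℝ} {n : ℕ} {x w : Fin n → ℝ}
    (hν : IsMomentMeasure ν L) (hq : IsGaussianQuadrature ν (Icc 0 L) x w) (hn : 1 ≤ n)
    {z b : ℂ} {r : ℝ} (hr1 : r < 1) (hzb : 1 - z * b ≠ 0)
    (hr : ∀ v ∈ Icc 0 L, ‖z * (v - b)‖ ≤ r * ‖1 - z * b‖) :
    ‖quadratureStieltjes x w z - stieltjes ν z‖
      ≤ 2 * ν.real univ * (‖1 - z * b‖⁻¹ * (r ^ (2 * n) / (1 - r))) := by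
  have hnz : 0 < ‖1 - z * b‖ := norm_pos_iff.2 hzb
  set d : ℂ := 1 - z * b with hd
  set y : ℂ := z / d with hy
  have hyv : ∀ v ∈ Icc 0 L, ‖y * (v - b)‖ ≤ r := by
    intro v hv
    rw [hy, div_mul_eq_mul_div, norm_div, div_le_iff₀ hnz]
    exact hr v hv
  -- Recentring at b turns the kernel into a geometric series in y (v - b), whose ratio is at most r
  -- on the whole interval.
  have hfac : ∀ v : ℝ, 1 - z * v = d * (1 - y * (v - b)) := by
    intro v
    rw [hy]
    field_simp
    rw [hd]
    ring
  have hne : ∀ v ∈ Icc 0 L, 1 - y * (v - b) ≠ 0 := by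
    intro v hv h0
    have h1 : y * (v - b) = 1 := (sub_eq_zero.1 h0).symm
    have h2 := hyv v hv
    rw [h1, norm_one] at h2
    linarith
  have hr0 : 0 ≤ r := (norm_nonneg _).trans (hyv 0 ⟨le_rfl, hν.pos.le⟩)
  -- The partial sum with 2n terms has degree at most 2n - 1, within the range of exactness.
  set f : ℂ[X] := ∑ j ∈ Finset.range (2 * n), C (d⁻¹ * y ^ j) * (X - C b) ^ j with hf
  have hfd : f.natDegree < 2 * n := by
    have : f.natDegree ≤ 2 * n - 1 := by
      refine natDegree_sum_le_of_forall_le _ _ fun j hj => ?_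
      refine (natDegree_C_mul_le _ _).trans ?_
      rw [natDegree_pow, natDegree_X_sub_C]
      have := Finset.mem_range.1 hj
      omega
    omega
  have hfe : ∀ v ∈ Icc 0 L, (1 - z * (v : ℂ))⁻¹ - f.eval (v : ℂ)
      = d⁻¹ * ((y * (v - b)) ^ (2 * n) / (1 - y * (v - b))) := by
    intro v hv
    have h1 : f.eval (v : ℂ) = d⁻¹ * ∑ j ∈ Finset.range (2 * n), (y * (v - b)) ^ j := by
      rw [hf, eval_finsetSum, Finset.mul_sum]
      refine Finset.sum_congr rfl fun j _ => ?_
      simp only [eval_mul, eval_C, eval_pow, eval_sub, eval_X, mul_pow]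
      ring
    have h2 := geom_sum_mul_neg (y * ((v : ℂ) - b)) (2 * n)
    have h3 := hne v hv
    rw [h1, hfac, mul_inv, ← mul_sub]
    congr 1
    rw [eq_div_iff h3, sub_mul, inv_mul_cancel₀ h3, h2]
    ring
  have hcont : ContinuousOn (fun v : ℝ => (1 - z * (v : ℂ))⁻¹) (Icc 0 L) := by
    refine ContinuousOn.inv₀ (by fun_prop) fun v hv => ?_
    rw [hfac]
    exact mul_ne_zero hzb (hne v hv)
  have hmain := hq.norm_integral_sub_sum_le hν hn hfd (hν.integrable hcont)
    (ε := ‖d‖⁻¹ * (r ^ (2 * n) / (1 - r))) (fun v hv => by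
      rw [hfe v hv, norm_mul, norm_inv, norm_div, norm_pow]
      have h1 := hyv v hv
      have h2 : 1 - r ≤ ‖1 - y * ((v : ℂ) - b)‖ := by
        have := norm_sub_norm_le (1 : ℂ) (y * ((v : ℂ) - b))
        rw [norm_one] at this
        linarith
      gcongr)
  have hsum : quadratureStieltjes x w z = ∑ i, (1 - z * (x i : ℂ))⁻¹ * w i :=
    Finset.sum_congr rfl fun i _ => by rw [div_eq_inv_mul]
  rw [norm_sub_rev, hsum]
  exact hmain

/-- Near `0`, the quadrature error is of order `2 n`. -/
lemma quadratureStieltjes_sub_isBigO {ν : Measure ℝ} {L : ℝ} {n : ℕ} {x w : Fin n → ℝ}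
    (hν : IsMomentMeasure ν L) (hq : IsGaussianQuadrature ν (Icc 0 L) x w) (hn : 1 ≤ n) :
    (fun z => quadratureStieltjes x w z - stieltjes ν z) =O[𝓝 0] (fun z : ℂ => z ^ (2 * n)) := by
  refine Asymptotics.IsBigO.of_bound (2 * ν.real univ * (L ^ (2 * n) * 2)) ?_
  have hev : ∀ᶠ z : ℂ in 𝓝 0, ‖z‖ * L < 1 / 2 := by
    have : Tendsto (fun z : ℂ => ‖z‖ * L) (𝓝 0) (𝓝 (‖(0 : ℂ)‖ * L)) := by
      refine Continuous.tendsto ?_ _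
      fun_prop
    rw [norm_zero, zero_mul] at this
    exact this.eventually_lt_const (by norm_num)
  filter_upwards [hev] with z hz
  have hL := hν.pos
  have h1 := norm_stieltjes_sub_le hν hq hn (z := z) (b := 0) (r := ‖z‖ * L) (by linarith)
    (by simp) (fun v hv => by
      simp only [sub_zero, mul_zero, norm_one, mul_one, norm_mul, Complex.norm_real]
      rw [Real.norm_of_nonneg hv.1]
      exact mul_le_mul_of_nonneg_left hv.2 (norm_nonneg _))
  refine h1.trans ?_
  simp only [mul_zero, sub_zero, norm_one, inv_one, one_mul]
  have h2 : (‖z‖ * L) ^ (2 * n) / (1 - ‖z‖ * L) ≤ (‖z‖ * L) ^ (2 * n) * 2 := by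
    rw [div_le_iff₀ (by linarith)]
    have : 0 ≤ (‖z‖ * L) ^ (2 * n) := by positivity
    nlinarith
  calc 2 * ν.real univ * ((‖z‖ * L) ^ (2 * n) / (1 - ‖z‖ * L))
      ≤ 2 * ν.real univ * ((‖z‖ * L) ^ (2 * n) * 2) := by gcongr
    _ = _ := by rw [norm_pow, mul_pow]; ring

/-- Geometrically (for z ≠ 0), b is the centre of a disc that contains [0, 1/ρ] but not 1/z. It is
sought on the perpendicular bisector, b = L/2 + it, with B the distance to the endpoints; then |1 -
zb|² - |z|² B² = 1 - L Re z + 2t Im z. A suitable t makes this positive if Im z ≠ 0, and for real z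
< ρ one takes t = 0. -/
lemma exists_center {ρ : ℝ} (hρ : 0 < ρ) {z : ℂ} (hz : z ∈ cutPlane ρ) :
    ∃ b : ℂ, ∃ B : ℝ, 0 ≤ B ∧ (∀ v ∈ Icc 0 (1 / ρ), ‖(v : ℂ) - b‖ ≤ B) ∧
      ‖z‖ * B < ‖1 - z * b‖ := by
  obtain ⟨t, ht⟩ : ∃ t : ℝ, z.re * (1 / ρ) - 2 * z.im * t < 1 := by
    by_cases him : z.im = 0
    · refine ⟨0, ?_⟩
      have h1 : z.re < ρ := by
        by_contra hcon
        exact hz ⟨z.re, not_lt.1 hcon, Complex.ext (by simp) (by simp [him])⟩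
      rw [mul_zero, sub_zero, mul_one_div, div_lt_one hρ]
      exact h1
    · refine ⟨z.re * (1 / ρ) / (2 * z.im), ?_⟩
      rw [mul_div_cancel₀ _ (mul_ne_zero two_ne_zero him)]
      linarith
  set L := 1 / ρ with hL
  refine ⟨⟨L / 2, t⟩, Real.sqrt ((L / 2) ^ 2 + t ^ 2), Real.sqrt_nonneg _, fun v hv => ?_, ?_⟩
  · refine Real.le_sqrt_of_sq_le ?_
    rw [Complex.sq_norm, Complex.normSq_apply]
    simp only [Complex.sub_re, Complex.ofReal_re, Complex.sub_im, Complex.ofReal_im]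
    nlinarith [hv.1, hv.2, mul_nonneg hv.1 (sub_nonneg.2 hv.2)]
  · refine lt_of_pow_lt_pow_left₀ 2 (norm_nonneg _) ?_
    rw [mul_pow, Real.sq_sqrt (by positivity), Complex.sq_norm, Complex.sq_norm,
      Complex.normSq_apply, Complex.normSq_apply]
    simp only [Complex.sub_re, Complex.one_re, Complex.mul_re, Complex.sub_im, Complex.one_im,
      Complex.mul_im]
    nlinarith

/-- Geometric convergence of the quadrature of Stieltjes functions on compact subsets of the cut
plane. -/
lemma exists_geometric_bound {ν : Measure ℝ} {ρ : ℝ} (hρ : 0 < ρ)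
    (hν : IsMomentMeasure ν (1 / ρ)) {A : Set ℂ} (hA : IsCompact A) (hAρ : A ⊆ cutPlane ρ) :
    ∃ K r : ℝ, 0 ≤ K ∧ 0 < r ∧ r < 1 ∧ ∀ z ∈ A, ∀ (n : ℕ) (x w : Fin n → ℝ), 1 ≤ n →
      IsGaussianQuadrature ν (Icc 0 (1 / ρ)) x w →
        ‖quadratureStieltjes x w z - stieltjes ν z‖ ≤ K * r ^ (2 * n) := by
  refine hA.induction_on (p := fun A => ∃ K r : ℝ, 0 ≤ K ∧ 0 < r ∧ r < 1 ∧ ∀ z ∈ A,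
      ∀ (n : ℕ) (x w : Fin n → ℝ), 1 ≤ n → IsGaussianQuadrature ν (Icc 0 (1 / ρ)) x w →
        ‖quadratureStieltjes x w z - stieltjes ν z‖ ≤ K * r ^ (2 * n)) ?_ ?_ ?_ ?_
  · exact ⟨0, 1 / 2, le_rfl, by norm_num, by norm_num, by simp⟩
  · rintro s t hst ⟨K, r, hK, hr0, hr1, h⟩
    exact ⟨K, r, hK, hr0, hr1, fun z hz => h z (hst hz)⟩
  · rintro s t ⟨K, r, hK, hr0, hr1, h⟩ ⟨K', r', hK', hr0', hr1', h'⟩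
    refine ⟨max K K', max r r', hK.trans (le_max_left _ _), hr0.trans_le (le_max_left _ _),
      max_lt hr1 hr1', fun z hz n x w hn hq => ?_⟩
    rcases hz with hz | hz
    · refine (h z hz n x w hn hq).trans ?_
      gcongr
      · exact le_max_left _ _
      · exact le_max_left _ _
    · refine (h' z hz n x w hn hq).trans ?_
      gcongr
      · exact le_max_right _ _
      · exact le_max_right _ _
  -- The centre chosen for z₀ serves for all nearby z, because the defining inequality is strict and
  -- both of its sides are continuous.
  · intro z₀ hz₀
    obtain ⟨b, B, hB0, hB, hlt⟩ := exists_center hρ (hAρ hz₀)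
    have hd0 : 0 < ‖1 - z₀ * b‖ := (mul_nonneg (norm_nonneg _) hB0).trans_lt hlt
    obtain ⟨r, hr0, hr1, hr⟩ : ∃ r : ℝ, 0 < r ∧ r < 1 ∧ ‖z₀‖ * B < r * ‖1 - z₀ * b‖ := by
      have h1 : ‖z₀‖ * B / ‖1 - z₀ * b‖ < 1 := (div_lt_one hd0).2 hlt
      -- The maximum with 0 keeps r positive, as its logarithm later yields the exponential rate.
      obtain ⟨r, h2, h3⟩ := exists_between (max_lt h1 (zero_lt_one' ℝ))
      exact ⟨r, (le_max_right _ _).trans_lt h2, h3,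
        (div_lt_iff₀ hd0).1 ((le_max_left _ _).trans_lt h2)⟩
    have hev1 : ∀ᶠ z : ℂ in 𝓝 z₀, ‖z‖ * B < r * ‖1 - z * b‖ :=
      (by fun_prop : Continuous fun z : ℂ => ‖z‖ * B).continuousAt.eventually_lt
        (by fun_prop : Continuous fun z : ℂ => r * ‖1 - z * b‖).continuousAt hr
    have hev2 : ∀ᶠ z : ℂ in 𝓝 z₀, ‖1 - z₀ * b‖ / 2 < ‖1 - z * b‖ :=
      (by fun_prop : Continuous fun z : ℂ => ‖1 - z * b‖).continuousAt.eventually_const_lt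
        (by linarith)
    refine ⟨{z | ‖z‖ * B < r * ‖1 - z * b‖ ∧ ‖1 - z₀ * b‖ / 2 < ‖1 - z * b‖},
      mem_nhdsWithin_of_mem_nhds (hev1.and hev2),
      2 * ν.real univ * ((‖1 - z₀ * b‖ / 2)⁻¹ / (1 - r)), r, ?_, hr0, hr1, ?_⟩
    · have : 0 < 1 - r := by linarith
      positivity
    · rintro z ⟨hz1, hz2⟩ n x w hn hq
      have hzb : 1 - z * b ≠ 0 := by
        rw [← norm_pos_iff]; linarith
      have h1 := norm_stieltjes_sub_le hν hq hn hr1 hzb (fun v hv => by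
        rw [norm_mul]
        exact (mul_le_mul_of_nonneg_left (hB v hv) (norm_nonneg _)).trans hz1.le)
      refine h1.trans ?_
      have h2 : ‖1 - z * b‖⁻¹ ≤ (‖1 - z₀ * b‖ / 2)⁻¹ := inv_anti₀ (by linarith) hz2.le
      have h3 : 0 < 1 - r := by linarith
      calc _ ≤ 2 * ν.real univ * ((‖1 - z₀ * b‖ / 2)⁻¹ * (r ^ (2 * n) / (1 - r))) := by gcongr
        _ = _ := by ring


/-! ### Padé approximants -/

section Pade

open Polynomial

/-- Otherwise p = z^k q with k < N and q(0) ≠ 0; dividing the bound by z^k and letting z tend to 0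
forces q(0) = 0. -/
lemma eq_zero_of_isBigO_pow {p : ℂ[X]} {N : ℕ} (hdeg : p.natDegree < N)
    (hO : (fun z => p.eval z) =O[𝓝 0] (fun z : ℂ => z ^ N)) : p = 0 := by
  by_contra hp
  obtain ⟨q, hq, hndvd⟩ := exists_eq_pow_rootMultiplicity_mul_and_not_dvd p hp 0
  set k := rootMultiplicity 0 p with hk
  have hkN : k < N := by
    have := natDegree_le_of_dvd (pow_rootMultiplicity_dvd p 0) hp
    rw [natDegree_pow, natDegree_X_sub_C, mul_one] at this
    exact this.trans_lt hdeg
  have hq0 : q.eval 0 ≠ 0 := fun h => hndvd (dvd_iff_isRoot.2 h)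
  obtain ⟨C, hC⟩ := hO.bound
  have h1 : ∀ᶠ z : ℂ in 𝓝[≠] 0, ‖q.eval z‖ ≤ C * ‖z‖ ^ (N - k) := by
    filter_upwards [nhdsWithin_le_nhds hC, self_mem_nhdsWithin] with z hz hz0
    have hz0' : 0 < ‖z‖ ^ k := pow_pos (norm_pos_iff.2 hz0) k
    rw [hq] at hz
    simp only [map_zero, sub_zero, eval_mul, eval_pow, eval_X, norm_mul, norm_pow] at hz
    have h2 : ‖z‖ ^ N = ‖z‖ ^ k * ‖z‖ ^ (N - k) := by rw [← pow_add]; congr 1; omega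
    rw [h2, mul_left_comm] at hz
    exact le_of_mul_le_mul_left hz hz0'
  have h3 : Tendsto (fun z : ℂ => ‖q.eval z‖) (𝓝[≠] 0) (𝓝 ‖q.eval 0‖) :=
    (q.continuous.norm.tendsto 0).mono_left nhdsWithin_le_nhds
  have h4 : Tendsto (fun z : ℂ => C * ‖z‖ ^ (N - k)) (𝓝[≠] 0) (𝓝 0) := by
    have : Tendsto (fun z : ℂ => C * ‖z‖ ^ (N - k)) (𝓝 0) (𝓝 (C * ‖(0 : ℂ)‖ ^ (N - k))) := by
      refine Continuous.tendsto ?_ _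
      fun_prop
    rw [norm_zero, zero_pow (by omega), mul_zero] at this
    exact this.mono_left nhdsWithin_le_nhds
  exact hq0 (norm_le_zero_iff.1 (le_of_tendsto_of_tendsto h3 h4 h1))

/-- The cross-multiplied difference has degree at most m + n but vanishes to order m + n + 1, so it
is zero. Coprimality then makes the two fractions agree up to a common constant, which gives
equality even at the poles. -/
lemma IsPadeApproximant.unique {f : ℂ → ℂ} {m n : ℕ} {R R' : ℂ → ℂ}
    (h : IsPadeApproximant f 0 m n R) (h' : IsPadeApproximant f 0 m n R') : R = R' := by
  obtain ⟨p, q, hp, hq, hq0, hpq, hR, hO⟩ := h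
  obtain ⟨p', q', hp', hq', hq0', hpq', hR', hO'⟩ := h'
  have hcross : p * q' - p' * q = 0 := by
    refine eq_zero_of_isBigO_pow (N := m + n + 1) ?_ ?_
    · refine Nat.lt_succ_of_le ((natDegree_sub_le _ _).trans (max_le ?_ ?_))
      · exact natDegree_mul_le.trans (by omega)
      · exact natDegree_mul_le.trans (by omega)
    · have h1 : (fun z => (R z - R' z) * (q.eval z * q'.eval z)) =O[𝓝 0]
          (fun z : ℂ => z ^ (m + n + 1) * 1) := by
        refine Asymptotics.IsBigO.mul ?_ ?_
        · have := hO.sub hO'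
          simpa using this
        · exact ((q.continuous.mul q'.continuous).tendsto 0).isBigO_one ℂ
      refine (h1.congr' ?_ (by simp))
      filter_upwards [q.continuous.continuousAt.eventually_ne hq0,
        q'.continuous.continuousAt.eventually_ne hq0'] with z hz hz'
      rw [hR, hR']
      simp only [eval_sub, eval_mul]
      field_simp
  have hcross' : p * q' = p' * q := sub_eq_zero.1 hcross
  have hqne : q ≠ 0 := by rintro rfl; simp at hq0
  have h1 : q ∣ q' := hpq.symm.dvd_of_dvd_mul_left (hcross' ▸ dvd_mul_left q p')
  have h2 : q' ∣ q := hpq'.symm.dvd_of_dvd_mul_left (hcross' ▸ dvd_mul_left q' p)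
  obtain ⟨u, hu⟩ := associated_of_dvd_dvd h1 h2
  obtain ⟨c, hc, hcu⟩ := Polynomial.isUnit_iff.1 u.isUnit
  have hc0 : c ≠ 0 := hc.ne_zero
  have hq'c : q' = q * C c := by rw [← hu, ← hcu]
  have hp'c : p' = p * C c := by
    refine mul_right_cancel₀ hqne ?_
    rw [← hcross', hq'c]; ring
  funext z
  rw [hR, hR', hq'c, hp'c, eval_mul, eval_mul, eval_C, mul_div_mul_right _ _ hc0]

/-- The numerator and denominator built from a quadrature. -/
noncomputable def padeDenom {n : ℕ} (x : Fin n → ℝ) (s : Finset (Fin n)) : ℂ[X] :=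
  ∏ i ∈ s, (1 - C (x i : ℂ) * X)

noncomputable def padeNum {n : ℕ} (k : ℕ) (t : ℕ → ℂ) (x w : Fin n → ℝ) : ℂ[X] :=
  (∑ j ∈ Finset.Icc 1 k, C (t j) * X ^ j) * padeDenom x Finset.univ
    + X ^ (k + 1) * ∑ i, C (w i : ℂ) * padeDenom x (Finset.univ.erase i)

lemma eval_padeDenom {n : ℕ} (x : Fin n → ℝ) (s : Finset (Fin n)) (z : ℂ) :
    (padeDenom x s).eval z = ∏ i ∈ s, (1 - z * x i) := by
  rw [padeDenom, eval_prod]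
  exact Finset.prod_congr rfl fun i _ => by
    simp only [eval_sub, eval_one, eval_mul, eval_C, eval_X]; ring

lemma natDegree_padeDenom_le {n : ℕ} (x : Fin n → ℝ) (s : Finset (Fin n)) :
    (padeDenom x s).natDegree ≤ s.card := by
  refine (natDegree_prod_le _ _).trans ?_
  rw [Finset.card_eq_sum_ones]
  refine Finset.sum_le_sum fun i _ => ?_
  refine (natDegree_sub_le _ _).trans (max_le (by simp) ?_)
  exact (natDegree_C_mul_le _ _).trans natDegree_X_le

lemma eval_padeNum {n : ℕ} (k : ℕ) (t : ℕ → ℂ) (x w : Fin n → ℝ) (z : ℂ) :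
    (padeNum k t x w).eval z = (∑ j ∈ Finset.Icc 1 k, t j * z ^ j) * ∏ i, (1 - z * x i)
      + z ^ (k + 1) * ∑ i, w i * ∏ j ∈ Finset.univ.erase i, (1 - z * x j) := by
  simp [padeNum, eval_padeDenom, eval_finsetSum]

lemma natDegree_padeNum_le {n : ℕ} (hn : 1 ≤ n) (k : ℕ) (t : ℕ → ℂ) (x w : Fin n → ℝ) :
    (padeNum k t x w).natDegree ≤ n + k := by
  refine (natDegree_add_le _ _).trans (max_le ?_ ?_)
  · refine natDegree_mul_le.trans ?_
    have h1 : (∑ j ∈ Finset.Icc 1 k, C (t j) * X ^ j).natDegree ≤ k :=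
      natDegree_sum_le_of_forall_le _ _ fun j hj =>
        (natDegree_C_mul_X_pow_le _ _).trans (Finset.mem_Icc.1 hj).2
    have h2 := natDegree_padeDenom_le x Finset.univ
    rw [Finset.card_fin] at h2
    omega
  · refine natDegree_mul_le.trans ?_
    rw [natDegree_X_pow]
    -- One factor is missing from each product, and this pays for the extra power in X ^ (k + 1).
    have h1 : (∑ i, C (w i : ℂ) * padeDenom x (Finset.univ.erase i)).natDegree ≤ n - 1 := by
      refine natDegree_sum_le_of_forall_le _ _ fun i _ => ?_
      refine (natDegree_C_mul_le _ _).trans ((natDegree_padeDenom_le _ _).trans ?_)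
      rw [Finset.card_erase_of_mem (Finset.mem_univ i), Finset.card_fin]
    omega

/-- At the pole 1/x_i only the i-th term of the numerator survives; it is nonzero because the weight
is positive and the nodes are distinct. -/
lemma isCoprime_padeNum {n : ℕ} {k : ℕ} {t : ℕ → ℂ} {x w : Fin n → ℝ}
    (hx : Function.Injective x) (hx0 : ∀ i, 0 < x i) (hw : ∀ i, 0 < w i) :
    IsCoprime (padeNum k t x w) (padeDenom x Finset.univ) := by
  refine IsCoprime.prod_right fun i _ => ?_
  have hxi : (x i : ℂ) ≠ 0 := by exact_mod_cast (hx0 i).ne'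
  have h1 : (1 - C (x i : ℂ) * X : ℂ[X]) = C (-(x i : ℂ)) * (X - C ((x i : ℂ)⁻¹)) := by
    rw [mul_sub, ← C_mul, neg_mul, mul_inv_cancel₀ hxi]
    simp only [map_neg, map_one]
    ring
  rw [h1]
  refine (isCoprime_mul_unit_left_right (isUnit_C.2 (neg_ne_zero.2 hxi).isUnit) _ _).2 ?_
  · rw [isCoprime_comm, (irreducible_X_sub_C _).coprime_iff_not_dvd, dvd_iff_isRoot, IsRoot,
      eval_padeNum]
    have hz : 1 - (x i : ℂ)⁻¹ * x i = 0 := by rw [inv_mul_cancel₀ hxi, sub_self]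
    rw [Finset.prod_eq_zero (Finset.mem_univ i) hz, mul_zero, zero_add, Finset.sum_eq_single i]
    · refine mul_ne_zero (pow_ne_zero _ (inv_ne_zero hxi)) (mul_ne_zero
        (by exact_mod_cast (hw i).ne') (Finset.prod_ne_zero_iff.2 fun j hj => ?_))
      intro h0
      have h2 : (x i : ℂ) = x j := by
        field_simp at h0
        linear_combination h0
      exact (Finset.mem_erase.1 hj).1 (hx (by exact_mod_cast h2.symm))
    · intro j _ hji
      rw [Finset.prod_eq_zero (Finset.mem_erase.2 ⟨hji.symm, Finset.mem_univ i⟩) hz, mul_zero]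
    · simp

/-- The Padé approximant given by a Gaussian quadrature. -/
theorem exists_isPadeApproximant {ν : Measure ℝ} {L : ℝ} {n : ℕ} {x w : Fin n → ℝ}
    (hν : IsMomentMeasure ν L) (hq : IsGaussianQuadrature ν (Icc 0 L) x w) (hn : 1 ≤ n)
    {f : ℂ → ℂ} {k : ℕ} {t : ℕ → ℂ}
    (hf : ∀ᶠ z in 𝓝 0, f z = ∑ j ∈ Finset.Icc 1 k, t j * z ^ j + z ^ (k + 1) * stieltjes ν z) :
    ∃ R : ℂ → ℂ, IsPadeApproximant f 0 (n + k) n R ∧ ∀ z : ℂ, (∀ i, 1 - z * x i ≠ 0) →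
      R z = ∑ j ∈ Finset.Icc 1 k, t j * z ^ j + z ^ (k + 1) * quadratureStieltjes x w z := by
  have hform : ∀ z : ℂ, (∀ i, 1 - z * x i ≠ 0) →
      (padeNum k t x w).eval z / (padeDenom x Finset.univ).eval z
        = ∑ j ∈ Finset.Icc 1 k, t j * z ^ j + z ^ (k + 1) * quadratureStieltjes x w z := by
    intro z hz
    have hprod : ∏ i, (1 - z * (x i : ℂ)) ≠ 0 := Finset.prod_ne_zero_iff.2 fun i _ => hz i
    rw [eval_padeNum, eval_padeDenom, div_eq_iff hprod, add_mul, mul_assoc (z ^ (k + 1))]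
    congr 2
    rw [quadratureStieltjes, Finset.sum_mul]
    refine Finset.sum_congr rfl fun i _ => ?_
    rw [← Finset.mul_prod_erase _ (fun i => 1 - z * (x i : ℂ)) (Finset.mem_univ i)]
    have := hz i
    field_simp
  refine ⟨fun z => (padeNum k t x w).eval z / (padeDenom x Finset.univ).eval z,
    ⟨padeNum k t x w, padeDenom x Finset.univ, natDegree_padeNum_le hn k t x w, ?_, ?_,
      isCoprime_padeNum hq.injective (hq.node_pos hν) hq.weight_pos, fun z => rfl, ?_⟩, hform⟩
  · simpa using natDegree_padeDenom_le x Finset.univ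
  · rw [eval_padeDenom]; simp
  -- The orders add up: (k + 1) + 2n = (n + k) + n + 1.
  · have h1 := (Asymptotics.isBigO_refl (fun z : ℂ => z ^ (k + 1)) (𝓝 0)).mul
      (quadratureStieltjes_sub_isBigO hν hq hn)
    have hne : ∀ᶠ z : ℂ in 𝓝 0, ∀ i, 1 - z * x i ≠ 0 := by
      refine eventually_all.2 fun i => ?_
      refine (by fun_prop : Continuous fun z : ℂ => 1 - z * x i).continuousAt.eventually_ne ?_
      simp
    refine h1.congr' ?_ (Eventually.of_forall fun z => ?_)
    · filter_upwards [hf, hne] with z hz hz'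
      rw [hform z hz', hz]
      ring
    · simp only [sub_zero]
      rw [← pow_add]
      congr 1
      omega

end Pade


/-! ### Lévy processes from characteristic functions of increments -/

section Increments

variable {Ω : Type*} [MeasurableSpace Ω] {P : Measure Ω}

/-- The characteristic function of `X` at `1`. -/
noncomputable def charVal (P : Measure Ω) (X : Ω → ℝ) : ℂ := ∫ ω, Complex.exp (X ω * Complex.I) ∂P

lemma charFun_map_eq_charVal {X : Ω → ℝ} (hX : AEMeasurable X P) (θ : ℝ) :
    charFun (P.map X) θ = charVal P (fun ω => θ * X ω) := by
  rw [charFun_apply_real, integral_map hX (by fun_prop), charVal]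
  simp only [Complex.ofReal_mul]

/-- The increments of `Y` over disjoint intervals are independent, and the increment over an
interval of length `t` has the characteristic function `exp (t η)`. -/
structure HasIncrementExponent (Y : ℝ≥0 → Ω → ℝ) (P : Measure Ω) (η : ℝ → ℂ) : Prop where
  measurable : ∀ t, Measurable (Y t)
  start_zero : ∀ᵐ ω ∂P, Y 0 ω = 0
  charVal_eq : ∀ (n : ℕ) (t : Fin (n + 1) → ℝ≥0), Monotone t → ∀ θ : Fin n → ℝ,
    charVal P (fun ω => ∑ j, θ j * (Y (t j.succ) ω - Y (t j.castSucc) ω))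
      = Complex.exp (∑ j, ((t j.succ : ℝ) - (t j.castSucc : ℝ) : ℝ) * η (θ j))

namespace HasIncrementExponent

variable {Y : ℝ≥0 → Ω → ℝ} {η : ℝ → ℂ}

lemma charVal_sub (h : HasIncrementExponent Y P η) {s t : ℝ≥0} (hst : s ≤ t) (θ : ℝ) :
    charVal P (fun ω => θ * (Y t ω - Y s ω)) = Complex.exp (((t : ℝ) - s : ℝ) * η θ) := by
  have hm : Monotone ![s, t] := by
    intro i j hij
    fin_cases i <;> fin_cases j <;> simp_all
  simpa using h.charVal_eq 1 ![s, t] hm (fun _ => θ)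

lemma charVal_eval (h : HasIncrementExponent Y P η) (t : ℝ≥0) (θ : ℝ) :
    charVal P (fun ω => θ * Y t ω) = Complex.exp ((t : ℝ) * η θ) := by
  have h1 := h.charVal_sub (s := 0) (t := t) (zero_le) θ
  rw [NNReal.coe_zero, sub_zero] at h1
  rw [← h1, charVal, charVal]
  refine integral_congr_ae ?_
  filter_upwards [h.start_zero] with ω hω
  rw [hω, sub_zero]

/-- Independence amounts to factorization of the joint characteristic function, and the exponential
of a sum factorizes. -/
lemma hasIndepIncrements [IsProbabilityMeasure P] (h : HasIncrementExponent Y P η) :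
    HasIndepIncrements Y P := by
  intro n t ht
  have hmeas : ∀ i : Fin n, Measurable fun ω => Y (t i.succ) ω - Y (t i.castSucc) ω :=
    fun i => (h.measurable _).sub (h.measurable _)
  rw [iIndepFun_iff_charFun_pi fun i => (hmeas i).aemeasurable]
  intro θ
  have hmeas' : Measurable fun ω => WithLp.toLp 2 fun i : Fin n =>
      Y (t i.succ) ω - Y (t i.castSucc) ω := by
    refine (WithLp.measurable_toLp 2 _).comp ?_
    exact measurable_pi_lambda _ hmeas
  rw [charFun_apply, integral_map hmeas'.aemeasurable (by fun_prop)]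
  have h1 : ∀ i : Fin n, charFun (P.map fun ω => Y (t i.succ) ω - Y (t i.castSucc) ω) (θ.ofLp i)
      = Complex.exp (((t i.succ : ℝ) - (t i.castSucc : ℝ) : ℝ) * η (θ.ofLp i)) := by
    intro i
    rw [charFun_map_eq_charVal (hmeas i).aemeasurable]
    exact h.charVal_sub (ht (Fin.castSucc_lt_succ.le)) _
  simp only [h1]
  rw [← Complex.exp_sum, ← h.charVal_eq n t ht θ.ofLp, charVal]
  refine integral_congr_ae (ae_of_all _ fun ω => ?_)
  simp only [PiLp.inner_apply, Real.inner_apply]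
  congr 3
  exact Finset.sum_congr rfl fun i _ => mul_comm _ _

lemma measureReal_le [IsProbabilityMeasure P] (h : HasIncrementExponent Y P η) {ε : ℝ} (hε : 0 < ε)
    {s t : ℝ≥0} (hst : s ≤ t) :
    P.real {ω | ε ≤ |Y t ω - Y s ω|} ≤ 2⁻¹ * (ε / 2) *
      ‖∫ θ in (-2 * (ε / 2)⁻¹)..(2 * (ε / 2)⁻¹), (1 - Complex.exp (((t : ℝ) - s : ℝ) * η θ))‖ := by
  have hmeas : Measurable fun ω => Y t ω - Y s ω := (h.measurable _).sub (h.measurable _)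
  have := Measure.isProbabilityMeasure_map (μ := P) hmeas.aemeasurable
  -- The tail estimate is for a strict inequality, so it is used at ε / 2.
  have h1 := measureReal_abs_gt_le_integral_charFun (μ := P.map fun ω => Y t ω - Y s ω)
    (half_pos hε)
  have h2 : ∀ θ : ℝ, charFun (P.map fun ω => Y t ω - Y s ω) θ
      = Complex.exp (((t : ℝ) - s : ℝ) * η θ) := fun θ => by
    rw [charFun_map_eq_charVal hmeas.aemeasurable]
    exact h.charVal_sub hst θ
  simp only [h2] at h1
  refine le_trans ?_ h1
  rw [map_measureReal_apply hmeas (measurableSet_lt measurable_const (by fun_prop))]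
  refine measureReal_mono fun ω hω => ?_
  have : ε ≤ |Y t ω - Y s ω| := hω
  simp only [mem_preimage, mem_ofPred_eq]
  linarith

/-- Dominated convergence: Re η ≤ 0 keeps the exponentials in the unit disc. The absolute value
covers times on both sides of s. -/
lemma tendsto_bound (η : ℝ → ℂ) (hη : Continuous η) (hre : ∀ θ, (η θ).re ≤ 0) (c d : ℝ)
    (s : ℝ≥0) :
    Tendsto (fun t : ℝ≥0 => c * ‖∫ θ in (-d)..d, (1 - Complex.exp ((|(t : ℝ) - s| : ℝ) * η θ))‖)
      (𝓝 s) (𝓝 0) := by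
  have h1 : Tendsto (fun t : ℝ≥0 => ∫ θ in (-d)..d,
      (1 - Complex.exp ((|(t : ℝ) - s| : ℝ) * η θ))) (𝓝 s) (𝓝 (∫ θ in (-d)..d, (0 : ℂ))) := by
    refine intervalIntegral.tendsto_integral_filter_of_dominated_convergence (fun _ => 2)
      (Eventually.of_forall fun t => ?_) (Eventually.of_forall fun t => ae_of_all _ fun θ _ => ?_)
      (by simp) (ae_of_all _ fun θ _ => ?_)
    · exact (by fun_prop : Continuous fun θ =>
        1 - Complex.exp ((|(t : ℝ) - s| : ℝ) * η θ)).aestronglyMeasurable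
    · refine (norm_sub_le _ _).trans ?_
      have : ‖Complex.exp ((|(t : ℝ) - s| : ℝ) * η θ)‖ ≤ 1 := by
        rw [Complex.norm_exp, Real.exp_le_one_iff]
        simp only [Complex.mul_re, Complex.ofReal_re, Complex.ofReal_im, zero_mul, sub_zero]
        exact mul_nonpos_of_nonneg_of_nonpos (abs_nonneg _) (hre θ)
      rw [norm_one]
      linarith
    · have h2 : Tendsto (fun t : ℝ≥0 => 1 - Complex.exp ((|(t : ℝ) - s| : ℝ) * η θ)) (𝓝 s)
          (𝓝 (1 - Complex.exp ((|(s : ℝ) - s| : ℝ) * η θ))) := by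
        refine Continuous.tendsto ?_ _
        fun_prop
      simpa using h2
  have h3 := h1.norm.const_mul c
  simpa using h3

lemma re_nonpos [IsProbabilityMeasure P] (h : HasIncrementExponent Y P η) (θ : ℝ) :
    (η θ).re ≤ 0 := by
  have h1 := h.charVal_eval 1 θ
  have h2 : ‖charVal P (fun ω => θ * Y 1 ω)‖ ≤ 1 := by
    rw [← charFun_map_eq_charVal (h.measurable 1).aemeasurable]
    have := Measure.isProbabilityMeasure_map (μ := P) (h.measurable 1).aemeasurable
    exact norm_charFun_le_one θ
  rw [h1, Complex.norm_exp, Real.exp_le_one_iff] at h2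
  simpa using h2

/-- A process with such increments is a Lévy process. -/
theorem isLevyProcess [IsProbabilityMeasure P] (h : HasIncrementExponent Y P η)
    (hη : Continuous η) : IsLevyProcess Y P where
  measurable := h.measurable
  start_zero := h.start_zero
  indep_increments := h.hasIndepIncrements
  stationary_increments s t := by
    have hmeas : Measurable fun ω => Y (s + t) ω - Y s ω := (h.measurable _).sub (h.measurable _)
    refine ⟨hmeas.aemeasurable, (h.measurable t).aemeasurable, ?_⟩
    have := Measure.isProbabilityMeasure_map (μ := P) hmeas.aemeasurable
    have := Measure.isProbabilityMeasure_map (μ := P) (h.measurable t).aemeasurable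
    refine Measure.ext_of_charFun ?_
    funext θ
    rw [charFun_map_eq_charVal hmeas.aemeasurable,
      charFun_map_eq_charVal (h.measurable t).aemeasurable, h.charVal_eval,
      h.charVal_sub (s := s) (t := s + t) (by simp)]
    simp
  stochastically_continuous s := by
    rw [tendstoInMeasure_iff_measureReal_norm]
    intro ε hε
    refine squeeze_zero (fun _ => measureReal_nonneg) (fun t => ?_)
      (tendsto_bound η hη h.re_nonpos (2⁻¹ * (ε / 2)) (2 * (ε / 2)⁻¹) s)
    rcases le_total s t with hst | hst
    · have := h.measureReal_le hε hst
      have h2 : (s : ℝ) ≤ t := by exact_mod_cast hst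
      rw [abs_of_nonneg (sub_nonneg.2 h2)]
      simpa [neg_mul] using this
    · have := h.measureReal_le hε hst
      have h2 : (t : ℝ) ≤ s := by exact_mod_cast hst
      rw [abs_of_nonpos (sub_nonpos.2 h2), neg_sub]
      have h3 : {ω | ε ≤ ‖Y t ω - Y s ω‖} = {ω | ε ≤ |Y s ω - Y t ω|} := by
        ext ω
        simp only [mem_ofPred_eq, Real.norm_eq_abs, abs_sub_comm]
      rw [h3]
      simpa [neg_mul] using this

theorem hasLaplaceExponent (h : HasIncrementExponent Y P η) {ψ : ℂ → ℂ}
    (hψ : ∀ θ : ℝ, ψ (Complex.I * θ) = η θ) : HasLaplaceExponent Y P ψ := by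
  intro t θ
  rw [hψ, ← h.charVal_eval t θ, charVal]
  refine integral_congr_ae (ae_of_all _ fun ω => ?_)
  simp only
  congr 1
  push_cast
  ring

/-- Adding a drift. -/
lemma add_drift (h : HasIncrementExponent Y P η) (b : ℝ) :
    HasIncrementExponent (fun t ω => Y t ω + b * t) P (fun θ => η θ + b * θ * Complex.I) where
  measurable t := (h.measurable t).add_const _
  start_zero := by
    filter_upwards [h.start_zero] with ω hω
    simp [hω]
  charVal_eq n t ht θ := by
    have h1 : ∀ ω, ∑ j, θ j * (Y (t j.succ) ω + b * t j.succ - (Y (t j.castSucc) ω + b * t j.castSucc))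
        = ∑ j, θ j * (Y (t j.succ) ω - Y (t j.castSucc) ω)
          + ∑ j, b * θ j * ((t j.succ : ℝ) - t j.castSucc) := by
      intro ω
      rw [← Finset.sum_add_distrib]
      exact Finset.sum_congr rfl fun j _ => by ring
    simp only [charVal, h1, Complex.ofReal_add, add_mul, Complex.exp_add]
    rw [integral_mul_const]
    have h2 := h.charVal_eq n t ht θ
    rw [charVal] at h2
    rw [h2, ← Complex.exp_add]
    congr 1
    simp only [mul_add, Finset.sum_add_distrib]
    congr 1
    push_cast
    rw [Finset.sum_mul]
    exact Finset.sum_congr rfl fun j _ => by ring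

lemma const_mul (h : HasIncrementExponent Y P η) (c : ℝ) :
    HasIncrementExponent (fun t ω => c * Y t ω) P (fun θ => η (c * θ)) where
  measurable t := (h.measurable t).const_mul _
  start_zero := by
    filter_upwards [h.start_zero] with ω hω
    simp [hω]
  charVal_eq n t ht θ := by
    rw [← h.charVal_eq n t ht fun j => c * θ j]
    congr 1
    funext ω
    exact Finset.sum_congr rfl fun j _ => by ring

/-- The sum of two independent processes. -/
lemma add_prod {Ω' : Type*} [MeasurableSpace Ω'] {P' : Measure Ω'} [IsProbabilityMeasure P]
    [IsProbabilityMeasure P'] {Z : ℝ≥0 → Ω' → ℝ} {ζ : ℝ → ℂ}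
    (h : HasIncrementExponent Y P η) (h' : HasIncrementExponent Z P' ζ) :
    HasIncrementExponent (fun t ω => Y t ω.1 + Z t ω.2) (P.prod P') (fun θ => η θ + ζ θ) where
  measurable t := ((h.measurable t).comp measurable_fst).add ((h'.measurable t).comp measurable_snd)
  start_zero := by
    have h1 : ∀ᵐ ω ∂(P.prod P'), Y 0 ω.1 = 0 := Measure.quasiMeasurePreserving_fst.ae h.start_zero
    have h2 : ∀ᵐ ω ∂(P.prod P'), Z 0 ω.2 = 0 := Measure.quasiMeasurePreserving_snd.ae h'.start_zero
    filter_upwards [h1, h2] with ω hω hω'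
    simp [hω, hω']
  charVal_eq n t ht θ := by
    have h1 : ∀ ω : Ω × Ω', ∑ j, θ j * (Y (t j.succ) ω.1 + Z (t j.succ) ω.2
        - (Y (t j.castSucc) ω.1 + Z (t j.castSucc) ω.2))
        = ∑ j, θ j * (Y (t j.succ) ω.1 - Y (t j.castSucc) ω.1)
          + ∑ j, θ j * (Z (t j.succ) ω.2 - Z (t j.castSucc) ω.2) := by
      intro ω
      rw [← Finset.sum_add_distrib]
      exact Finset.sum_congr rfl fun j _ => by ring
    simp only [charVal, h1, Complex.ofReal_add, add_mul, Complex.exp_add]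
    rw [integral_prod_mul (fun ω : Ω => Complex.exp
      ((∑ j, θ j * (Y (t j.succ) ω - Y (t j.castSucc) ω) : ℝ) * Complex.I))
      (fun ω : Ω' => Complex.exp
      ((∑ j, θ j * (Z (t j.succ) ω - Z (t j.castSucc) ω) : ℝ) * Complex.I))]
    have h2 := h.charVal_eq n t ht θ
    have h3 := h'.charVal_eq n t ht θ
    rw [charVal] at h2 h3
    rw [h2, h3, ← Complex.exp_add]
    simp only [mul_add, Finset.sum_add_distrib]

end HasIncrementExponent

end Increments


/-! ### Existence of Brownian motion -/

section Brownian

lemma charVal_infinitePi_sum {ι : Type*} {E : ι → Type*} [∀ i, MeasurableSpace (E i)]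
    (μ : ∀ i, Measure (E i)) [∀ i, IsProbabilityMeasure (μ i)] (s : Finset ι) (f : ∀ i, E i → ℝ)
    (hf : ∀ i, Measurable (f i)) :
    charVal (Measure.infinitePi μ) (fun ω => ∑ i ∈ s, f i (ω i)) = ∏ i ∈ s, charVal (μ i) (f i) := by
  have hm : ∀ i, Measurable fun ω : ∀ i, E i => f i (ω i) :=
    fun i => (hf i).comp (measurable_pi_apply i)
  have h1 := ((iIndepFun_infinitePi (P := μ) (X := f) hf).restrict s).charFun_map_fun_finsetSum_eq_prod
    (s := s) (fun i _ => (hm i).aemeasurable)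
  have h2 := congrFun h1 1
  rw [charFun_map_eq_charVal (Finset.measurable_sum s fun i _ => hm i).aemeasurable] at h2
  simp only [one_mul] at h2
  rw [h2, Finset.prod_apply]
  refine Finset.prod_congr rfl fun i _ => ?_
  rw [charFun_map_eq_charVal (hm i).aemeasurable]
  simp only [one_mul, charVal]
  rw [← Measure.infinitePi_map_eval μ i,
    integral_map (measurable_pi_apply i).aemeasurable (by have := hf i; fun_prop)]

/-- From |e^{ix} - e^{iy}| ≤ |x - y| and L¹ ≤ L² on a probability space. It makes characteristic
functions continuous on L², so that Gaussian identities pass to limits. -/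
lemma norm_charVal_sub_le {Ω : Type*} [MeasurableSpace Ω] {P : Measure Ω} [IsProbabilityMeasure P]
    (f g : Lp ℝ 2 P) : ‖charVal P f - charVal P g‖ ≤ ‖f - g‖ := by
  have hi : ∀ f : Lp ℝ 2 P, Integrable (fun ω => Complex.exp (f ω * Complex.I)) P := fun f => by
    refine Integrable.of_bound (C := 1) ?_ (ae_of_all _ fun ω => ?_)
    · have := Lp.aestronglyMeasurable f
      exact (Complex.continuous_exp.comp
        (Complex.continuous_ofReal.mul continuous_const)).comp_aestronglyMeasurable this
    · rw [Complex.norm_exp_ofReal_mul_I]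
  rw [charVal, charVal, ← integral_sub (hi f) (hi g)]
  have h1 : ∀ x y : ℝ, ‖Complex.exp (x * Complex.I) - Complex.exp (y * Complex.I)‖ ≤ ‖x - y‖ := by
    intro x y
    have : Complex.exp (x * Complex.I) - Complex.exp (y * Complex.I)
        = Complex.exp (y * Complex.I) * (Complex.exp (Complex.I * (x - y : ℝ)) - 1) := by
      rw [mul_sub, ← Complex.exp_add, mul_one]
      congr 2
      push_cast
      ring
    rw [this, norm_mul, Complex.norm_exp_ofReal_mul_I, one_mul]
    exact Real.norm_exp_I_mul_ofReal_sub_one_le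
  have hfg : MemLp (f - g : Lp ℝ 2 P) 1 P := (Lp.memLp (f - g)).mono_exponent (by norm_num)
  calc _ ≤ ∫ ω, ‖(f - g : Lp ℝ 2 P) ω‖ ∂P := by
        refine norm_integral_le_of_norm_le (hfg.integrable le_rfl).norm ?_
        filter_upwards [Lp.coeFn_sub f g] with ω hω
        rw [hω, Pi.sub_apply]
        exact h1 _ _
    _ = (eLpNorm (f - g : Lp ℝ 2 P) 1 P).toReal := by
        rw [eLpNorm_one_eq_lintegral_enorm, integral_norm_eq_lintegral_enorm (Lp.aestronglyMeasurable _)]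
    _ ≤ ‖f - g‖ := by
        rw [Lp.norm_def]
        refine ENNReal.toReal_mono (Lp.eLpNorm_ne_top _) ?_
        exact eLpNorm_le_eLpNorm_of_exponent_le (by norm_num) (Lp.aestronglyMeasurable _)

lemma charVal_congr {Ω : Type*} [MeasurableSpace Ω] {P : Measure Ω} {f g : Ω → ℝ} (h : f =ᵐ[P] g) :
    charVal P f = charVal P g :=
  integral_congr_ae (by filter_upwards [h] with ω hω; rw [hω])

lemma charVal_gaussianReal (c : ℝ) :
    charVal (gaussianReal 0 1) (fun x => c * x) = Complex.exp (-(c ^ 2 : ℝ) / 2) := by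
  have h := charFun_gaussianReal (μ := 0) (v := 1) c
  have h2 := charFun_map_eq_charVal (P := gaussianReal 0 1) aemeasurable_id c
  rw [Measure.map_id] at h2
  rw [show (fun x : ℝ => c * x) = fun x => c * id x from rfl, ← h2, h]
  congr 1
  push_cast
  ring

/-- A Hilbert space is isometric to a space of centered Gaussian random variables. -/
lemma exists_isonormal (H : Type) [NormedAddCommGroup H] [InnerProductSpace ℝ H] [CompleteSpace H] :
    ∃ (Ω : Type) (_ : MeasurableSpace Ω) (P : Measure Ω) (_ : IsProbabilityMeasure P)
      (W : H →ₗᵢ[ℝ] Lp ℝ 2 P), ∀ f, charVal P (W f) = Complex.exp (-(‖f‖ ^ 2 : ℝ) / 2) := by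
  obtain ⟨w, b, -⟩ := exists_hilbertBasis ℝ H
  let P : Measure (w → ℝ) := Measure.infinitePi fun _ => gaussianReal 0 1
  have hmp : ∀ i : w, MeasurePreserving (fun ω : w → ℝ => ω i) P (gaussianReal 0 1) :=
    fun i => ⟨measurable_pi_apply i, Measure.infinitePi_map_eval _ i⟩
  have hL : ∀ i : w, MemLp (fun ω : w → ℝ => ω i) 2 P := fun i =>
    (memLp_id_gaussianReal 2).comp_measurePreserving (hmp i)
  let ξ : w → Lp ℝ 2 P := fun i => (hL i).toLp
  have hξ : ∀ i, ξ i =ᵐ[P] fun ω => ω i := fun i => (hL i).coeFn_toLp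
  have hind : iIndepFun (fun (i : w) (ω : w → ℝ) => ω i) P :=
    iIndepFun_infinitePi (X := fun _ x => x) fun _ => measurable_id
  classical
  have horth : Orthonormal ℝ ξ := by
    rw [orthonormal_iff_ite]
    intro i j
    have h1 : inner ℝ (ξ i) (ξ j) = ∫ ω : w → ℝ, ω i * ω j ∂P := by
      rw [L2.inner_def]
      refine integral_congr_ae ?_
      filter_upwards [hξ i, hξ j] with ω h1 h2
      rw [h1, h2, Real.inner_apply]
    rw [h1]
    split_ifs with hij
    · subst hij
      have h2 : ∫ ω : w → ℝ, ω i * ω i ∂P = ∫ x, x * x ∂(gaussianReal 0 1) := by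
        rw [← (hmp i).map_eq, integral_map (hmp i).measurable.aemeasurable (by fun_prop)]
      have h3 := variance_fun_id_gaussianReal (μ := 0) (v := 1)
      rw [variance_eq_integral (by fun_prop), integral_id_gaussianReal] at h3
      rw [h2]
      simpa [sq] using h3
    · have h2 := (hind.indepFun hij).integral_mul_eq_mul_integral (hL i).1 (hL j).1
      have h3 : ∫ ω : w → ℝ, ω i ∂P = 0 := by
        rw [← integral_id_gaussianReal (μ := 0) (v := 1), ← (hmp i).map_eq,
          integral_map (hmp i).measurable.aemeasurable (by fun_prop)]
      simp only [Pi.mul_apply] at h2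
      exact h2.trans (by rw [h3, zero_mul])
  -- W sends a Hilbert basis to the independent standard Gaussian coordinates.
  let W : H →ₗᵢ[ℝ] Lp ℝ 2 P :=
    horth.orthogonalFamily.linearIsometry.comp b.repr.toLinearIsometry
  have hWb : ∀ i, W (b i) = ξ i := by
    intro i
    change horth.orthogonalFamily.linearIsometry (b.repr (b i)) = ξ i
    rw [HilbertBasis.repr_self, OrthogonalFamily.linearIsometry_apply_single]
    simp
  refine ⟨w → ℝ, inferInstance, P, inferInstance, W, ?_⟩
  have hcont : Continuous fun f : Lp ℝ 2 P => charVal P f := by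
    refine LipschitzWith.continuous (K := 1) (LipschitzWith.of_dist_le_mul fun f g => ?_)
    rw [dist_eq_norm, dist_eq_norm, NNReal.coe_one, one_mul]
    exact norm_charVal_sub_le f g
  have hdense : Dense (Submodule.span ℝ (range b) : Set H) := by
    exact Submodule.dense_iff_topologicalClosure_eq_top.2 b.dense_span
  have hclosed : IsClosed {f : H | charVal P (W f) = Complex.exp (-(‖f‖ ^ 2 : ℝ) / 2)} :=
    isClosed_eq (hcont.comp W.continuous) (by fun_prop)
  -- Both sides are continuous in f, so the identity need only be checked for finite combinations of
  -- basis vectors.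
  intro f
  refine hdense.induction (P := fun f => charVal P (W f) = Complex.exp (-(‖f‖ ^ 2 : ℝ) / 2)) ?_ hclosed f
  intro g hg
  obtain ⟨c, rfl⟩ := (Finsupp.mem_span_range_iff_exists_finsupp).1 hg
  have h1 : W (c.sum fun i a => a • b i) =ᵐ[P] fun ω => ∑ i ∈ c.support, c i * ω i := by
    have h2 : W (c.sum fun i a => a • b i) = ∑ i ∈ c.support, c i • ξ i := by
      rw [Finsupp.sum, map_sum]
      simp only [map_smul, hWb]
    rw [h2]
    have h3 := Lp.coeFn_finsetSum (p := 2) (μ := P) c.support fun i => c i • ξ i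
    have h4 : ∀ᵐ ω ∂P, ∀ i ∈ c.support, (c i • ξ i : Lp ℝ 2 P) ω = c i * ω i := by
      rw [Filter.eventually_all_finset]
      intro i _
      filter_upwards [Lp.coeFn_smul (c i) (ξ i), hξ i] with ω h5 h6
      rw [h5, Pi.smul_apply, h6, smul_eq_mul]
    filter_upwards [h3, h4] with ω h5 h6
    rw [h5, Finset.sum_apply]
    exact Finset.sum_congr rfl h6
  rw [charVal_congr h1]
  have h2 := charVal_infinitePi_sum (fun _ : w => gaussianReal 0 1) c.support (fun i x => c i * x)
    (fun i => by fun_prop)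
  rw [h2]
  simp only [charVal_gaussianReal]
  rw [← Complex.exp_sum, Finsupp.sum, ← real_inner_self_eq_norm_sq,
    b.orthonormal.inner_sum]
  congr 1
  simp only [conj_trivial]
  push_cast
  rw [← Finset.sum_div, Finset.sum_neg_distrib]
  congr 2
  exact Finset.sum_congr rfl fun i _ => by ring

/-- Brownian motion exists. -/
theorem exists_brownian : ∃ (Ω : Type) (_ : MeasurableSpace Ω) (P : Measure Ω)
    (_ : IsProbabilityMeasure P) (B : ℝ≥0 → Ω → ℝ),
    HasIncrementExponent B P fun θ => -(θ ^ 2 : ℝ) / 2 := by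
  obtain ⟨Ω, mΩ, P, hP, W, hW⟩ := exists_isonormal (Lp ℝ 2 (volume : Measure ℝ))
  -- B_t is the Gaussian variable attached to the indicator of (0, t]; increments over disjoint
  -- intervals correspond to orthogonal vectors, and the squared norms are the lengths.
  let e : ℝ≥0 → ℝ≥0 → Lp ℝ 2 (volume : Measure ℝ) := fun s t =>
    indicatorConstLp 2 (measurableSet_Ioc (a := (s : ℝ)) (b := t)) (by simp) 1
  have hinner : ∀ s t s' t', inner ℝ (e s t) (e s' t')
      = volume.real (Ioc (s : ℝ) t ∩ Ioc (s' : ℝ) t') := fun s t s' t' =>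
    L2.real_inner_indicatorConstLp_one_indicatorConstLp_one measurableSet_Ioc measurableSet_Ioc
      (by simp) (by simp)
  have hadd : ∀ s t, s ≤ t → e 0 t - e 0 s = e s t := by
    intro s t hst
    have h1 : (s : ℝ) ≤ t := by exact_mod_cast hst
    have h2 : Disjoint (Ioc ((0 : ℝ≥0) : ℝ) s) (Ioc (s : ℝ) t) :=
      Set.Ioc_disjoint_Ioc_of_le le_rfl
    have h3 : Ioc ((0 : ℝ≥0) : ℝ) t = Ioc ((0 : ℝ≥0) : ℝ) s ∪ Ioc (s : ℝ) t :=
      (Ioc_union_Ioc_eq_Ioc (by simp) h1).symm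
    rw [sub_eq_iff_eq_add']
    simp only [e, h3]
    exact indicatorConstLp_disjoint_union _ _ _ _ h2 _
  refine ⟨Ω, mΩ, P, hP, fun t => W (e 0 t), fun t => (Lp.stronglyMeasurable _).measurable, ?_, ?_⟩
  · have h1 : e 0 0 = 0 := by
      rw [← norm_eq_zero, ← sq_eq_zero_iff, ← real_inner_self_eq_norm_sq, hinner]
      simp
    simp only [h1, map_zero]
    exact Lp.coeFn_zero _ _ _
  · intro n t ht θ
    have h1 : (fun ω => ∑ j, θ j * (W (e 0 (t j.succ)) ω - W (e 0 (t j.castSucc)) ω))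
        =ᵐ[P] W (∑ j, θ j • e (t j.castSucc) (t j.succ)) := by
      rw [map_sum]
      have h2 : ∀ᵐ ω ∂P, ∀ j : Fin n, W (θ j • e (t j.castSucc) (t j.succ)) ω
          = θ j * (W (e 0 (t j.succ)) ω - W (e 0 (t j.castSucc)) ω) := by
        rw [ae_all_iff]
        intro j
        rw [← hadd _ _ (ht (Fin.castSucc_lt_succ (i := j)).le), map_smul, map_sub]
        filter_upwards [Lp.coeFn_smul (θ j) (W (e 0 (t j.succ)) - W (e 0 (t j.castSucc))),
          Lp.coeFn_sub (W (e 0 (t j.succ))) (W (e 0 (t j.castSucc)))] with ω h3 h4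
        rw [h3, Pi.smul_apply, h4, Pi.sub_apply, smul_eq_mul]
      filter_upwards [h2, Lp.coeFn_finsetSum (p := 2) (μ := P) Finset.univ
        fun j => W (θ j • e (t j.castSucc) (t j.succ))] with ω h3 h4
      rw [h4, Finset.sum_apply]
      exact (Finset.sum_congr rfl fun j _ => h3 j).symm
    have hdiag : ∀ j i : Fin n, inner ℝ (e (t j.castSucc) (t j.succ)) (e (t i.castSucc) (t i.succ))
        = if j = i then ((t j.succ : ℝ) - t j.castSucc) else 0 := by
      have hdisj : ∀ j i : Fin n, j < i →
          Disjoint (Ioc (t j.castSucc : ℝ) (t j.succ)) (Ioc (t i.castSucc : ℝ) (t i.succ)) := by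
        intro j i hji
        refine Set.Ioc_disjoint_Ioc_of_le ?_
        exact_mod_cast ht (Fin.succ_le_castSucc_iff.2 hji)
      intro j i
      rw [hinner]
      split_ifs with hij
      · subst hij
        rw [inter_self, Real.volume_real_Ioc_of_le]
        exact_mod_cast ht (Fin.castSucc_lt_succ (i := j)).le
      · rcases lt_or_gt_of_ne hij with h | h
        · rw [(hdisj j i h).inter_eq, measureReal_empty]
        · rw [(hdisj i j h).symm.inter_eq, measureReal_empty]
    rw [charVal_congr h1, hW, ← real_inner_self_eq_norm_sq]
    congr 1
    simp only [sum_inner, inner_sum, real_inner_smul_left, real_inner_smul_right, hdiag, mul_ite,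
      mul_zero, Finset.sum_ite_eq', Finset.mem_univ, if_true]
    push_cast
    rw [← Finset.sum_neg_distrib, Finset.sum_div]
    exact Finset.sum_congr rfl fun i _ => by ring

end Brownian


/-! ### Existence of compound Poisson processes -/

section CompoundPoisson

lemma integrable_cexp_mul_I {Ω : Type*} [MeasurableSpace Ω] {P : Measure Ω} [IsFiniteMeasure P]
    {X : Ω → ℝ} (hX : AEMeasurable X P) :
    Integrable (fun ω => Complex.exp (X ω * Complex.I)) P := by
  refine Integrable.of_bound (C := 1) ?_ (ae_of_all _ fun ω => ?_)
  · exact (Complex.continuous_exp.comp (Complex.continuous_ofReal.mul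
      continuous_const)).comp_aestronglyMeasurable hX.aestronglyMeasurable
  · rw [Complex.norm_exp_ofReal_mul_I]

/-- A Poisson number of independent marks. -/
noncomputable def poissonMarks {E : Type*} [MeasurableSpace E] (r : ℝ≥0) (q : Measure E)
    [IsProbabilityMeasure q] : Measure (ℕ × (ℕ → E)) :=
  (poissonMeasure r).prod (Measure.infinitePi fun _ => q)

instance {E : Type*} [MeasurableSpace E] (r : ℝ≥0) (q : Measure E) [IsProbabilityMeasure q] :
    IsProbabilityMeasure (poissonMarks r q) := by
  unfold poissonMarks
  infer_instance

lemma measurable_sum_marks {E : Type*} [MeasurableSpace E] {g : E → ℝ} (hg : Measurable g) :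
    Measurable fun ω : ℕ × (ℕ → E) => ∑ i ∈ Finset.range ω.1, g (ω.2 i) := by
  refine measurable_from_prod_countable_right fun n => ?_
  exact Finset.measurable_sum (Finset.range n) fun i _ => hg.comp (measurable_pi_apply i)

/-- Given n marks, independence yields the n-th power of the characteristic function of one mark;
summing over the Poisson law gives an exponential series. -/
lemma charVal_poissonMarks {E : Type*} [MeasurableSpace E] (r : ℝ≥0) (q : Measure E)
    [IsProbabilityMeasure q] {g : E → ℝ} (hg : Measurable g) :
    charVal (poissonMarks r q) (fun ω => ∑ i ∈ Finset.range ω.1, g (ω.2 i))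
      = Complex.exp (r * (charVal q g - 1)) := by
  have h1 : ∀ n : ℕ, charVal (Measure.infinitePi fun _ : ℕ => q)
      (fun ω => ∑ i ∈ Finset.range n, g (ω i)) = charVal q g ^ n := fun n => by
    rw [charVal_infinitePi_sum _ _ (fun _ => g) (fun _ => hg), Finset.prod_const, Finset.card_range]
  have h2 := integrable_cexp_mul_I (P := poissonMarks r q) (measurable_sum_marks hg).aemeasurable
  rw [charVal, poissonMarks, integral_prod _ h2]
  simp only [charVal] at h1
  simp only [h1]
  change ∫ n, charVal q g ^ n ∂(poissonMeasure r) = _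
  rw [integral_poissonMeasure]
  have h3 : ∀ n : ℕ, (Real.exp (-r) * r ^ n / n.factorial : ℝ) • charVal q g ^ n
      = Complex.exp (-r) * ((r * charVal q g) ^ n / n.factorial) := fun n => by
    rw [Complex.real_smul, mul_pow]
    push_cast
    ring
  simp only [h3]
  rw [tsum_mul_left, mul_sub, mul_one, sub_eq_add_neg, add_comm, Complex.exp_add]
  congr 1
  rw [Complex.exp_eq_exp_ℂ, NormedSpace.exp_eq_tsum_div]

/-- Each summand is the length of (0, s] ∩ (k, k + 1]. -/
lemma sum_clamp (s : ℝ) (hs : 0 ≤ s) (K : ℕ) :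
    ∑ k ∈ Finset.range K, min 1 (max 0 (s - k)) = min (K : ℝ) s := by
  induction K with
  | zero => simp [hs]
  | succ K ih =>
    rw [Finset.sum_range_succ, ih]
    push_cast
    rcases le_total s K with h | h
    · rw [min_eq_right h, max_eq_left (by linarith), min_eq_right zero_le_one, min_eq_right
        (by linarith), add_zero]
    · rw [min_eq_left h, max_eq_right (by linarith)]
      rcases le_total s (K + 1) with h' | h'
      · rw [min_eq_right h', min_eq_right (by linarith)]
        ring
      · rw [min_eq_left h', min_eq_left (by linarith)]

/-- The contribution at time `t` of a jump of size `p.2` at time `k + p.1`, where `p.1` is taken in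
`(0, 1]`. -/
noncomputable def jumpAt (t : ℝ≥0) (k : ℕ) (p : ℝ × ℝ) : ℝ :=
  if 0 < p.1 ∧ k + p.1 ≤ t then p.2 else 0

lemma measurable_jumpAt (t : ℝ≥0) (k : ℕ) : Measurable (jumpAt t k) := by
  refine Measurable.ite ?_ measurable_snd measurable_const
  exact (measurableSet_lt measurable_const measurable_fst).inter
    (measurableSet_le (measurable_fst.const_add (k : ℝ)) measurable_const)

/-- The process that jumps at the times `k + p.1` by `p.2`. -/
noncomputable def jumpProcess (t : ℝ≥0) (ω : ℕ → ℕ × (ℕ → ℝ × ℝ)) : ℝ :=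
  ∑ k ∈ Finset.range ⌈t⌉₊, ∑ i ∈ Finset.range (ω k).1, jumpAt t k ((ω k).2 i)

/-- Jumps attached to k occur strictly after time k, so enlarging the range adds nothing. This lets
several times share one range of summation. -/
lemma jumpProcess_eq {t : ℝ≥0} {K : ℕ} (hK : ⌈t⌉₊ ≤ K) (ω : ℕ → ℕ × (ℕ → ℝ × ℝ)) :
    jumpProcess t ω = ∑ k ∈ Finset.range K, ∑ i ∈ Finset.range (ω k).1, jumpAt t k ((ω k).2 i) := by
  refine Finset.sum_subset (Finset.range_mono hK) fun k _ hk => ?_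
  refine Finset.sum_eq_zero fun i _ => ?_
  rw [jumpAt, if_neg]
  rintro ⟨h1, h2⟩
  refine hk (Finset.mem_range.2 (Nat.lt_ceil.2 ?_))
  have : (k : ℝ) < t := by linarith
  exact_mod_cast this

lemma jumpAt_sub {s t : ℝ≥0} (hst : s ≤ t) (k : ℕ) (p : ℝ × ℝ) :
    jumpAt t k p - jumpAt s k p
      = if 0 < p.1 ∧ (s : ℝ) < k + p.1 ∧ k + p.1 ≤ t then p.2 else 0 := by
  have h : (s : ℝ) ≤ t := by exact_mod_cast hst
  unfold jumpAt
  split_ifs <;> grind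

lemma volume_real_jump {s t : ℝ≥0} (hst : s ≤ t) (k : ℕ) :
    (volume.restrict (Ioc (0 : ℝ) 1)).real {u | 0 < u ∧ (s : ℝ) < k + u ∧ k + u ≤ t}
      = min 1 (max 0 ((t : ℝ) - k)) - min 1 (max 0 ((s : ℝ) - k)) := by
  have h : (s : ℝ) ≤ t := by exact_mod_cast hst
  have h1 : {u : ℝ | 0 < u ∧ (s : ℝ) < k + u ∧ k + u ≤ t} ∩ Ioc (0 : ℝ) 1
      = Ioc (min 1 (max 0 ((s : ℝ) - k))) (min 1 (max 0 ((t : ℝ) - k))) := by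
    ext u
    simp only [mem_inter_iff, mem_ofPred_eq, mem_Ioc, min_lt_iff, max_lt_iff, le_min_iff, le_max_iff]
    grind
  rw [measureReal_restrict_apply' measurableSet_Ioc, h1, Real.volume_real_Ioc_of_le]
  gcongr

/-- At most one summand is active, since a jump time lies in at most one of the disjoint increments;
hence e^{i·} - 1 is additive here. -/
lemma exp_sum_ite_sub_one {n : ℕ} (c : Fin n → ℝ) (J : Fin n → Prop) [DecidablePred J]
    (hJ : ∀ i j, J i → J j → i = j) :
    Complex.exp ((∑ j, if J j then c j else 0 : ℝ) * Complex.I) - 1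
      = ∑ j, if J j then Complex.exp (c j * Complex.I) - 1 else 0 := by
  by_cases h : ∃ j, J j
  · obtain ⟨j, hj⟩ := h
    rw [Finset.sum_eq_single j, Finset.sum_eq_single j, if_pos hj, if_pos hj]
    · exact fun i _ hi => if_neg fun h => hi (hJ _ _ h hj)
    · simp
    · exact fun i _ hi => if_neg fun h => hi (hJ _ _ h hj)
    · simp
  · push Not at h
    simp [h]

/-- The compound Poisson process with jump rate `r` and jump distribution `q`. -/
theorem hasIncrementExponent_jumpProcess (r : ℝ≥0) (q : Measure ℝ) [IsProbabilityMeasure q]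
    (lam : Measure ℝ) [IsProbabilityMeasure lam] (hlam : lam = volume.restrict (Ioc (0 : ℝ) 1)) :
    HasIncrementExponent jumpProcess (Measure.infinitePi fun _ : ℕ => poissonMarks r (lam.prod q))
      (fun θ => r * (charVal q (fun v => θ * v) - 1)) where
  measurable t := Finset.measurable_sum _ fun k _ =>
    (measurable_sum_marks (measurable_jumpAt t k)).comp (measurable_pi_apply k)
  start_zero := ae_of_all _ fun ω => by simp [jumpProcess]
  charVal_eq n t ht θ := by
    set K := ⌈t (Fin.last n)⌉₊
    have hK : ∀ j, ⌈t j⌉₊ ≤ K := fun j => Nat.ceil_mono (ht (Fin.le_last j))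
    have ht' : ∀ j : Fin n, t j.castSucc ≤ t j.succ := fun j => ht Fin.castSucc_lt_succ.le
    let G : ℕ → ℝ × ℝ → ℝ := fun k p =>
      ∑ j, θ j * (jumpAt (t j.succ) k p - jumpAt (t j.castSucc) k p)
    have hG : ∀ k, Measurable (G k) := fun k => Finset.measurable_sum _ fun j _ =>
      ((measurable_jumpAt _ k).sub (measurable_jumpAt _ k)).const_mul _
    have h1 : ∀ ω, ∑ j, θ j * (jumpProcess (t j.succ) ω - jumpProcess (t j.castSucc) ω)
        = ∑ k ∈ Finset.range K, ∑ i ∈ Finset.range (ω k).1, G k ((ω k).2 i) := by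
      intro ω
      simp only [jumpProcess_eq (hK _), ← Finset.sum_sub_distrib, Finset.mul_sum, G]
      rw [Finset.sum_comm]
      exact Finset.sum_congr rfl fun k _ => Finset.sum_comm
    simp only [h1]
    rw [charVal_infinitePi_sum _ _ (fun k (b : ℕ × (ℕ → ℝ × ℝ)) =>
      ∑ i ∈ Finset.range b.1, G k (b.2 i)) fun k => measurable_sum_marks (hG k)]
    -- For one mark in the block (k, k + 1], increment j contributes in proportion to its overlap
    -- with the block; summed over blocks, the overlaps give the length of the increment.
    have h2 : ∀ k, charVal (lam.prod q) (G k) - 1 = ∑ j, (min 1 (max 0 ((t j.succ : ℝ) - k))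
        - min 1 (max 0 ((t j.castSucc : ℝ) - k)) : ℝ) * (charVal q (fun v => θ j * v) - 1) := by
      intro k
      let S : Fin n → Set ℝ := fun j => {u | 0 < u ∧ (t j.castSucc : ℝ) < k + u ∧ k + u ≤ t j.succ}
      have hS : ∀ j, MeasurableSet (S j) := fun j =>
        (measurableSet_lt measurable_const measurable_id).inter
          ((measurableSet_lt measurable_const (measurable_const_add (k : ℝ))).inter
            (measurableSet_le (measurable_const_add (k : ℝ)) measurable_const))
      have h3 : ∀ p, Complex.exp (G k p * Complex.I) - 1
          = ∑ j, (S j).indicator 1 p.1 * (Complex.exp ((θ j * p.2 : ℝ) * Complex.I) - 1) := by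
        intro p
        classical
        have h4 := exp_sum_ite_sub_one (fun j => θ j * p.2) (fun j => p.1 ∈ S j) (by
          intro i j hi hj
          by_contra hij
          have key : ∀ i j, p.1 ∈ S i → p.1 ∈ S j → ¬ i < j := by
            intro i j hi hj hlt
            have h5 : (t i.succ : ℝ) ≤ t j.castSucc := by
              exact_mod_cast ht (Fin.succ_le_castSucc_iff.2 hlt)
            have := hi.2.2
            have := hj.2.1
            linarith
          rcases lt_or_gt_of_ne hij with h | h
          · exact key i j hi hj h
          · exact key j i hj hi h)
        have h5 : G k p = ∑ j, if p.1 ∈ S j then θ j * p.2 else 0 := by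
          refine Finset.sum_congr rfl fun j _ => ?_
          rw [jumpAt_sub (ht' j), mul_ite, mul_zero]
          rfl
        rw [h5, h4]
        refine Finset.sum_congr rfl fun j _ => ?_
        rw [indicator_apply]
        split_ifs <;> simp
      have hint : ∀ j : Fin n, Integrable (fun v : ℝ => Complex.exp ((θ j * v : ℝ) * Complex.I) - 1) q :=
        fun j => (integrable_cexp_mul_I (by fun_prop)).sub (integrable_const _)
      have h6 : charVal (lam.prod q) (G k) - 1
          = ∫ p, (Complex.exp (G k p * Complex.I) - 1) ∂(lam.prod q) := by
        rw [integral_sub (integrable_cexp_mul_I (hG k).aemeasurable) (integrable_const _), charVal]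
        simp
      rw [h6]
      simp only [h3]
      rw [integral_finsetSum]
      · refine Finset.sum_congr rfl fun j _ => ?_
        rw [integral_prod_mul (fun u => (S j).indicator (1 : ℝ → ℂ) u)
          (fun v : ℝ => Complex.exp ((θ j * v : ℝ) * Complex.I) - 1),
          integral_sub (integrable_cexp_mul_I (by fun_prop)) (integrable_const _),
          integral_indicator (hS j), ← volume_real_jump (ht' j)]
        simp [charVal, S, hlam]
      · intro j _
        exact Integrable.mul_prod ((integrable_const (1 : ℂ)).indicator (hS j)) (hint j)
    simp only [charVal_poissonMarks r _ (hG _), h2]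
    rw [← Complex.exp_sum]
    congr 1
    rw [← Finset.mul_sum, Finset.sum_comm, Finset.mul_sum]
    refine Finset.sum_congr rfl fun j _ => ?_
    rw [← Finset.sum_mul, ← Complex.ofReal_sum, Finset.sum_sub_distrib, sum_clamp _ (by positivity),
      sum_clamp _ (by positivity), min_eq_right, min_eq_right]
    · ring
    · exact_mod_cast Nat.ceil_le.1 (hK j.castSucc)
    · exact_mod_cast Nat.ceil_le.1 (hK j.succ)

/-- Compound Poisson processes with a given finite jump measure exist. -/
theorem exists_compoundPoisson (m : Measure ℝ) [IsFiniteMeasure m] (hm : m ≠ 0) :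
    ∃ (Ω : Type) (_ : MeasurableSpace Ω) (P : Measure Ω)
    (_ : IsProbabilityMeasure P) (Y : ℝ≥0 → Ω → ℝ),
    HasIncrementExponent Y P fun θ => ∫ x, (Complex.exp ((θ * x : ℝ) * Complex.I) - 1) ∂m := by
  have : IsProbabilityMeasure ((volume : Measure ℝ).restrict (Ioc (0 : ℝ) 1)) := ⟨by simp⟩
  have : NeZero m := ⟨hm⟩
  -- The jump law is m normalized and the jump rate is its total mass.
  have hq : IsProbabilityMeasure ((m univ)⁻¹ • m) := isProbabilityMeasureSMul
  have h := hasIncrementExponent_jumpProcess (m univ).toNNReal ((m univ)⁻¹ • m) _ rfl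
  refine ⟨ℕ → ℕ × (ℕ → ℝ × ℝ), inferInstance, Measure.infinitePi fun _ : ℕ =>
    poissonMarks (m univ).toNNReal ((volume.restrict (Ioc (0 : ℝ) 1)).prod ((m univ)⁻¹ • m)),
    inferInstance, jumpProcess, ?_⟩
  convert h using 2 with θ
  have hne : (m univ).toReal ≠ 0 := (ENNReal.toReal_pos (by simpa using hm) (by simp)).ne'
  rw [integral_sub (integrable_cexp_mul_I (by fun_prop)) (integrable_const _), charVal,
    integral_smul_measure]
  simp only [integral_const, ENNReal.toReal_inv, Complex.real_smul, mul_one, Measure.real]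
  have h2 : ((m univ).toNNReal : ℂ) = ((m univ).toReal : ℂ) := rfl
  have h3 : ((m univ).toReal : ℂ) ≠ 0 := by exact_mod_cast hne
  rw [h2]
  push_cast
  field_simp
  simp only [mul_right_comm _ Complex.I]

end CompoundPoisson


/-! ### Lévy processes with finite activity and hyperexponential processes -/

/-- A Lévy density with finite mass and finite mean belongs to a Lévy process, with any drift and
any Gaussian coefficient. -/
theorem exists_hasCharacteristicTriple {f : ℝ → ℝ} (hf : Measurable f) (hnn : ∀ x, 0 ≤ f x)
    (hint : Integrable f) (hint' : Integrable fun x => x * f x) (hne : ∫ x, f x ≠ 0) (d : ℝ)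
    {σsq : ℝ} (hσ : 0 ≤ σsq) :
    ∃ (Ω : Type) (_ : MeasurableSpace Ω) (P : Measure Ω) (Y : ℝ≥0 → Ω → ℝ),
      IsProbabilityMeasure P ∧ HasCharacteristicTriple Y P (fun x => x) d σsq f := by
  set m : Measure ℝ := volume.withDensity fun x => ENNReal.ofReal (f x)
  have hfin : IsFiniteMeasure m := isFiniteMeasure_withDensity_ofReal hint.2
  have hm : m ≠ 0 := by
    intro h
    have h1 : m univ = 0 := by rw [h]; rfl
    rw [withDensity_apply _ MeasurableSet.univ, Measure.restrict_univ] at h1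
    rw [integral_eq_lintegral_of_nonneg_ae (ae_of_all _ hnn) hf.aestronglyMeasurable, h1] at hne
    simp at hne
  obtain ⟨Ω₁, _, P₁, _, J, hJ⟩ := exists_compoundPoisson m hm
  obtain ⟨Ω₂, _, P₂, _, B, hB⟩ := exists_brownian
  -- The cutoff h(x) = x compensates the whole mean of the jumps, which the compound Poisson part
  -- does not, so the mean is subtracted from the drift.
  have hY := (hJ.add_prod (hB.const_mul (√σsq))).add_drift (d - ∫ x, x * f x)
  have hexp : ∀ θ : ℝ, Integrable fun x : ℝ =>
      (Complex.exp ((θ * x : ℝ) * Complex.I) - 1) * (f x : ℂ) := fun θ => by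
    refine hint.ofReal.bdd_mul (c := 2) (by fun_prop) (ae_of_all _ fun x => ?_)
    refine (norm_sub_le _ _).trans ?_
    rw [Complex.norm_exp_ofReal_mul_I]
    norm_num
  have hmean : ∀ θ : ℝ, Integrable fun x : ℝ => (Complex.I * θ) * ((x * f x : ℝ) : ℂ) :=
    fun θ => hint'.ofReal.const_mul _
  have hlev : ∀ θ x : ℝ, levyIntegrand (fun x => x) f (Complex.I * θ) x
      = (Complex.exp ((θ * x : ℝ) * Complex.I) - 1) * (f x : ℂ)
        - (Complex.I * θ) * ((x * f x : ℝ) : ℂ) := fun θ x => by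
    rw [levyIntegrand, show Complex.I * (θ : ℂ) * x = (θ * x : ℝ) * Complex.I by push_cast; ring]
    push_cast
    ring
  have hmint : ∀ θ : ℝ, ∫ x, (Complex.exp ((θ * x : ℝ) * Complex.I) - 1) ∂m
      = ∫ x, (Complex.exp ((θ * x : ℝ) * Complex.I) - 1) * (f x : ℂ) := fun θ => by
    rw [integral_withDensity_eq_integral_toReal_smul (by fun_prop)
      (ae_of_all _ fun x => ENNReal.ofReal_lt_top)]
    refine integral_congr_ae (ae_of_all _ fun x => ?_)
    simp only
    rw [ENNReal.toReal_ofReal (hnn x), Complex.real_smul, mul_comm]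
  have hη : Continuous fun θ : ℝ => ∫ x, (Complex.exp ((θ * x : ℝ) * Complex.I) - 1) ∂m := by
    refine continuous_of_dominated (bound := fun _ => 2) (fun θ => by fun_prop)
      (fun θ => ae_of_all _ fun x => ?_) (integrable_const _) (ae_of_all _ fun x => by fun_prop)
    refine (norm_sub_le _ _).trans ?_
    rw [Complex.norm_exp_ofReal_mul_I]
    norm_num
  refine ⟨Ω₁ × Ω₂, inferInstance, P₁.prod P₂, _, inferInstance, hY.isLevyProcess ?_, hσ, ?_, ?_,
    hY.hasLaplaceExponent fun θ => ?_⟩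
  · have := hη
    fun_prop
  · refine ⟨hf, hnn, ?_⟩
    refine hint.bdd_mul (c := 1) (by fun_prop) (ae_of_all _ fun x => ?_)
    rw [Real.norm_of_nonneg (le_min zero_le_one (sq_nonneg x))]
    exact min_le_left _ _
  · intro θ
    simp only [funext (hlev θ)]
    exact (hexp θ).sub (hmean θ)
  · rw [levyExponent]
    simp only [hlev]
    rw [integral_sub (hexp θ) (hmean θ), hmint, integral_const_mul,
      integral_complex_ofReal]
    have h1 : ((√σsq * θ) ^ 2 : ℝ) = σsq * θ ^ 2 := by rw [mul_pow, Real.sq_sqrt hσ]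
    rw [h1]
    push_cast
    rw [mul_pow, Complex.I_sq]
    ring

section Quadrature

variable {n : ℕ} {x w : Fin n → ℝ} (p : ℕ)

lemma quadratureDensity_eq_indicator (x w : Fin n → ℝ) : quadratureDensity p x w
    = (Ioi 0).indicator fun y => ∑ i, w i / x i ^ p * Real.exp (-(x i)⁻¹ * y) := by
  funext y
  simp only [quadratureDensity, indicator_apply, mem_Ioi]
  split_ifs
  · exact Finset.sum_congr rfl fun i _ => by
      rw [show -y / x i = -(x i)⁻¹ * y by rw [div_eq_mul_inv]; ring]
  · rfl

lemma quadratureDensity_nonneg (hx : ∀ i, 0 < x i) (hw : ∀ i, 0 < w i) (y : ℝ) :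
    0 ≤ quadratureDensity p x w y := by
  unfold quadratureDensity
  split_ifs
  · exact Finset.sum_nonneg fun i _ => by have := hx i; have := hw i; positivity
  · rfl

lemma measurable_quadratureDensity (x w : Fin n → ℝ) : Measurable (quadratureDensity p x w) := by
  rw [quadratureDensity_eq_indicator]
  exact Measurable.indicator (by fun_prop) measurableSet_Ioi

lemma integrable_pow_mul_quadratureDensity (hx : ∀ i, 0 < x i) (k : ℕ) :
    Integrable fun y => y ^ k * quadratureDensity p x w y := by
  have h1 : (fun y => y ^ k * quadratureDensity p x w y)
      = (Ioi 0).indicator fun y => ∑ i, w i / x i ^ p * (y ^ k * Real.exp (-(x i)⁻¹ * y)) := by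
    rw [quadratureDensity_eq_indicator]
    funext y
    simp only [indicator_apply, mul_ite, mul_zero, Finset.mul_sum, mul_left_comm]
  rw [h1, integrable_indicator_iff measurableSet_Ioi]
  exact integrable_finsetSum _ fun i _ =>
    (integrableOn_pow_mul_exp_neg k (inv_pos.2 (hx i))).const_mul _

lemma integral_quadratureDensity_pos (hn : 1 ≤ n) (hx : ∀ i, 0 < x i) (hw : ∀ i, 0 < w i) :
    0 < ∫ y, quadratureDensity p x w y := by
  rw [quadratureDensity_eq_indicator, integral_indicator measurableSet_Ioi, integral_finsetSum]
  · have : Nonempty (Fin n) := ⟨⟨0, hn⟩⟩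
    refine Finset.sum_pos (fun i _ => ?_) Finset.univ_nonempty
    have h := integral_pow_mul_exp_neg 0 (inv_pos.2 (hx i))
    simp only [pow_zero, one_mul] at h
    rw [integral_const_mul, h]
    have := hx i
    have := hw i
    positivity
  · intro i _
    have h := integrableOn_pow_mul_exp_neg 0 (inv_pos.2 (hx i))
    simp only [pow_zero, one_mul] at h
    exact h.const_mul _

/-- The Laplace exponent of a hyperexponential process. -/
lemma levyExponent_quadratureDensity (hx : ∀ i, 0 < x i) (d σsq : ℝ) {z : ℂ} (hz : z.re ≤ 0) :
    levyExponent (fun x => x) d σsq (quadratureDensity (p + 3) x w) z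
      = σsq * z ^ 2 / 2 + d * z + z ^ 2 * ∑ i, (w i : ℂ) / (x i ^ p * (1 - z * x i)) := by
  rw [levyExponent]
  congr 1
  have h1 : levyIntegrand (fun x => x) (quadratureDensity (p + 3) x w) z
      = (Ioi (0 : ℝ)).indicator fun y : ℝ => ∑ i, ((w i / x i ^ (p + 3) : ℝ) : ℂ) *
        ((Complex.exp (z * y) - 1 - z * y) * (Real.exp (-(x i)⁻¹ * y) : ℂ)) := by
    rw [quadratureDensity_eq_indicator]
    funext y
    simp only [levyIntegrand, indicator_apply]
    split_ifs
    · push_cast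
      rw [Finset.mul_sum]
      exact Finset.sum_congr rfl fun i _ => by ring
    · simp
  have hz' : ∀ i, z.re < (x i)⁻¹ := fun i => hz.trans_lt (inv_pos.2 (hx i))
  rw [h1, integral_indicator measurableSet_Ioi, integral_finsetSum _ fun i _ =>
    (integral_compensated_exp (inv_pos.2 (hx i)) (hz' i)).1.const_mul _, Finset.mul_sum]
  refine Finset.sum_congr rfl fun i _ => ?_
  -- With u = 1/x_i, the value z²/(u²(u - z)) equals z² x_i³/(1 - z x_i), which cancels the three
  -- extra powers of x_i.
  rw [integral_const_mul, (integral_compensated_exp (inv_pos.2 (hx i)) (hz' i)).2]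
  have hxi : (x i : ℂ) ≠ 0 := by exact_mod_cast (hx i).ne'
  have h2 : 1 - z * x i ≠ 0 := by
    intro h
    have h3 := congrArg Complex.re h
    simp only [Complex.sub_re, Complex.one_re, Complex.mul_re, Complex.ofReal_re,
      Complex.ofReal_im, mul_zero, sub_zero, Complex.zero_re] at h3
    nlinarith [hx i]
  have h3 : ((x i : ℂ)⁻¹ - z) = (1 - z * x i) / x i := by field_simp
  push_cast
  rw [h3]
  field_simp
  ring

/-- The mixing measure has an atom of mass w_i / x_i^p at each 1 / x_i. -/
lemma hasHyperexponentialJumps_quadratureDensity (hx : ∀ i, 0 < x i) (hw : ∀ i, 0 < w i) :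
    HasHyperexponentialJumps (quadratureDensity p x w) := by
  let c : Fin n → ℝ := fun i => w i / x i ^ p
  have hc : ∀ i, 0 ≤ c i := fun i => by have := hx i; have := hw i; positivity
  let μ : Measure ℝ := ∑ i, ENNReal.ofReal (c i) • Measure.dirac (x i)⁻¹
  have hint : ∀ f : ℝ → ℝ, Integrable f μ := fun f => by
    refine integrable_finsetSum_measure.2 fun i _ => ?_
    exact (integrable_dirac (by simp)).smul_measure ENNReal.ofReal_ne_top
  have hnull : ∀ s : Set ℝ, MeasurableSet s → (∀ i, (x i)⁻¹ ∉ s) → μ s = 0 := fun s hs h => by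
    simp only [μ, Measure.coe_finsetSum, Finset.sum_apply, Measure.smul_apply,
      Measure.dirac_apply' _ hs, indicator_of_notMem (h _), smul_eq_mul, mul_zero,
      Finset.sum_const_zero]
  have hpos : ∀ i, 0 < (x i)⁻¹ := fun i => inv_pos.2 (hx i)
  refine ⟨μ, ⟨?_, fun y _ => (hint _).integrableOn, ?_, fun y _ => (hint _).integrableOn, ?_⟩, ?_⟩
  · exact hnull _ (measurableSet_singleton 0) fun i => (hpos i).ne'
  · intro y hy
    have h1 : μ.restrict (Ioi 0) = μ := by
      refine Measure.restrict_eq_self_of_ae_mem ?_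
      exact hnull _ measurableSet_Ioi.compl fun i hi => hi (hpos i)
    rw [h1, integral_finsetSum_measure fun i _ =>
      (integrable_dirac (by simp)).smul_measure ENNReal.ofReal_ne_top,
      quadratureDensity_eq_indicator, indicator_of_mem (mem_Ioi.2 hy)]
    refine Finset.sum_congr rfl fun i _ => ?_
    rw [integral_smul_measure, integral_dirac, ENNReal.toReal_ofReal (hc i), smul_eq_mul]
  · intro y hy
    rw [Measure.restrict_eq_zero.2 (hnull _ measurableSet_Iio fun i hi => (hpos i).not_gt hi),
      integral_zero_measure, quadratureDensity, if_neg hy.not_gt]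
  · refine (finite_range fun i => (x i)⁻¹).subset (Measure.support_subset_of_isClosed
      (finite_range _).isClosed ?_)
    exact hnull _ (finite_range _).measurableSet.compl fun i hi => hi (mem_range_self i)

end Quadrature


/-! ### The Laplace exponent on the cut plane -/

section CutPlane

variable {ρ : ℝ}

lemma one_sub_mul_ne_zero {z : ℂ} (hz : z ∈ cutPlane ρ) {v : ℝ} (hρ : 0 < ρ)
    (hv : v ∈ Icc 0 (1 / ρ)) : 1 - z * v ≠ 0 := by
  intro h
  rcases hv.1.eq_or_lt with h0 | h0
  · simp [← h0] at h
  · refine hz ⟨v⁻¹, ?_, ?_⟩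
    · rw [mem_Ici, ← one_div, le_div_comm₀ hρ h0]
      exact hv.2
    · have hv' : (v : ℂ) ≠ 0 := by exact_mod_cast h0.ne'
      push_cast
      rw [← one_div, div_eq_iff hv']
      linear_combination h

lemma isOpen_cutPlane (ρ : ℝ) : IsOpen (cutPlane ρ) :=
  (Complex.isometry_ofReal.isClosedEmbedding.isClosedMap _ isClosed_Ici).isOpen_compl

lemma mem_cutPlane_of_re_lt {z : ℂ} (hz : z.re < ρ) : z ∈ cutPlane ρ := by
  rintro ⟨r, hr, rfl⟩
  exact absurd hz (by simpa using hr)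

lemma differentiableOn_quadratureStieltjes {n : ℕ} {x : Fin n → ℝ} (w : Fin n → ℝ) (hρ : 0 < ρ)
    (hx : ∀ i, x i ∈ Icc 0 (1 / ρ)) :
    DifferentiableOn ℂ (quadratureStieltjes x w) (cutPlane ρ) := by
  unfold quadratureStieltjes
  refine DifferentiableOn.fun_sum fun i _ => ?_
  exact DifferentiableOn.div (by fun_prop) (by fun_prop) fun z hz => one_sub_mul_ne_zero hz hρ (hx i)

/-- The quadrature functions are holomorphic on the cut plane and converge locally uniformly by the
geometric bound, so their limit is holomorphic. -/
lemma IsMomentMeasure.differentiableOn_stieltjes {ν : Measure ℝ} (hρ : 0 < ρ)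
    (hν : IsMomentMeasure ν (1 / ρ)) : DifferentiableOn ℂ (stieltjes ν) (cutPlane ρ) := by
  have hex : ∀ n : ℕ, ∃ x w : Fin (n + 1) → ℝ, IsGaussianQuadrature ν (Icc 0 (1 / ρ)) x w :=
    fun n => hν.exists_isGaussianQuadrature (by omega)
  choose x w hq using hex
  have hlim : TendstoLocallyUniformlyOn (fun n => quadratureStieltjes (x n) (w n)) (stieltjes ν)
      atTop (cutPlane ρ) := by
    rw [tendstoLocallyUniformlyOn_iff_forall_isCompact (isOpen_cutPlane ρ)]
    intro A hAρ hA
    obtain ⟨K, r, hK, hr0, hr1, hb⟩ := exists_geometric_bound hρ hν hA hAρ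
    rw [Metric.tendstoUniformlyOn_iff]
    intro ε hε
    have h1 : Tendsto (fun n : ℕ => K * r ^ (2 * (n + 1))) atTop (𝓝 0) := by
      have h2 : Tendsto (fun n : ℕ => 2 * (n + 1)) atTop atTop :=
        tendsto_atTop_mono (fun n => by simp only [id]; omega) tendsto_id
      simpa using ((tendsto_pow_atTop_nhds_zero_of_lt_one hr0.le hr1).comp h2).const_mul K
    filter_upwards [h1.eventually_lt_const hε] with n hn z hz
    rw [dist_comm, dist_eq_norm]
    exact (hb z hz _ _ _ (by omega) (hq n)).trans_lt hn
  exact hlim.differentiableOn (Eventually.of_forall fun n =>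
    differentiableOn_quadratureStieltjes _ hρ (hq n).mem) (isOpen_cutPlane ρ)

lemma stieltjes_zero {ν : Measure ℝ} : stieltjes ν 0 = (ν.real univ : ℂ) := by
  simp [stieltjes]

lemma IsMomentMeasure.measureReal_univ_pos {ν : Measure ℝ} {L : ℝ} (hν : IsMomentMeasure ν L) :
    0 < ν.real univ := by
  have := hν.isFiniteMeasure
  have h := hν.infinite ∅ finite_empty
  rw [compl_empty] at h
  exact ENNReal.toReal_pos h (measure_ne_top _ _)

end CutPlane

lemma iteratedDeriv_linear_add_sq_mul {f g : ℂ → ℂ} {c : ℂ} (hg : AnalyticAt ℂ g 0)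
    (hf : ∀ᶠ z in 𝓝 0, f z = c * z + z ^ 2 * g z) :
    iteratedDeriv 1 f 0 = c ∧ iteratedDeriv 2 f 0 = 2 * g 0 := by
  have h1 : ∀ᶠ z in 𝓝 (0 : ℂ), deriv f z = c + z * (2 * g z + z * deriv g z) := by
    filter_upwards [hf.eventually_nhds, hg.eventually_analyticAt] with z hz hgz
    have h2 := (EventuallyEq.deriv_eq hz : deriv f z = _)
    rw [h2]
    have h3 := ((hasDerivAt_id z).const_mul c).add
      (((hasDerivAt_id z).pow 2).mul hgz.differentiableAt.hasDerivAt)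
    refine h3.deriv.trans ?_
    simp
    ring
  constructor
  · rw [iteratedDeriv_one, h1.self_of_nhds]
    simp
  · rw [iteratedDeriv_succ, iteratedDeriv_one, (EventuallyEq.deriv_eq h1)]
    have h4 : DifferentiableAt ℂ (fun z => 2 * g z + z * deriv g z) 0 := by
      have := hg.differentiableAt
      have := hg.deriv.differentiableAt
      fun_prop
    have h5 := ((hasDerivAt_id (0 : ℂ)).mul h4.hasDerivAt).const_add c
    refine h5.deriv.trans ?_
    simp

namespace IsOneSidedLevyDensity

variable {π : ℝ → ℝ} {ρ : ℝ} {μ : Measure ℝ}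

/-- Integrate 1/(1 - zv) = 1 + zv/(1 - zv); the factor v raises the power in the measure by one. -/
lemma stieltjes_eq (h : IsOneSidedLevyDensity π ρ) (hμ : IsPosMixing μ π) {z : ℂ} (hz : z ∈ cutPlane ρ) :
    stieltjes (powInvMeasure μ 3) z
      = stieltjes (powInvMeasure μ 3) 0 + z * stieltjes (powInvMeasure μ 4) z := by
  have hν := h.isMomentMeasure hμ (p := 3) le_rfl
  have := hν.isFiniteMeasure
  have h1 : stieltjes (powInvMeasure μ 4) z
      = ∫ v : ℝ, v * (1 - z * v)⁻¹ ∂(powInvMeasure μ 3) :=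
    integral_powInvMeasure_succ hμ 3 (by fun_prop)
  have hint : Integrable (fun v : ℝ => (v : ℂ) * (1 - z * v)⁻¹) (powInvMeasure μ 3) :=
    hν.integrable (ContinuousOn.mul (by fun_prop) (ContinuousOn.inv₀ (by fun_prop)
      fun v hv => one_sub_mul_ne_zero hz h.rate_pos hv))
  rw [h1, stieltjes, stieltjes, ← integral_const_mul, ← integral_add
    (hν.integrable (by simpa using continuousOn_const)) (hint.const_mul z)]
  refine integral_congr_ae ?_
  filter_upwards [hν.ae_mem] with v hv
  have h2 := one_sub_mul_ne_zero hz h.rate_pos (Ioc_subset_Icc_self hv)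
  simp only [zero_mul, sub_zero, inv_one]
  field_simp
  ring

/-- The Taylor expansion of the Laplace exponent at `0`, with its remainder. -/
lemma taylor_eq (h : IsOneSidedLevyDensity π ρ) (hμ : IsPosMixing μ π) {a : ℝ} {ψ : ℂ → ℂ}
    (hψ : ∀ᶠ z in 𝓝 0, ψ z = a * z + z ^ 2 * stieltjes (powInvMeasure μ 3) z) :
    (iteratedDeriv 1 ψ 0 = (a : ℂ) ∧
      iteratedDeriv 2 ψ 0 = ((2 * (powInvMeasure μ 3).real univ : ℝ) : ℂ)) ∧
    ∀ k : ℕ, k = 1 ∨ k = 2 → ∀ z ∈ cutPlane ρ,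
      a * z + z ^ 2 * stieltjes (powInvMeasure μ 3) z
        = ∑ j ∈ Finset.Icc 1 k, iteratedDeriv j ψ 0 / (j.factorial : ℂ) * z ^ j
          + z ^ (k + 1) * stieltjes (powInvMeasure μ (2 + k)) z := by
  have hν := h.isMomentMeasure hμ (p := 3) le_rfl
  have han : AnalyticAt ℂ (stieltjes (powInvMeasure μ 3)) 0 :=
    (hν.differentiableOn_stieltjes h.rate_pos).analyticAt
      ((isOpen_cutPlane ρ).mem_nhds (mem_cutPlane_of_re_lt h.rate_pos))
  obtain ⟨h1, h2⟩ := iteratedDeriv_linear_add_sq_mul han hψ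
  refine ⟨⟨h1, by rw [h2, stieltjes_zero]; push_cast; rfl⟩, ?_⟩
  rintro k (rfl | rfl) z hz
  · simp [h1]
  · rw [Finset.sum_Icc_succ_top (by norm_num), Finset.Icc_self, Finset.sum_singleton, h1,
      h2, h.stieltjes_eq hμ hz]
    simp
    ring

/-- This is the nonnegativity of the Gaussian coefficient for k = 2: the integral of 1/v against v⁴
μ* is the mass of v³ μ*, that is ψ''(0)/2, and the quadrature does not exceed it. -/
lemma sum_div_le_measureReal (h : IsOneSidedLevyDensity π ρ) (hμ : IsPosMixing μ π) {n : ℕ} {x w : Fin n → ℝ}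
    (hq : IsGaussianQuadrature (powInvMeasure μ 4) (Icc 0 (1 / ρ)) x w) :
    ∑ i, w i / x i ≤ (powInvMeasure μ 3).real univ := by
  have hν := h.isMomentMeasure hμ (p := 3) le_rfl
  have h1 : ∫ v : ℝ, ((v⁻¹ : ℝ) : ℂ) ∂(powInvMeasure μ 4)
      = ((powInvMeasure μ 3).real univ : ℂ) := by
    rw [integral_powInvMeasure_succ hμ 3 (g := fun v : ℝ => ((v⁻¹ : ℝ) : ℂ)) (by fun_prop)]
    have h2 : (fun v : ℝ => (v : ℂ) * ((v⁻¹ : ℝ) : ℂ)) =ᵐ[powInvMeasure μ 3] fun _ => 1 := by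
      filter_upwards [hν.ae_mem] with v hv
      have : v ≠ 0 := hv.1.ne'
      rw [← Complex.ofReal_mul, mul_inv_cancel₀ this, Complex.ofReal_one]
    rw [integral_congr_ae h2]
    simp
  rw [integral_complex_ofReal] at h1
  have h2 : ∫ v : ℝ, v⁻¹ ∂(powInvMeasure μ 4) = (powInvMeasure μ 3).real univ := by
    exact_mod_cast h1
  rw [← h2]
  refine IsGaussianQuadrature.sum_div_le (h.isMomentMeasure hμ (by norm_num)) hq ?_
  refine not_imp_comm.1 integral_undef ?_
  rw [h2]
  exact hν.measureReal_univ_pos.ne'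

end IsOneSidedLevyDensity

/-! ### Padé approximants as Laplace exponents -/

/-- The Padé approximants are the Laplace exponents of hyperexponential processes. -/
lemma exists_hyperexponential_process {n : ℕ} {x w : Fin n → ℝ} (hn : 1 ≤ n) (hx : ∀ i, 0 < x i)
    (hw : ∀ i, 0 < w i) {k : ℕ} (hk : k = 1 ∨ k = 2) {d₁ d₂ : ℝ} {ψ R : ℂ → ℂ}
    (h1 : iteratedDeriv 1 ψ 0 = (d₁ : ℂ)) (h2 : iteratedDeriv 2 ψ 0 = (d₂ : ℂ))
    (hσ : k = 2 → 0 ≤ d₂ - 2 * ∑ i, w i / x i)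
    (hR : ∀ z : ℂ, (∀ i, 1 - z * x i ≠ 0) →
      R z = ∑ j ∈ Finset.Icc 1 k, iteratedDeriv j ψ 0 * z ^ j / (j.factorial : ℂ)
        + z ^ (k + 1) * ∑ i, (w i : ℂ) / (1 - z * x i)) :
    ∃ (Ω' : Type) (_ : MeasurableSpace Ω') (P' : Measure Ω') (Y : ℝ≥0 → Ω' → ℝ),
      IsProbabilityMeasure P' ∧
      HasCharacteristicTriple Y P' (fun x => x) d₁ (if k = 1 then 0 else d₂ - 2 * ∑ i, w i / x i)
        (quadratureDensity (2 + k) x w) ∧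
      HasLaplaceExponent Y P' R := by
  have hint0 := integrable_pow_mul_quadratureDensity (w := w) (2 + k) hx 0
  have hint1 := integrable_pow_mul_quadratureDensity (w := w) (2 + k) hx 1
  simp only [pow_zero, one_mul, pow_one] at hint0 hint1
  have hσ' : 0 ≤ (if k = 1 then 0 else d₂ - 2 * ∑ i, w i / x i) := by
    split_ifs with hk1
    · exact le_rfl
    · exact hσ (hk.resolve_left hk1)
  obtain ⟨Ω', mΩ', P', Y, hP', hY⟩ := exists_hasCharacteristicTriple
    (measurable_quadratureDensity (2 + k) x w) (quadratureDensity_nonneg (2 + k) hx hw) hint0 hint1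
    (integral_quadratureDensity_pos (2 + k) hn hx hw).ne' d₁ hσ'
  refine ⟨Ω', mΩ', P', Y, hP', hY, fun t θ => ?_⟩
  rw [hY.laplaceExponent t θ]
  congr 2
  have hre : (Complex.I * (θ : ℂ)).re ≤ 0 := by simp
  set z : ℂ := Complex.I * θ
  have hz : ∀ i, 1 - z * x i ≠ 0 := by
    intro i hi
    have h3 := congrArg Complex.re hi
    simp [z] at h3
  rw [hR z hz]
  rcases hk with rfl | rfl
  · rw [show 2 + 1 = 0 + 3 from rfl, levyExponent_quadratureDensity 0 hx d₁ _ hre]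
    simp [h1]
  · rw [show 2 + 2 = 1 + 3 from rfl, levyExponent_quadratureDensity 1 hx d₁ _ hre,
      Finset.sum_Icc_succ_top (by norm_num), Finset.Icc_self, Finset.sum_singleton, h1, h2]
    -- The constant parts w_i/x_i add up to the z² term that the subtraction in the Gaussian
    -- coefficient cancels; the rest is the z³ term of the approximant.
    have h4 : ∀ i, (w i : ℂ) / ((x i : ℂ) ^ 1 * (1 - z * x i))
        = w i / x i + z * (w i / (1 - z * x i)) := fun i => by
      have hxi : (x i : ℂ) ≠ 0 := by exact_mod_cast (hx i).ne'
      have : 1 - (x i : ℂ) * z ≠ 0 := by rw [mul_comm]; exact hz i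
      rw [mul_comm z (x i : ℂ)]
      field_simp
      ring
    simp only [h4, Finset.sum_add_distrib, ← Finset.mul_sum]
    norm_num
    ring

end LevyPade

/-! ### Assembly of the theorem -/

theorem theorem4 {Ω : Type*} [MeasurableSpace Ω] (P : Measure Ω) [IsProbabilityMeasure P]
    (X : ℝ≥0 → Ω → ℝ) (a ρ : ℝ) (π : ℝ → ℝ)
    (hX : LevyPade.HasCharacteristicTriple X P (fun x => x) a 0 π)
    (hCM : LevyPade.IsClassCM π ⊤ (ENNReal.ofReal ρ))
    (hpos : ∀ x < 0, π x = 0)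
    (hvar : ¬ LevyPade.HasFiniteVariationJumps π) :
    -- the measure `μ` of the mixture-of-exponentials representation of `π` exists
    (∃ μ : Measure ℝ, LevyPade.IsMixingMeasure μ π) ∧
    -- the Laplace exponent, continued analytically to the cut plane
    ∃ ψ : ℂ → ℂ,
      DifferentiableOn ℂ ψ (LevyPade.cutPlane ρ) ∧
      (∀ z : ℂ, z.re < ρ →
        Integrable (LevyPade.levyIntegrand (fun x => x) π z) ∧
        ψ z = LevyPade.levyExponent (fun x => x) a 0 π z) ∧
      LevyPade.HasLaplaceExponent X P ψ ∧
      ∃ d₁ d₂ : ℝ, iteratedDeriv 1 ψ 0 = (d₁ : ℂ) ∧ iteratedDeriv 2 ψ 0 = (d₂ : ℂ) ∧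
      ∀ k : ℕ, k = 1 ∨ k = 2 →
        -- the Padé approximants exist and are unique
        (∀ n : ℕ, 1 ≤ n → ∃! R : ℂ → ℂ, LevyPade.IsPadeApproximant ψ 0 (n + k) n R) ∧
        (∀ μ : Measure ℝ, LevyPade.IsMixingMeasure μ π → ∀ n : ℕ, 1 ≤ n →
          (∃ x w : Fin n → ℝ, LevyPade.IsGaussianQuadrature
            (LevyPade.powInvMeasure μ (2 + k)) (Icc 0 (1 / ρ)) x w) ∧
          ∀ x w : Fin n → ℝ, LevyPade.IsGaussianQuadrature
            (LevyPade.powInvMeasure μ (2 + k)) (Icc 0 (1 / ρ)) x w →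
          ∀ R : ℂ → ℂ, LevyPade.IsPadeApproximant ψ 0 (n + k) n R →
            (∀ i, 0 < x i) ∧
            -- (i)
            (∀ z : ℂ, (∀ i, 1 - z * x i ≠ 0) →
              R z = ∑ j ∈ Finset.Icc 1 k, iteratedDeriv j ψ 0 * z ^ j / (j.factorial : ℂ)
                + z ^ (k + 1) * ∑ i, (w i : ℂ) / (1 - z * x i)) ∧
            -- (ii)
            LevyPade.HasHyperexponentialJumps (LevyPade.quadratureDensity (2 + k) x w) ∧
            ∃ (Ω' : Type) (_ : MeasurableSpace Ω') (P' : Measure Ω') (Y : ℝ≥0 → Ω' → ℝ),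
              IsProbabilityMeasure P' ∧
              LevyPade.HasCharacteristicTriple Y P' (fun x => x) d₁
                (if k = 1 then 0 else d₂ - 2 * ∑ i, w i / x i)
                (LevyPade.quadratureDensity (2 + k) x w) ∧
              LevyPade.HasLaplaceExponent Y P' R) ∧
        -- (iii)
        (∀ R : ℕ → ℂ → ℂ,
          (∀ n : ℕ, 1 ≤ n → LevyPade.IsPadeApproximant ψ 0 (n + k) n (R n)) →
          ∀ A : Set ℂ, IsCompact A → A ⊆ LevyPade.cutPlane ρ →
            ∃ c₁ c₂ : ℝ, 0 < c₁ ∧ 0 < c₂ ∧ ∀ n : ℕ, 1 ≤ n → ∀ z ∈ A,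
              ‖R n z - ψ z‖ < c₁ * Real.exp (-c₂ * n)) := by
  have hρ : 0 < ρ := ENNReal.ofReal_pos.1 hCM.rate_pos_pos
  have hπ := hX.isLevyDensity
  have h : LevyPade.IsOneSidedLevyDensity π ρ :=
    ⟨hπ, hρ, fun c hc => hCM.integrableOn_exp_mul hπ hc, hpos, hvar⟩
  obtain ⟨μ₀, hμ₀⟩ := hCM.exists_isMixingMeasure hπ hpos
  have hμ₀' := hμ₀.isPosMixing hpos
  have hν : ∀ {μ : Measure ℝ}, LevyPade.IsPosMixing μ π → ∀ {k : ℕ}, k = 1 ∨ k = 2 →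
      LevyPade.IsMomentMeasure (LevyPade.powInvMeasure μ (2 + k)) (1 / ρ) := fun hμ k hk =>
    h.isMomentMeasure hμ (by omega)
  refine ⟨⟨μ₀, hμ₀⟩, ?_⟩
  let ψ : ℂ → ℂ := fun z => a * z + z ^ 2 * LevyPade.stieltjes (LevyPade.powInvMeasure μ₀ 3) z
  have hψlev : ∀ z : ℂ, z.re < ρ → ψ z = LevyPade.levyExponent (fun x => x) a 0 π z :=
    fun z hz => (h.levyExponent_eq hμ₀' a hz).symm
  -- ψ is defined through one mixing measure, but every other one yields the same Lévy–Khintchine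
  -- integral near 0, so uniqueness of the mixing measure is not required.
  have hψloc : ∀ μ : Measure ℝ, LevyPade.IsPosMixing μ π →
      ∀ᶠ z in 𝓝 0, ψ z = a * z + z ^ 2 * LevyPade.stieltjes (LevyPade.powInvMeasure μ 3) z := by
    intro μ hμ
    have : ∀ᶠ z : ℂ in 𝓝 0, z.re < ρ :=
      Complex.continuous_re.continuousAt.eventually_lt_const (by simpa using hρ)
    filter_upwards [this] with z hz
    rw [hψlev z hz, h.levyExponent_eq hμ a hz]
  have hcut : ∀ᶠ z : ℂ in 𝓝 0, z ∈ LevyPade.cutPlane ρ :=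
    (LevyPade.isOpen_cutPlane ρ).mem_nhds (LevyPade.mem_cutPlane_of_re_lt hρ)
  have htaylor := fun μ (hμ : LevyPade.IsPosMixing μ π) => h.taylor_eq hμ (hψloc μ hμ)
  obtain ⟨⟨hd₁, hd₂⟩, htaylor₀⟩ := htaylor μ₀ hμ₀'
  have hpade : ∀ {μ : Measure ℝ}, LevyPade.IsPosMixing μ π → ∀ {k : ℕ}, k = 1 ∨ k = 2 →
      ∀ {n : ℕ}, 1 ≤ n → ∀ {x w : Fin n → ℝ}, LevyPade.IsGaussianQuadrature
        (LevyPade.powInvMeasure μ (2 + k)) (Icc 0 (1 / ρ)) x w →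
      ∃ R, LevyPade.IsPadeApproximant ψ 0 (n + k) n R ∧ ∀ z : ℂ, (∀ i, 1 - z * x i ≠ 0) →
        R z = ∑ j ∈ Finset.Icc 1 k, iteratedDeriv j ψ 0 / (j.factorial : ℂ) * z ^ j
          + z ^ (k + 1) * LevyPade.quadratureStieltjes x w z := by
    intro μ hμ k hk n hn x w hq
    refine LevyPade.exists_isPadeApproximant (hν hμ hk) hq hn ?_
    filter_upwards [hψloc μ hμ, hcut] with z hz hzc
    rw [hz, (htaylor μ hμ).2 k hk z hzc]
  refine ⟨ψ, ?_, fun z hz => ⟨h.integrable_levyIntegrand hz, hψlev z hz⟩, ?_, a,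
    2 * (LevyPade.powInvMeasure μ₀ 3).real univ, hd₁, hd₂, fun k hk => ⟨?_, ?_, ?_⟩⟩
  · have hS := (h.isMomentMeasure hμ₀' (p := 3) le_rfl).differentiableOn_stieltjes hρ
    exact DifferentiableOn.add (by fun_prop) (DifferentiableOn.mul (by fun_prop) hS)
  · intro t θ
    rw [hX.laplaceExponent t θ, hψlev _ (by simpa using hρ)]
  · intro n hn
    obtain ⟨x, w, hq⟩ := (hν hμ₀' hk).exists_isGaussianQuadrature hn
    obtain ⟨R, hR, -⟩ := hpade hμ₀' hk hn hq
    exact ⟨R, hR, fun R' hR' => hR'.unique hR⟩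
  · intro μ hμ n hn
    have hμ' := hμ.isPosMixing hpos
    refine ⟨(hν hμ' hk).exists_isGaussianQuadrature hn, fun x w hq R hR => ?_⟩
    have hx := LevyPade.IsGaussianQuadrature.node_pos (hν hμ' hk) hq
    obtain ⟨R', hR', hform⟩ := hpade hμ' hk hn hq
    obtain rfl := hR.unique hR'
    have hform' : ∀ z : ℂ, (∀ i, 1 - z * x i ≠ 0) →
        R z = ∑ j ∈ Finset.Icc 1 k, iteratedDeriv j ψ 0 * z ^ j / (j.factorial : ℂ)
          + z ^ (k + 1) * ∑ i, (w i : ℂ) / (1 - z * x i) := by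
      intro z hz
      rw [hform z hz, LevyPade.quadratureStieltjes]
      simp only [div_mul_eq_mul_div]
    refine ⟨hx, hform', LevyPade.hasHyperexponentialJumps_quadratureDensity _ hx hq.weight_pos,
      LevyPade.exists_hyperexponential_process hn hx hq.weight_pos hk hd₁ hd₂ ?_ hform'⟩
    rintro rfl
    have h1 := h.sum_div_le_measureReal hμ' hq
    have h2 := hd₂.symm.trans (htaylor μ hμ').1.2
    -- The masses of v³ μ* agree for the two mixing measures because both are ψ''(0)/2.
    have h3 : 2 * (LevyPade.powInvMeasure μ₀ 3).real univ
        = 2 * (LevyPade.powInvMeasure μ 3).real univ := by exact_mod_cast h2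
    linarith
  · intro R hR A hA hAρ
    obtain ⟨K, r, hK, hr0, hr1, hb⟩ := LevyPade.exists_geometric_bound hρ (hν hμ₀' hk) hA hAρ
    obtain ⟨M, hM⟩ := hA.exists_bound_of_continuousOn (f := fun z : ℂ => z ^ (k + 1))
      (by fun_prop)
    -- M bounds the prefactor z^{k+1} on A; the added 1 makes the constant positive and the
    -- inequality strict. The rate is chosen so that e^{-c₂n} = r^{2n}.
    refine ⟨|M| * K + 1, -2 * Real.log r, by positivity,
      by have := Real.log_neg hr0 hr1; linarith, fun n hn z hz => ?_⟩
    obtain ⟨x, w, hq⟩ := (hν hμ₀' hk).exists_isGaussianQuadrature hn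
    obtain ⟨R', hR', hform⟩ := hpade hμ₀' hk hn hq
    have hexp : Real.exp (-(-2 * Real.log r) * n) = r ^ (2 * n) := by
      rw [← Real.exp_log (pow_pos hr0 (2 * n)), Real.log_pow]
      congr 1
      push_cast
      ring
    rw [(hR n hn).unique hR', hexp, hform z fun i =>
      LevyPade.one_sub_mul_ne_zero (hAρ hz) hρ (hq.mem i)]
    simp only [ψ]
    rw [htaylor₀ k hk z (hAρ hz), add_sub_add_left_eq_sub, ← mul_sub, norm_mul]
    have h1 : ‖z ^ (k + 1)‖ ≤ |M| := (hM z hz).trans (le_abs_self M)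
    calc _ ≤ |M| * (K * r ^ (2 * n)) := by gcongr; exact hb z hz n x w hn hq
      _ < (|M| * K + 1) * r ^ (2 * n) := by
        have := pow_pos hr0 (2 * n)
        linarith
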